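/- Let $M^3(c)$ be a $3$-dimensional Sasakian space form, i.e. a complete connected smooth Riemannian $3$-manifold $(M,g)$ with a smooth vector field $\xi$, $1$-form $\eta$ and endomorphism field $\varphi$ satisfying $$\varphi^2=-I+\eta\otimes\xi,\quad \eta(\xi)=1,\quad g(\varphi X,\varphi Y)=g(X,Y)-\eta(X)\eta(Y),\quad g(\xi,\cdot)=\eta,$$ $$d\eta(X,Y)=2g(X,\varphi Y),\quad (\nabla_X\varphi)Y=g(X,Y)\xi-\eta(Y)X$$ (with $d\eta(X,Y)=X\eta(Y)-Y\eta(X)-\eta([X,Y])$ and $\nabla$ the Levi-Civita connection), and such that every $\varphi$-invariant tangent plane has sectional curvature $c$. Assume that $M$ is regular: the trajectories of $\xi$ are defined on all of $\mathbb{R}$ and are the fibres of a surjective Riemannian submersion $\pi:M\to\bar M$ onto a Riemannian surface, the orbit space. Let $\bar\gamma:J\to\bar M$ be a smooth curve parametrised by arc length on an open interval $J$, and let $\iota:S\to M$ be the Hopf cylinder over $\bar\gamma$, i.e. the inverse image $S=\pi^{-1}(\bar\gamma)$ regarded as an isometrically immersed surface (locally the fibre product of $\bar\gamma$ and $\pi$,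 every point of the fibre product being attained). Let $\mathbb{H}=\frac12\operatorname{tr}(\nabla d\iota)$ be the mean curvature vector field of $S$ and $H$ the mean curvature, so that $H^2=|\mathbb{H}|^2$. For a section $V$ of $\iota^*TM$ put $$\mathcal{J}_\iota(V)=-\sum_{i=1}^{2}\left(\nabla^\iota_{e_i}\nabla^\iota_{e_i}V-\nabla^\iota_{\nabla^S_{e_i}e_i}V\right)-\sum_{i=1}^{2}R(V,d\iota(e_i))\,d\iota(e_i),$$ where $\nabla^\iota$ is the induced connection of $\iota^*TM$, $\nabla^S$ the Levi-Civita connection of $S$, $(e_1,e_2)$ a local orthonormal frame of $S$ and $R(X,Y)=[\nabla_X,\nabla_Y]-\nabla_{[X,Y]}$ (the Jacobi operator of the energy). Then there is a constant $\lambda\in\mathbb{R}$ with $\mathcal{J}_\iota(\mathbb{H})=\lambda\mathbb{H}$ on $S$ if and only if $\bar\gamma$ is a geodesic ($\bar\nabla_{\bar\gamma'}\bar\gamma'=0$) or a Riemannian circle (there are a constant $\kappa>0$ and a unit normal field $p$ along $\bar\gamma$ with $\bar\nabla_{\bar\gamma'}\bar\gamma'=\kappa p$ and $\bar\nabla_{\bar\gamma'}p=-\kappa\bar\gamma'$).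 Moreover, if $\mathcal{J}_\iota(\mathbb{H})=\lambda\mathbb{H}$ and $\bar\gamma$ is not a geodesic, then $\lambda=4H^2+1-c$. -/

import Mathlib

open Bundle FiberBundle Set Filter
open scoped Manifold ContDiff Topology

noncomputable section LeviCivita

variable {E : Type*} [NormedAddCommGroup E] [NormedSpace ℝ E]
  {H : Type*} [TopologicalSpace H] {I : ModelWithCorners ℝ E H}
  {M : Type*} [TopologicalSpace M] [ChartedSpace H M]
  [RiemannianBundle (fun x : M ↦ TangentSpace I x)]

/-- The right-hand side of Koszul's formula for `2 g(∇_X Y, Z)`. -/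
def koszul (X Y Z : Π x : M, TangentSpace I x) (x : M) : ℝ :=
  mvfderiv I (fun y ↦ inner ℝ (Y y) (Z y)) x (X x)
    + mvfderiv I (fun y ↦ inner ℝ (X y) (Z y)) x (Y x)
    - mvfderiv I (fun y ↦ inner ℝ (X y) (Y y)) x (Z x)
    + inner ℝ (VectorField.mlieBracket I X Y x) (Z x)
    - inner ℝ (VectorField.mlieBracket I X Z x) (Y x)
    - inner ℝ (VectorField.mlieBracket I Y Z x) (X x)

variable [FiniteDimensional ℝ E] [IsManifold I ∞ M]
  [IsContMDiffRiemannianBundle I ∞ E (fun x : M ↦ TangentSpace I x)]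

instance finiteDimensional_tangentSpace (x : M) : FiniteDimensional ℝ (TangentSpace I x) :=
  inferInstanceAs (FiniteDimensional ℝ E)

set_option linter.unusedSectionVars false in
theorem mdifferentiableAt_inner {x : M} {Y Z : Π x : M, TangentSpace I x}
    (hY : MDiffAt (T% Y) x) (hZ : MDiffAt (T% Z) x) :
    MDiffAt (fun y ↦ inner ℝ (Y y) (Z y)) x :=
  MDifferentiableAt.inner_bundle (E := fun x : M ↦ TangentSpace I x) hY hZ

theorem koszul_tensorial_left (x : M) {Y Z : Π x : M, TangentSpace I x}
    (hY : MDiffAt (T% Y) x) (hZ : MDiffAt (T% Z) x) :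
    TensorialAt I E (fun X ↦ koszul X Y Z x) x where
  smul {f X} hf hX := by
    have := FiniteDimensional.complete ℝ E
    simp [koszul, mvfderiv_fun_mul hf (mdifferentiableAt_inner hX hZ),
      mvfderiv_fun_mul hf (mdifferentiableAt_inner hX hY),
      VectorField.mlieBracket_smul_left hf hX, inner_smul_left, inner_add_left, inner_smul_right]
    simp [real_inner_comm]
    ring
  add {X X'} hX hX' := by
    have := FiniteDimensional.complete ℝ E
    simp [koszul, mvfderiv_fun_add (mdifferentiableAt_inner hX hZ) (mdifferentiableAt_inner hX' hZ),
      mvfderiv_fun_add (mdifferentiableAt_inner hX hY) (mdifferentiableAt_inner hX' hY),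
      VectorField.mlieBracket_add_left hX hX', inner_add_left, inner_add_right]
    ring

theorem koszul_tensorial_right (x : M) {X Y : Π x : M, TangentSpace I x}
    (hX : MDiffAt (T% X) x) (hY : MDiffAt (T% Y) x) :
    TensorialAt I E (fun Z ↦ koszul X Y Z x) x where
  smul {f Z} hf hZ := by
    have := FiniteDimensional.complete ℝ E
    simp [koszul, mvfderiv_fun_mul hf (mdifferentiableAt_inner hX hZ),
      mvfderiv_fun_mul hf (mdifferentiableAt_inner hY hZ),
      VectorField.mlieBracket_smul_right hf hZ, inner_smul_left, inner_add_left, inner_smul_right]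
    simp [real_inner_comm]
    ring
  add {Z Z'} hZ hZ' := by
    have := FiniteDimensional.complete ℝ E
    simp [koszul, mvfderiv_fun_add (mdifferentiableAt_inner hX hZ) (mdifferentiableAt_inner hX hZ'),
      mvfderiv_fun_add (mdifferentiableAt_inner hY hZ) (mdifferentiableAt_inner hY hZ'),
      VectorField.mlieBracket_add_right hZ hZ', inner_add_left, inner_add_right]
    ring


theorem koszul_smul_middle {x : M} {X Y Z : Π x : M, TangentSpace I x} {f : M → ℝ}
    (hX : MDiffAt (T% X) x) (hY : MDiffAt (T% Y) x) (hZ : MDiffAt (T% Z) x) (hf : MDiffAt f x) :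
    koszul X (f • Y) Z x
      = f x * koszul X Y Z x + 2 * (mvfderiv I f x (X x) * inner ℝ (Y x) (Z x)) := by
  have := FiniteDimensional.complete ℝ E
  simp [koszul, mvfderiv_fun_mul hf (mdifferentiableAt_inner hX hY),
    mvfderiv_fun_mul hf (mdifferentiableAt_inner hY hZ),
    VectorField.mlieBracket_smul_right hf hY, VectorField.mlieBracket_smul_left hf hY,
    inner_smul_left, inner_add_left, inner_smul_right]
  simp [real_inner_comm]
  ring

theorem koszul_add_middle {x : M} {X Y Y' Z : Π x : M, TangentSpace I x}
    (hX : MDiffAt (T% X) x) (hY : MDiffAt (T% Y) x) (hY' : MDiffAt (T% Y') x)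
    (hZ : MDiffAt (T% Z) x) :
    koszul X (Y + Y') Z x = koszul X Y Z x + koszul X Y' Z x := by
  have := FiniteDimensional.complete ℝ E
  simp [koszul, mvfderiv_fun_add (mdifferentiableAt_inner hX hY) (mdifferentiableAt_inner hX hY'),
    mvfderiv_fun_add (mdifferentiableAt_inner hY hZ) (mdifferentiableAt_inner hY' hZ),
    VectorField.mlieBracket_add_right hY hY', VectorField.mlieBracket_add_left hY hY',
    inner_add_left, inner_add_right]
  ring

/-- `(u, w) ↦ 2 g(∇_u Y, w)` at `x`. -/
def koszulHom (Y : Π x : M, TangentSpace I x) (x : M) (hY : MDiffAt (T% Y) x) :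
    TangentSpace I x →L[ℝ] TangentSpace I x →L[ℝ] ℝ :=
  TensorialAt.mkHom₂ (I := I) (F := E) (F' := E) (fun X Z ↦ koszul X Y Z x) x
    (fun _ hZ ↦ koszul_tensorial_left x hY hZ) (fun _ hX ↦ koszul_tensorial_right x hX hY)

open Classical in
/-- The covariant derivative `∇Y` given by Koszul's formula, as a linear map `u ↦ ∇_u Y` on
`T_x M`; it has the value `0` where `Y` is not differentiable. -/
def leviCivitaFun (Y : Π x : M, TangentSpace I x) (x : M) :
    TangentSpace I x →L[ℝ] TangentSpace I x :=
  haveI : CompleteSpace (TangentSpace I x) := FiniteDimensional.complete ℝ _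
  if hY : MDiffAt (T% Y) x then
    LinearMap.toContinuousLinearMap
      { toFun := fun u ↦ (1 / 2 : ℝ) •
          (InnerProductSpace.toDual ℝ (TangentSpace I x)).symm (koszulHom Y x hY u)
        map_add' := by intro u v; simp
        map_smul' := by intro a u; simp [smul_comm a] }
  else 0

theorem inner_leviCivitaFun {x : M} {X Y Z : Π x : M, TangentSpace I x}
    (hX : MDiffAt (T% X) x) (hY : MDiffAt (T% Y) x) (hZ : MDiffAt (T% Z) x) :
    inner ℝ (leviCivitaFun Y x (X x)) (Z x) = (1 / 2) * koszul X Y Z x := by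
  have : CompleteSpace (TangentSpace I x) := FiniteDimensional.complete ℝ _
  have h := TensorialAt.mkHom₂_apply (I := I) (F := E) (F' := E)
    (Φ := fun X Z ↦ koszul X Y Z x) (x := x)
    (fun _ hZ ↦ koszul_tensorial_left x hY hZ) (fun _ hX ↦ koszul_tensorial_right x hX hY) hX hZ
  simp only [leviCivitaFun, hY, dif_pos]
  simp only [LinearMap.coe_toContinuousLinearMap', LinearMap.coe_mk, AddHom.coe_mk,
    real_inner_smul_left, InnerProductSpace.toDual_symm_apply]
  rw [← h]; rfl

theorem leviCivitaFun_eq {x : M} {Y : Π x : M, TangentSpace I x} (hY : MDiffAt (T% Y) x)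
    (A : TangentSpace I x →L[ℝ] TangentSpace I x)
    (h : ∀ X Z : Π x : M, TangentSpace I x, MDiffAt (T% X) x → MDiffAt (T% Z) x →
      inner ℝ (A (X x)) (Z x) = (1 / 2) * koszul X Y Z x) :
    leviCivitaFun Y x = A := by
  ext u
  refine ext_inner_right ℝ fun w ↦ ?_
  have hu := mdifferentiableAt_extend I E u
  have hw := mdifferentiableAt_extend I E w
  have h1 := inner_leviCivitaFun hu hY hw
  have h2 := h _ _ hu hw
  simp only [extend_apply_self] at h1 h2
  rw [h1, h2]

variable (I M) in
/-- The Levi-Civita connection of a Riemannian manifold. -/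
def leviCivita : CovariantDerivative I E (fun x : M ↦ TangentSpace I x) where
  toFun := leviCivitaFun
  isCovariantDerivativeOnUniv :=
    { add := fun {Y Y' x} hY hY' _ ↦ by
        refine leviCivitaFun_eq (mdifferentiableAt_add_section hY hY') _ fun X Z hX hZ ↦ ?_
        have h1 := inner_leviCivitaFun hX hY hZ
        have h2 := inner_leviCivitaFun hX hY' hZ
        have h3 := koszul_add_middle hX hY hY' hZ
        simp only [add_apply, inner_add_left]
        rw [h1, h2, h3]; ring
      leibniz := fun {Y f x} hY hf _ ↦ by
        refine leviCivitaFun_eq (hf.smul_section hY) _ fun X Z hX hZ ↦ ?_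
        have h1 := inner_leviCivitaFun hX hY hZ
        have h3 := koszul_smul_middle hX hY hZ hf
        simp only [add_apply, smul_apply,
          ContinuousLinearMap.smulRight_apply, inner_add_left, real_inner_smul_left]
        rw [h1, h3]; ring }

theorem inner_leviCivita {x : M} {X Y Z : Π x : M, TangentSpace I x}
    (hX : MDiffAt (T% X) x) (hY : MDiffAt (T% Y) x) (hZ : MDiffAt (T% Z) x) :
    inner ℝ (leviCivita I M Y x (X x)) (Z x) = (1 / 2) * koszul X Y Z x :=
  inner_leviCivitaFun hX hY hZ

theorem leviCivita_torsion [CompleteSpace E] : (leviCivita I M).torsion = 0 := by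
  refine (CovariantDerivative.torsion_eq_zero_iff _).2 fun {X Y x} hX hY ↦ ?_
  refine ext_inner_right ℝ fun w ↦ ?_
  have hw := mdifferentiableAt_extend I E w
  have h1 := inner_leviCivita hX hY hw
  have h2 := inner_leviCivita hY hX hw
  simp only [extend_apply_self] at h1 h2
  rw [inner_sub_left, h1, h2]
  simp only [koszul, extend_apply_self, VectorField.mlieBracket_swap_apply (V := Y) (W := X),
    real_inner_comm, inner_neg_left]
  ring

theorem leviCivita_metric {x : M} {X Y Z : Π x : M, TangentSpace I x}
    (hX : MDiffAt (T% X) x) (hY : MDiffAt (T% Y) x) (hZ : MDiffAt (T% Z) x) :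
    mvfderiv I (fun y ↦ inner ℝ (Y y) (Z y)) x (X x)
      = inner ℝ (leviCivita I M Y x (X x)) (Z x) + inner ℝ (Y x) (leviCivita I M Z x (X x)) := by
  have h1 := inner_leviCivita hX hY hZ
  have h2 := inner_leviCivita hX hZ hY
  rw [real_inner_comm _ (Y x), h1, h2]
  simp only [koszul, VectorField.mlieBracket_swap_apply (V := Z) (W := Y),
    real_inner_comm, inner_neg_left]
  ring

/-- The Riemannian curvature `R(u, v)w = ∇_U ∇_V W - ∇_V ∇_U W - ∇_{[U, V]} W` at `x`, where
`U, V, W` are local smooth extensions of `u, v, w` (the value does not depend on them). -/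
def curvatureTensor (x : M) (u v w : TangentSpace I x) : TangentSpace I x :=
  leviCivita I M (fun y ↦ leviCivita I M (extend E w) y (extend E v y)) x u
    - leviCivita I M (fun y ↦ leviCivita I M (extend E w) y (extend E u y)) x v
    - leviCivita I M (extend E w) x (VectorField.mlieBracket I (extend E u) (extend E v) x)

end LeviCivita

noncomputable section Maps

variable {E : Type*} [NormedAddCommGroup E] [NormedSpace ℝ E] [FiniteDimensional ℝ E]
  {H : Type*} [TopologicalSpace H] {I : ModelWithCorners ℝ E H}
  {M : Type*} [TopologicalSpace M] [ChartedSpace H M] [IsManifold I ∞ M]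
  [RiemannianBundle (fun x : M ↦ TangentSpace I x)]
  [IsContMDiffRiemannianBundle I ∞ E (fun x : M ↦ TangentSpace I x)]
  {E' : Type*} [NormedAddCommGroup E'] [NormedSpace ℝ E']
  {H' : Type*} [TopologicalSpace H'] {I' : ModelWithCorners ℝ E' H'}
  {N : Type*} [TopologicalSpace N] [ChartedSpace H' N]

variable (I I') in
/-- The induced connection `∇^f` of `f^*TM` for a map `f : N → M`: the linear map `u ↦ ∇^f_u V`
on `T_x N`. In the local frame `(e_i)` of `TM` that comes from the trivialization at `f x`, a
section `V = ∑ V^i (e_i ∘ f)` has `∇^f_u V = ∑ dV^i(u) e_i + ∑ V^i ∇_{df(u)} e_i`. -/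
def covAlong (f : N → M) (V : Π y : N, TangentSpace I (f y)) (x : N) :
    TangentSpace I' x →L[ℝ] TangentSpace I (f x) :=
  (trivializationAt E (TangentSpace I : M → Type _) (f x)).symmL ℝ (f x) ∘L
      mvfderiv I' (fun y ↦ (trivializationAt E (TangentSpace I : M → Type _) (f x)
        (TotalSpace.mk' E (f y) (V y))).2) x
    + leviCivita I M (extend E (V x)) (f x) ∘L mfderiv I' I f x

variable [FiniteDimensional ℝ E'] [IsManifold I' ∞ N]
  [RiemannianBundle (fun x : N ↦ TangentSpace I' x)]
  [IsContMDiffRiemannianBundle I' ∞ E' (fun x : N ↦ TangentSpace I' x)]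

variable (I I') in
/-- The second fundamental form `(∇df)(u, v) = ∇^f_u (df(V)) - df(∇_u V)` of a map `f : N → M`,
where `V` is a local smooth extension of `v`. -/
def hessianMap (f : N → M) (x : N) (u v : TangentSpace I' x) : TangentSpace I (f x) :=
  covAlong I I' f (fun y ↦ mfderiv I' I f y (extend E' v y)) x u
    - mfderiv I' I f x (leviCivita I' N (extend E' v) x u)

variable (I I') in
/-- The tension field `tr (∇df)`. -/
def tensionField (f : N → M) (x : N) : TangentSpace I (f x) :=
  ∑ i, hessianMap I I' f x (stdOrthonormalBasis ℝ (TangentSpace I' x) i)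
    (stdOrthonormalBasis ℝ (TangentSpace I' x) i)

variable (I I') in
/-- The mean curvature vector field `ℍ = (1 / dim N) tr (∇df)` of an isometric immersion. -/
def meanCurvatureVector (f : N → M) (x : N) : TangentSpace I (f x) :=
  (Module.finrank ℝ E' : ℝ)⁻¹ • tensionField I I' f x

variable (I I') in
/-- The second covariant derivative `∇^f_u ∇^f_{W} V - ∇^f_{∇_u W} V` of a section `V` of
`f^*TM`, where `W` is a local smooth extension of `w`. -/
def secondCovAlong (f : N → M) (V : Π y : N, TangentSpace I (f y)) (x : N)
    (u w : TangentSpace I' x) : TangentSpace I (f x) :=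
  covAlong I I' f (fun y ↦ covAlong I I' f V y (extend E' w y)) x u
    - covAlong I I' f V x (leviCivita I' N (extend E' w) x u)

variable (I I') in
/-- The rough Laplacian `-∑ (∇^f_{e_i} ∇^f_{e_i} V - ∇^f_{∇_{e_i} e_i} V)`. -/
def roughLaplacian (f : N → M) (V : Π y : N, TangentSpace I (f y)) (x : N) :
    TangentSpace I (f x) :=
  -∑ i, secondCovAlong I I' f V x (stdOrthonormalBasis ℝ (TangentSpace I' x) i)
    (stdOrthonormalBasis ℝ (TangentSpace I' x) i)

variable (I I') in
/-- The curvature term `∑ R(V, df(e_i)) df(e_i)`. -/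
def curvatureTerm (f : N → M) (V : Π y : N, TangentSpace I (f y)) (x : N) :
    TangentSpace I (f x) :=
  ∑ i, curvatureTensor (f x) (V x)
    (mfderiv I' I f x (stdOrthonormalBasis ℝ (TangentSpace I' x) i))
    (mfderiv I' I f x (stdOrthonormalBasis ℝ (TangentSpace I' x) i))

variable (I I') in
/-- The Jacobi operator of the energy at the map `f`. -/
def jacobiOperator (f : N → M) (V : Π y : N, TangentSpace I (f y)) (x : N) :
    TangentSpace I (f x) :=
  roughLaplacian I I' f V x - curvatureTerm I I' f V x

end Maps

noncomputable section Curves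

variable {E : Type*} [NormedAddCommGroup E] [NormedSpace ℝ E] [FiniteDimensional ℝ E]
  {H : Type*} [TopologicalSpace H] (I : ModelWithCorners ℝ E H)
  {M : Type*} [TopologicalSpace M] [ChartedSpace H M] [IsManifold I ∞ M]
  [RiemannianBundle (fun x : M ↦ TangentSpace I x)]
  [IsContMDiffRiemannianBundle I ∞ E (fun x : M ↦ TangentSpace I x)]

/-- The velocity `γ'(s)`. -/
def velocity (γ : ℝ → M) (s : ℝ) : TangentSpace I (γ s) :=
  mfderiv 𝓘(ℝ, ℝ) I γ s (1 : ℝ)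

/-- The covariant derivative `∇_{γ'} V` of a vector field `V` along `γ`. -/
def covCurve (γ : ℝ → M) (V : Π s : ℝ, TangentSpace I (γ s)) (s : ℝ) : TangentSpace I (γ s) :=
  covAlong I 𝓘(ℝ, ℝ) γ V s (1 : ℝ)

/-- `γ` is a smooth curve on `J`, parametrized by arc length. -/
structure IsUnitSpeedOn (γ : ℝ → M) (J : Set ℝ) : Prop where
  smooth : ContMDiffOn 𝓘(ℝ, ℝ) I ∞ γ J
  norm_velocity : ∀ s ∈ J, ‖velocity I γ s‖ = 1

/-- `∇_{γ'} γ' = 0` on `J`. -/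
def IsGeodesicOn (γ : ℝ → M) (J : Set ℝ) : Prop :=
  ∀ s ∈ J, covCurve I γ (velocity I γ) s = 0

/-- The unit speed curve `γ` is a Riemannian circle on `J`: with a constant `κ > 0` and a unit
normal field `p` along `γ` it satisfies the Frenet equations `∇_{γ'} γ' = κ p` and
`∇_{γ'} p = -κ γ'` (constant curvature and no torsion; `p` is smooth as `p = κ⁻¹ ∇_{γ'} γ'`). -/
def IsRiemannianCircleOn (γ : ℝ → M) (J : Set ℝ) : Prop :=
  ∃ κ : ℝ, 0 < κ ∧ ∃ p : Π s : ℝ, TangentSpace I (γ s), ∀ s ∈ J,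
    ‖p s‖ = 1 ∧ inner ℝ (velocity I γ s) (p s) = 0 ∧
    covCurve I γ (velocity I γ) s = κ • p s ∧
    covCurve I γ p s = -(κ • velocity I γ s)

end Curves

section Sasaki

variable {E : Type*} [NormedAddCommGroup E] [NormedSpace ℝ E] [FiniteDimensional ℝ E]
  {H : Type*} [TopologicalSpace H] (I : ModelWithCorners ℝ E H)
  {M : Type*} [TopologicalSpace M] [ChartedSpace H M] [IsManifold I ∞ M]
  [RiemannianBundle (fun x : M ↦ TangentSpace I x)]
  [IsContMDiffRiemannianBundle I ∞ E (fun x : M ↦ TangentSpace I x)]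

/-- `(η, ξ, φ, g)` is a Sasaki structure, `g` being the given Riemannian metric of `M`. The
exterior derivative is `dη(X, Y) = X(η(Y)) - Y(η(X)) - η([X, Y])`. In dimension three `η` is
a contact form by `sq`, `metric`, `metric_xi` and `d_eta`: for a unit vector `u` orthogonal to `ξ`,
`dη(u, φ u) = -2`. -/
structure IsSasakian (ξ : Π x : M, TangentSpace I x) (η : Π x : M, TangentSpace I x →L[ℝ] ℝ)
    (φ : Π x : M, TangentSpace I x →L[ℝ] TangentSpace I x) : Prop where
  smooth_xi : ContMDiff I I.tangent ∞ (fun x ↦ TotalSpace.mk' E x (ξ x))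
  smooth_eta : ContMDiff I (I.prod 𝓘(ℝ, E →L[ℝ] ℝ)) ∞
    (fun x ↦ TotalSpace.mk' (E →L[ℝ] ℝ)
      (E := fun x : M ↦ TangentSpace I x →L[ℝ] Bundle.Trivial M ℝ x) x (η x))
  smooth_phi : ContMDiff I (I.prod 𝓘(ℝ, E →L[ℝ] E)) ∞
    (fun x ↦ TotalSpace.mk' (E →L[ℝ] E)
      (E := fun x : M ↦ TangentSpace I x →L[ℝ] TangentSpace I x) x (φ x))
  sq : ∀ (x : M) (u : TangentSpace I x), φ x (φ x u) = -u + η x u • ξ x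
  eta_xi : ∀ x : M, η x (ξ x) = 1
  metric : ∀ (x : M) (u v : TangentSpace I x),
    inner ℝ (φ x u) (φ x v) = inner ℝ u v - η x u * η x v
  metric_xi : ∀ (x : M) (u : TangentSpace I x), inner ℝ (ξ x) u = η x u
  d_eta : ∀ (X Y : Π x : M, TangentSpace I x) (x : M), MDiffAt (T% X) x → MDiffAt (T% Y) x →
    mvfderiv I (fun y ↦ η y (Y y)) x (X x) - mvfderiv I (fun y ↦ η y (X y)) x (Y x)
      - η x (VectorField.mlieBracket I X Y x) = 2 * inner ℝ (X x) (φ x (Y x))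
  /-- `(∇_u φ)Y = g(u, Y)ξ - η(Y)u` -/
  cov_phi : ∀ (Y : Π x : M, TangentSpace I x) (x : M) (u : TangentSpace I x),
    MDiffAt (T% Y) x →
    leviCivita I M (fun y ↦ φ y (Y y)) x u - φ x (leviCivita I M Y x u)
      = (inner ℝ u (Y x) : ℝ) • ξ x - η x (Y x) • u

/-- Every holomorphic plane (a tangent plane invariant under `φ`) has sectional curvature `c`. -/
def HasConstHolSectionalCurvature (φ : Π x : M, TangentSpace I x →L[ℝ] TangentSpace I x)
    (c : ℝ) : Prop :=
  ∀ (x : M) (u v : TangentSpace I x), ‖u‖ = 1 → ‖v‖ = 1 → inner ℝ u v = 0 →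
    (∀ w ∈ Submodule.span ℝ {u, v}, φ x w ∈ Submodule.span ℝ {u, v}) →
    inner ℝ (curvatureTensor x u v v) u = c

/-- A Sasakian space form: a complete connected Sasaki manifold of constant holomorphic sectional
curvature `c`. -/
structure IsSasakianSpaceForm {M : Type*} [EMetricSpace M] [ChartedSpace H M] [IsManifold I ∞ M]
    [RiemannianBundle (fun x : M ↦ TangentSpace I x)]
    [IsContMDiffRiemannianBundle I ∞ E (fun x : M ↦ TangentSpace I x)]
    [IsRiemannianManifold I M] (ξ : Π x : M, TangentSpace I x)
    (η : Π x : M, TangentSpace I x →L[ℝ] ℝ)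
    (φ : Π x : M, TangentSpace I x →L[ℝ] TangentSpace I x) (c : ℝ) : Prop where
  complete : CompleteSpace M
  connected : ConnectedSpace M
  sasakian : IsSasakian I ξ η φ
  curvature : HasConstHolSectionalCurvature I φ c

end Sasaki

section HopfCylinder

variable {M : Type*} [TopologicalSpace M] [ChartedSpace (EuclideanSpace ℝ (Fin 3)) M]
  [RiemannianBundle (fun x : M ↦ TangentSpace (𝓡 3) x)]
  {B : Type*} [TopologicalSpace B] [ChartedSpace (EuclideanSpace ℝ (Fin 2)) B]
  [RiemannianBundle (fun x : B ↦ TangentSpace (𝓡 2) x)]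
  {S : Type*} [TopologicalSpace S] [ChartedSpace (EuclideanSpace ℝ (Fin 2)) S]
  [RiemannianBundle (fun x : S ↦ TangentSpace (𝓡 2) x)]

/-- `pr : M → B` exhibits the surface `B` as the orbit space of the flow of `ξ`, with the metric
for which `pr` is a Riemannian submersion: the fibres of `pr` are the trajectories of `ξ` (which are
defined on all of `ℝ`), and `dpr` is isometric on the vectors orthogonal to `ξ`. -/
structure IsBoothbyWangFibration (ξ : Π x : M, TangentSpace (𝓡 3) x) (pr : M → B) : Prop where
  smooth : ContMDiff (𝓡 3) (𝓡 2) ∞ pr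
  surjective : Function.Surjective pr
  fibre : ∀ p q : M, pr p = pr q ↔
    ∃ θ : ℝ → M, IsMIntegralCurve θ ξ ∧ θ 0 = p ∧ ∃ t : ℝ, θ t = q
  isometric : ∀ (p : M) (u v : TangentSpace (𝓡 3) p),
    inner ℝ (ξ p) u = 0 → inner ℝ (ξ p) v = 0 →
    inner ℝ (mfderiv (𝓡 3) (𝓡 2) pr p u) (mfderiv (𝓡 3) (𝓡 2) pr p v) = inner ℝ u v

/-- Near `x ∈ S`, the map `pr ∘ ι` runs along the curve `γ : J → B` with smooth parameter `σ`. -/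
def IsParameterAt (pr : M → B) (γ : ℝ → B) (J : Set ℝ) (ι : S → M) (σ : S → ℝ) (x : S) : Prop :=
  ContMDiffAt (𝓡 2) 𝓘(ℝ, ℝ) ∞ σ x ∧ ∀ᶠ y in 𝓝 x, σ y ∈ J ∧ pr (ι y) = γ (σ y)

/-- The surface `S`, isometrically immersed by `ι`, is the Hopf cylinder `pr⁻¹(γ)` over the curve
`γ : J → B`. Locally `S` is mapped into the fibre product `{(s, p) | s ∈ J, pr p = γ s}`
(necessarily by a diffeomorphism onto an open set), and every point of the fibre product is
attained; so the image of `ι` is `pr⁻¹(γ(J))`. The fibre product itself, the submanifold `pr⁻¹(γ(J))`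
for an embedded curve and the torus `pr⁻¹(γ(ℝ))` for a periodic one are all covered;
self-intersections of `γ` are allowed. -/
structure IsHopfCylinder (pr : M → B) (γ : ℝ → B) (J : Set ℝ) (ι : S → M) : Prop where
  smooth : ContMDiff (𝓡 2) (𝓡 3) ∞ ι
  isometric : ∀ (x : S) (u v : TangentSpace (𝓡 2) x),
    inner ℝ (mfderiv (𝓡 2) (𝓡 3) ι x u) (mfderiv (𝓡 2) (𝓡 3) ι x v) = inner ℝ u v
  exists_parameter : ∀ x : S, ∃ σ : S → ℝ, IsParameterAt pr γ J ι σ x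
  exists_point : ∀ s ∈ J, ∀ p : M, pr p = γ s →
    ∃ (x : S) (σ : S → ℝ), ι x = p ∧ σ x = s ∧ IsParameterAt pr γ J ι σ x

end HopfCylinder

set_option linter.unusedSectionVars false

noncomputable section SectionsAlongMaps

variable {E : Type*} [NormedAddCommGroup E] [NormedSpace ℝ E]
  {H : Type*} [TopologicalSpace H] {I : ModelWithCorners ℝ E H}
  {M : Type*} [TopologicalSpace M] [ChartedSpace H M] [IsManifold I ∞ M]
  {E' : Type*} [NormedAddCommGroup E'] [NormedSpace ℝ E']
  {H' : Type*} [TopologicalSpace H'] {I' : ModelWithCorners ℝ E' H'}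
  {N : Type*} [TopologicalSpace N] [ChartedSpace H' N]
  {E'' : Type*} [NormedAddCommGroup E''] [NormedSpace ℝ E'']
  {H'' : Type*} [TopologicalSpace H''] {I'' : ModelWithCorners ℝ E'' H''}
  {P : Type*} [TopologicalSpace P] [ChartedSpace H'' P]
  {n m : WithTop ℕ∞} {f : N → M} {x : N}

variable (I I') in
/-- A vector field `V` along `f : N → M`, i.e. a section of `f^*TM`, is of class `C^n` at `x`. -/
def ContMDiffAlongAt (n : WithTop ℕ∞) (f : N → M) (V : Π y : N, TangentSpace I (f y)) (x : N) :
    Prop :=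
  ContMDiffAt I' I.tangent n (fun y ↦ (TotalSpace.mk' E (f y) (V y) : TangentBundle I M)) x

variable (I) in
/-- The coordinates of the vector field `V` along `f` in the trivialization of `TM` at `p`. -/
def coordAlong (p : M) (f : N → M) (V : Π y : N, TangentSpace I (f y)) (y : N) : E :=
  (trivializationAt E (TangentSpace I : M → Type _) p (TotalSpace.mk' E (f y) (V y))).2

theorem mvfderiv_congr {F : Type*} [NormedAddCommGroup F] [NormedSpace ℝ F] {g g' : N → F}
    (h : ∀ᶠ y in 𝓝 x, g y = g' y) : mvfderiv I' g x = mvfderiv I' g' x := by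
  ext u
  simp only [mvfderiv, EventuallyEq.mfderiv_eq h]
  rfl

theorem contMDiffAlongAt_iff {V : Π y : N, TangentSpace I (f y)} :
    ContMDiffAlongAt I I' n f V x ↔
      ContMDiffAt I' I n f x ∧ ContMDiffAt I' 𝓘(ℝ, E) n (coordAlong I (f x) f V) x :=
  contMDiffAt_totalSpace

theorem ContMDiffAlongAt.contMDiffAt {V : Π y : N, TangentSpace I (f y)}
    (hV : ContMDiffAlongAt I I' n f V x) : ContMDiffAt I' I n f x :=
  (contMDiffAlongAt_iff.1 hV).1

theorem ContMDiffAlongAt.coord {V : Π y : N, TangentSpace I (f y)}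
    (hV : ContMDiffAlongAt I I' n f V x) :
    ContMDiffAt I' 𝓘(ℝ, E) n (coordAlong I (f x) f V) x :=
  (contMDiffAlongAt_iff.1 hV).2

theorem ContMDiffAlongAt.congr {V W : Π y : N, TangentSpace I (f y)}
    (hV : ContMDiffAlongAt I I' n f V x) (h : ∀ᶠ y in 𝓝 x, W y = V y) :
    ContMDiffAlongAt I I' n f W x :=
  ContMDiffAt.congr_of_eventuallyEq hV (h.mono fun y hy ↦ by simp only [hy])

theorem ContMDiffAlongAt.of_le {V : Π y : N, TangentSpace I (f y)}
    (hV : ContMDiffAlongAt I I' n f V x) (h : m ≤ n) : ContMDiffAlongAt I I' m f V x :=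
  ContMDiffAt.of_le hV h

theorem ContMDiffAlongAt.eventually [IsManifold I' ∞ N] {V : Π y : N, TangentSpace I (f y)}
    (hV : ContMDiffAlongAt I I' n f V x) (hn : n < ∞) :
    ∀ᶠ y in 𝓝 x, ContMDiffAlongAt I I' n f V y := by
  have : IsManifold I' n N := .of_le hn.le
  have : IsManifold I.tangent n (TangentBundle I M) := .of_le (n := ∞) hn.le
  exact (contMDiffAt_iff_contMDiffAt_nhds hn.ne).1 hV

theorem eventually_mem_baseSet (hf : ContinuousAt f x) :
    ∀ᶠ y in 𝓝 x, f y ∈ (trivializationAt E (TangentSpace I : M → Type _) (f x)).baseSet :=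
  hf.eventually ((trivializationAt E (TangentSpace I : M → Type _) (f x)).open_baseSet.mem_nhds
    (FiberBundle.mem_baseSet_trivializationAt' (f x)))

theorem coordAlong_eq {p : M} {V : Π y : N, TangentSpace I (f y)} {y : N}
    (hy : f y ∈ (trivializationAt E (TangentSpace I : M → Type _) p).baseSet) :
    coordAlong I p f V y
      = (trivializationAt E (TangentSpace I : M → Type _) p).continuousLinearEquivAt ℝ (f y) hy
        (V y) := rfl

theorem coordAlong_add {p : M} {V W : Π y : N, TangentSpace I (f y)} {y : N}
    (hy : f y ∈ (trivializationAt E (TangentSpace I : M → Type _) p).baseSet) :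
    coordAlong I p f (V + W) y = coordAlong I p f V y + coordAlong I p f W y := by
  simp only [coordAlong_eq hy, Pi.add_apply, map_add]

theorem coordAlong_smul {p : M} {g : N → ℝ} {V : Π y : N, TangentSpace I (f y)} {y : N}
    (hy : f y ∈ (trivializationAt E (TangentSpace I : M → Type _) p).baseSet) :
    coordAlong I p f (g • V) y = g y • coordAlong I p f V y := by
  simp only [coordAlong_eq hy, Pi.smul_apply', map_smul]

theorem symmL_coordAlong {V : Π y : N, TangentSpace I (f y)} {p : M} {y : N}
    (hy : f y ∈ (trivializationAt E (TangentSpace I : M → Type _) p).baseSet) :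
    (trivializationAt E (TangentSpace I : M → Type _) p).symmL ℝ (f y) (coordAlong I p f V y)
      = V y := by
  rw [coordAlong_eq hy, Trivialization.coe_continuousLinearEquivAt_eq _ hy]
  exact Trivialization.symmL_continuousLinearMapAt (R := ℝ) _ hy _

theorem ContMDiffAlongAt.add {V W : Π y : N, TangentSpace I (f y)}
    (hV : ContMDiffAlongAt I I' n f V x) (hW : ContMDiffAlongAt I I' n f W x) :
    ContMDiffAlongAt I I' n f (V + W) x := by
  refine contMDiffAlongAt_iff.2 ⟨hV.contMDiffAt, (hV.coord.add hW.coord).congr_of_eventuallyEq ?_⟩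
  exact (eventually_mem_baseSet hV.contMDiffAt.continuousAt).mono fun y hy ↦ coordAlong_add hy

theorem ContMDiffAlongAt.smul {g : N → ℝ} {V : Π y : N, TangentSpace I (f y)}
    (hg : ContMDiffAt I' 𝓘(ℝ, ℝ) n g x) (hV : ContMDiffAlongAt I I' n f V x) :
    ContMDiffAlongAt I I' n f (g • V) x := by
  refine contMDiffAlongAt_iff.2 ⟨hV.contMDiffAt, (hg.smul hV.coord).congr_of_eventuallyEq ?_⟩
  exact (eventually_mem_baseSet hV.contMDiffAt.continuousAt).mono fun y hy ↦ coordAlong_smul hy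

theorem ContMDiffAlongAt.zero (hf : ContMDiffAt I' I n f x) :
    ContMDiffAlongAt I I' n f 0 x := by
  refine contMDiffAlongAt_iff.2 ⟨hf, contMDiffAt_const (c := (0 : E)) |>.congr_of_eventuallyEq ?_⟩
  exact (eventually_mem_baseSet hf.continuousAt).mono fun y hy ↦ by
    rw [coordAlong_eq hy]; exact map_zero _

theorem ContMDiffAlongAt.sum {ι : Type*} {s : Finset ι} {V : ι → Π y : N, TangentSpace I (f y)}
    (hf : ContMDiffAt I' I n f x) (hV : ∀ i ∈ s, ContMDiffAlongAt I I' n f (V i) x) :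
    ContMDiffAlongAt I I' n f (∑ i ∈ s, V i) x := by
  classical
  induction s using Finset.induction_on with
  | empty => simpa using ContMDiffAlongAt.zero hf
  | insert a s ha ih =>
    rw [Finset.sum_insert ha]
    exact (hV a (by simp)).add (ih fun i hi ↦ hV i (by simp [hi]))

/-- Restriction of a vector field along `f` to a map into the source of `f`. -/
theorem ContMDiffAlongAt.comp {g : P → N} {z : P} {V : Π y : N, TangentSpace I (f y)}
    (hV : ContMDiffAlongAt I I' n f V (g z)) (hg : ContMDiffAt I'' I' n g z) :
    ContMDiffAlongAt I I'' n (f ∘ g) (fun y ↦ V (g y)) z :=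
  ContMDiffAt.comp z hV hg

theorem contMDiffAlongAt_comp {V : Π p : M, TangentSpace I p}
    (hV : ContMDiffAt I I.tangent n (T% V) (f x)) (hf : ContMDiffAt I' I n f x) :
    ContMDiffAlongAt I I' n f (fun y ↦ V (f y)) x :=
  ContMDiffAt.comp x hV hf

theorem contMDiffAlongAt_mfderiv [IsManifold I' ∞ N] {Y : Π y : N, TangentSpace I' y}
    (hf : ContMDiffAt I' I n f x) (hY : ContMDiffAt I' I'.tangent m (T% Y) x) (hmn : m + 1 ≤ n) :
    ContMDiffAlongAt I I' m f (fun y ↦ mfderiv I' I f y (Y y)) x := by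
  have h1 := hf.mfderiv_const hmn
  exact ContMDiffAt.clm_apply_of_inCoordinates (b₁ := id) h1 hY (hf.of_le (le_self_add.trans hmn))

theorem contMDiffAt_mvfderiv_apply [IsManifold I' ∞ N] {g : N → E} {Y : Π y : N, TangentSpace I' y}
    (hg : ContMDiffAt I' 𝓘(ℝ, E) n g x) (hY : ContMDiffAt I' I'.tangent m (T% Y) x)
    (hmn : m + 1 ≤ n) :
    ContMDiffAt I' 𝓘(ℝ, E) m (fun y ↦ mvfderiv I' g y (Y y)) x := by
  have h1 : ContMDiffAlongAt 𝓘(ℝ, E) I' m g (fun y ↦ mfderiv I' 𝓘(ℝ, E) g y (Y y)) x :=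
    contMDiffAlongAt_mfderiv hg hY hmn
  refine h1.coord.congr_of_eventuallyEq (.of_forall fun y ↦ ?_)
  simp [coordAlong, trivializationAt_model_space_apply]
  rfl

end SectionsAlongMaps

noncomputable section CovAlong

variable {E : Type*} [NormedAddCommGroup E] [NormedSpace ℝ E] [FiniteDimensional ℝ E]
  {H : Type*} [TopologicalSpace H] {I : ModelWithCorners ℝ E H}
  {M : Type*} [TopologicalSpace M] [ChartedSpace H M] [IsManifold I ∞ M]
  [RiemannianBundle (fun x : M ↦ TangentSpace I x)]
  [IsContMDiffRiemannianBundle I ∞ E (fun x : M ↦ TangentSpace I x)]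
  {E' : Type*} [NormedAddCommGroup E'] [NormedSpace ℝ E']
  {H' : Type*} [TopologicalSpace H'] {I' : ModelWithCorners ℝ E' H'}
  {N : Type*} [TopologicalSpace N] [ChartedSpace H' N]
  {E'' : Type*} [NormedAddCommGroup E''] [NormedSpace ℝ E'']
  {H'' : Type*} [TopologicalSpace H''] {I'' : ModelWithCorners ℝ E'' H''}
  {P : Type*} [TopologicalSpace P] [ChartedSpace H'' P]
  {n m : WithTop ℕ∞} {f : N → M} {x : N}

section Extend

theorem extend_add {p : M} (v w : TangentSpace I p) :
    ∀ᶠ q in 𝓝 p, extend E (v + w) q = extend E v q + extend E w q := by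
  set t := trivializationAt E (TangentSpace I : M → Type _) p
  have hp : p ∈ t.baseSet := FiberBundle.mem_baseSet_trivializationAt' p
  have h : (t ⟨p, v + w⟩).2 = (t ⟨p, v⟩).2 + (t ⟨p, w⟩).2 :=
    map_add (t.continuousLinearEquivAt ℝ p hp) v w
  filter_upwards [t.open_baseSet.mem_nhds hp] with q hq
  change t.symm q (t ⟨p, v + w⟩).2 = t.symm q (t ⟨p, v⟩).2 + t.symm q (t ⟨p, w⟩).2
  rw [h, ← t.symmL_apply (R := ℝ) hq, ← t.symmL_apply (R := ℝ) hq, ← t.symmL_apply (R := ℝ) hq,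
    map_add]

theorem extend_smul {p : M} (a : ℝ) (v : TangentSpace I p) :
    ∀ᶠ q in 𝓝 p, extend E (a • v) q = a • extend E v q := by
  set t := trivializationAt E (TangentSpace I : M → Type _) p
  have hp : p ∈ t.baseSet := FiberBundle.mem_baseSet_trivializationAt' p
  have h : (t ⟨p, a • v⟩).2 = a • (t ⟨p, v⟩).2 :=
    map_smul (t.continuousLinearEquivAt ℝ p hp) a v
  filter_upwards [t.open_baseSet.mem_nhds hp] with q hq
  change t.symm q (t ⟨p, a • v⟩).2 = a • t.symm q (t ⟨p, v⟩).2
  rw [h, ← t.symmL_apply (R := ℝ) hq, ← t.symmL_apply (R := ℝ) hq, map_smul]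

theorem eventually_coordAlong_extend {p : M} (v : TangentSpace I p) :
    ∀ᶠ q in 𝓝 p, coordAlong I p (fun q : M ↦ q) (extend E v) q
      = (trivializationAt E (TangentSpace I : M → Type _) p ⟨p, v⟩).2 := by
  set t := trivializationAt E (TangentSpace I : M → Type _) p
  have hp : p ∈ t.baseSet := FiberBundle.mem_baseSet_trivializationAt' p
  filter_upwards [t.open_baseSet.mem_nhds hp] with q hq
  have h := congrArg Prod.snd (t.apply_mk_symm hq (t ⟨p, v⟩).2)
  exact h

end Extend

theorem leviCivita_add {V W : Π q : M, TangentSpace I q} {p : M}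
    (hV : MDiffAt (T% V) p) (hW : MDiffAt (T% W) p) :
    leviCivita I M (V + W) p = leviCivita I M V p + leviCivita I M W p :=
  (leviCivita I M).isCovariantDerivativeOnUniv.add hV hW

theorem leviCivita_smul {g : M → ℝ} {V : Π q : M, TangentSpace I q} {p : M}
    (hg : MDiffAt g p) (hV : MDiffAt (T% V) p) :
    leviCivita I M (g • V) p = g p • leviCivita I M V p + (mvfderiv I g p).smulRight (V p) :=
  (leviCivita I M).isCovariantDerivativeOnUniv.leibniz hV hg

theorem leviCivita_const_smul (a : ℝ) {V : Π q : M, TangentSpace I q} {p : M}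
    (hV : MDiffAt (T% V) p) : leviCivita I M (a • V) p = a • leviCivita I M V p :=
  (leviCivita I M).isCovariantDerivativeOnUniv.smul_const a hV

theorem leviCivita_congr {V W : Π q : M, TangentSpace I q} {p : M}
    (hV : MDiffAt (T% V) p) (h : ∀ᶠ q in 𝓝 p, V q = W q) :
    leviCivita I M V p = leviCivita I M W p := by
  have hW : MDiffAt (T% W) p :=
    hV.congr_of_eventuallyEq (h.mono fun q hq ↦ by simp only [hq])
  exact (leviCivita I M).isCovariantDerivativeOnUniv.congr_of_eventuallyEq hV hW univ_mem h

theorem covAlong_apply (V : Π y : N, TangentSpace I (f y)) (u : TangentSpace I' x) :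
    covAlong I I' f V x u
      = (trivializationAt E (TangentSpace I : M → Type _) (f x)).symmL ℝ (f x)
          (mvfderiv I' (coordAlong I (f x) f V) x u)
        + leviCivita I M (extend E (V x)) (f x) (mfderiv I' I f x u) := rfl

theorem covAlong_congr {V W : Π y : N, TangentSpace I (f y)} (h : ∀ᶠ y in 𝓝 x, V y = W y) :
    covAlong I I' f V x = covAlong I I' f W x := by
  have h1 : coordAlong I (f x) f V =ᶠ[𝓝 x] coordAlong I (f x) f W :=
    h.mono fun y hy ↦ by simp only [coordAlong, hy]
  ext u
  rw [covAlong_apply, covAlong_apply, h.self_of_nhds, mvfderiv_congr h1]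

theorem covAlong_add_of_coord {V W : Π y : N, TangentSpace I (f y)} (hf : ContinuousAt f x)
    (hV : MDifferentiableAt I' 𝓘(ℝ, E) (coordAlong I (f x) f V) x)
    (hW : MDifferentiableAt I' 𝓘(ℝ, E) (coordAlong I (f x) f W) x) :
    covAlong I I' f (V + W) x = covAlong I I' f V x + covAlong I I' f W x := by
  have h1 : coordAlong I (f x) f (V + W) =ᶠ[𝓝 x] coordAlong I (f x) f V + coordAlong I (f x) f W :=
    (eventually_mem_baseSet hf).mono fun y hy ↦ coordAlong_add hy
  have h2 : mvfderiv I' (coordAlong I (f x) f (V + W)) x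
      = mvfderiv I' (coordAlong I (f x) f V) x + mvfderiv I' (coordAlong I (f x) f W) x := by
    rw [← mvfderiv_add hV hW, mvfderiv_congr h1]
  ext u
  rw [add_apply, covAlong_apply, covAlong_apply, covAlong_apply, h2, Pi.add_apply,
    leviCivita_congr (mdifferentiableAt_extend I E _) (extend_add _ _),
    show (fun q ↦ extend E (V x) q + extend E (W x) q) = extend E (V x) + extend E (W x) from rfl,
    leviCivita_add (mdifferentiableAt_extend I E _) (mdifferentiableAt_extend I E _)]
  simp only [add_apply, map_add]
  abel

theorem covAlong_smul_of_coord {g : N → ℝ} {V : Π y : N, TangentSpace I (f y)}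
    (hf : ContinuousAt f x) (hg : MDifferentiableAt I' 𝓘(ℝ, ℝ) g x)
    (hV : MDifferentiableAt I' 𝓘(ℝ, E) (coordAlong I (f x) f V) x) :
    covAlong I I' f (g • V) x = g x • covAlong I I' f V x + (mvfderiv I' g x).smulRight (V x) := by
  have h1 : coordAlong I (f x) f (g • V) =ᶠ[𝓝 x] g • coordAlong I (f x) f V :=
    (eventually_mem_baseSet hf).mono fun y hy ↦ coordAlong_smul hy
  have h2 : mvfderiv I' (coordAlong I (f x) f (g • V)) x
      = g x • mvfderiv I' (coordAlong I (f x) f V) x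
        + (mvfderiv I' g x).smulRight (coordAlong I (f x) f V x) := by
    rw [← mvfderiv_smul hg hV, mvfderiv_congr h1]
  ext u
  rw [add_apply, covAlong_apply, smul_apply, covAlong_apply, h2, Pi.smul_apply',
    leviCivita_congr (mdifferentiableAt_extend I E _) (extend_smul _ _),
    show (fun q ↦ g x • extend E (V x) q) = g x • extend E (V x) from rfl,
    leviCivita_const_smul _ (mdifferentiableAt_extend I E _)]
  simp only [add_apply, smul_apply, map_add, map_smul, ContinuousLinearMap.smulRight_apply,
    smul_add, symmL_coordAlong (FiberBundle.mem_baseSet_trivializationAt' (f x))]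
  abel

theorem covAlong_add {V W : Π y : N, TangentSpace I (f y)}
    (hV : ContMDiffAlongAt I I' 1 f V x) (hW : ContMDiffAlongAt I I' 1 f W x) :
    covAlong I I' f (V + W) x = covAlong I I' f V x + covAlong I I' f W x :=
  covAlong_add_of_coord hV.contMDiffAt.continuousAt (hV.coord.mdifferentiableAt one_ne_zero)
    (hW.coord.mdifferentiableAt one_ne_zero)

theorem covAlong_smul {g : N → ℝ} {V : Π y : N, TangentSpace I (f y)}
    (hg : ContMDiffAt I' 𝓘(ℝ, ℝ) 1 g x) (hV : ContMDiffAlongAt I I' 1 f V x) :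
    covAlong I I' f (g • V) x = g x • covAlong I I' f V x + (mvfderiv I' g x).smulRight (V x) :=
  covAlong_smul_of_coord hV.contMDiffAt.continuousAt (hg.mdifferentiableAt one_ne_zero)
    (hV.coord.mdifferentiableAt one_ne_zero)

theorem covAlong_zero (hf : ContMDiffAt I' I 1 f x) :
    covAlong I I' f (0 : Π y : N, TangentSpace I (f y)) x = 0 := by
  have h := covAlong_add (ContMDiffAlongAt.zero hf) (ContMDiffAlongAt.zero hf)
  simpa using h

theorem covAlong_sum {ι : Type*} {s : Finset ι} {V : ι → Π y : N, TangentSpace I (f y)}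
    (hf : ContMDiffAt I' I 1 f x) (hV : ∀ i ∈ s, ContMDiffAlongAt I I' 1 f (V i) x) :
    covAlong I I' f (∑ i ∈ s, V i) x = ∑ i ∈ s, covAlong I I' f (V i) x := by
  classical
  induction s using Finset.induction_on with
  | empty => simpa using covAlong_zero hf
  | insert a s ha ih =>
    rw [Finset.sum_insert ha, Finset.sum_insert ha, ← ih fun i hi ↦ hV i (by simp [hi])]
    exact covAlong_add (hV a (by simp)) (ContMDiffAlongAt.sum hf fun i hi ↦ hV i (by simp [hi]))

/-- The chain rule `∇^{f ∘ g}_u (V ∘ g) = ∇^f_{dg(u)} V`. -/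
theorem covAlong_comp {g : P → N} {z : P} {V : Π y : N, TangentSpace I (f y)}
    (hV : ContMDiffAlongAt I I' 1 f V (g z)) (hg : ContMDiffAt I'' I' 1 g z)
    (u : TangentSpace I'' z) :
    covAlong I I'' (f ∘ g) (fun y ↦ V (g y)) z u
      = covAlong I I' f V (g z) (mfderiv I'' I' g z u) := by
  have hg' := hg.mdifferentiableAt one_ne_zero
  have h1 := mfderiv_comp_apply z (hV.contMDiffAt.mdifferentiableAt one_ne_zero) hg' u
  have h2 := mfderiv_comp_apply z (hV.coord.mdifferentiableAt one_ne_zero) hg' u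
  rw [covAlong_apply, covAlong_apply, h1]
  congr 2

/-- The induced connection of the identity map is the Levi-Civita connection. -/
theorem covAlong_id {V : Π q : M, TangentSpace I q} {p : M}
    (hV : ContMDiffAt I I.tangent 1 (T% V) p) :
    covAlong I I (fun q : M ↦ q) V p = leviCivita I M V p := by
  have hc : ∀ {W : Π q : M, TangentSpace I q}, MDiffAt (T% W) p →
      MDifferentiableAt I 𝓘(ℝ, E) (coordAlong I p (fun q : M ↦ q) W) p := fun hW ↦
    (mdifferentiableAt_section I _).1 hW
  have ht : TensorialAt I E (fun W : Π q : M, TangentSpace I q ↦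
      covAlong I I (fun q : M ↦ q) W p - leviCivita I M W p) p :=
    { smul := fun {g W} hg hW ↦ by
        rw [leviCivita_smul hg hW]
        have := covAlong_smul_of_coord (f := (fun q : M ↦ q)) continuousAt_id hg (hc hW)
        rw [this, smul_sub]
        exact add_sub_add_right_eq_sub _ _ _
      add := fun {V W} hV hW ↦ by
        rw [leviCivita_add hV hW]
        have := covAlong_add_of_coord (f := (fun q : M ↦ q)) continuousAt_id (hc hV) (hc hW)
        rw [this]
        abel }
  have h1 := ht.pointwise (hV.mdifferentiableAt one_ne_zero) (mdifferentiableAt_extend I E (V p))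
    (extend_apply_self E (V p)).symm
  rw [← sub_eq_zero, h1]
  ext u
  rw [sub_apply, covAlong_apply,
    mvfderiv_congr (g := coordAlong I p (fun q : M ↦ q) (extend E (V p))) (eventually_coordAlong_extend (V p)),
    mvfderiv_const]
  have h2 : mfderiv I I (fun q : M ↦ q) p = ContinuousLinearMap.id ℝ _ := mfderiv_id
  simp [h2]

theorem covAlong_comp_field {V : Π q : M, TangentSpace I q}
    (hV : ContMDiffAt I I.tangent 1 (T% V) (f x)) (hf : ContMDiffAt I' I 1 f x)
    (u : TangentSpace I' x) :
    covAlong I I' f (fun y ↦ V (f y)) x u = leviCivita I M V (f x) (mfderiv I' I f x u) := by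
  rw [← covAlong_id hV]
  exact covAlong_comp (f := (fun q : M ↦ q)) hV hf u

end CovAlong

noncomputable section Frames

variable {E : Type*} [NormedAddCommGroup E] [NormedSpace ℝ E] [FiniteDimensional ℝ E]
  {H : Type*} [TopologicalSpace H] {I : ModelWithCorners ℝ E H}
  {M : Type*} [TopologicalSpace M] [ChartedSpace H M] [IsManifold I ∞ M]
  [RiemannianBundle (fun x : M ↦ TangentSpace I x)]
  [IsContMDiffRiemannianBundle I ∞ E (fun x : M ↦ TangentSpace I x)]
  {E' : Type*} [NormedAddCommGroup E'] [NormedSpace ℝ E']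
  {H' : Type*} [TopologicalSpace H'] {I' : ModelWithCorners ℝ E' H'}
  {N : Type*} [TopologicalSpace N] [ChartedSpace H' N]
  {n m : WithTop ℕ∞} {f : N → M} {x : N}

theorem contMDiffAt_inner_along {V W : Π y : N, TangentSpace I (f y)}
    (hV : ContMDiffAlongAt I I' n f V x) (hW : ContMDiffAlongAt I I' n f W x) (hn : n ≤ ∞) :
    ContMDiffAt I' 𝓘(ℝ, ℝ) n (fun y ↦ inner ℝ (V y) (W y)) x := by
  have : IsContMDiffRiemannianBundle I n E (fun x : M ↦ TangentSpace I x) := .of_le hn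
  exact ContMDiffAt.inner_bundle (E := fun x : M ↦ TangentSpace I x) hV hW

theorem contMDiffAt_inner {V W : Π y : M, TangentSpace I y} {p : M}
    (hV : ContMDiffAt I I.tangent n (T% V) p) (hW : ContMDiffAt I I.tangent n (T% W) p)
    (hn : n ≤ ∞) :
    ContMDiffAt I 𝓘(ℝ, ℝ) n (fun y ↦ inner ℝ (V y) (W y)) p :=
  contMDiffAt_inner_along (f := fun q : M ↦ q) hV hW hn

variable (I) in
/-- `b` is a smooth orthonormal frame of `TM` near `p`. -/
structure IsOrthonormalFrameAt {κ : Type*} (b : κ → Π q : M, TangentSpace I q) (p : M) :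
    Prop where
  smooth : ∀ᶠ q in 𝓝 p, ∀ i, ContMDiffAt I I.tangent ∞ (T% (b i)) q
  orthonormal : ∀ᶠ q in 𝓝 p, Orthonormal ℝ (fun i ↦ b i q)

open InnerProductSpace in
variable (I) in
/-- Every point has a smooth orthonormal frame around it. -/
theorem exists_isOrthonormalFrameAt (p : M) :
    ∃ b : Fin (Module.finrank ℝ E) → Π q : M, TangentSpace I q, IsOrthonormalFrameAt I b p := by
  set t := trivializationAt E (TangentSpace I : M → Type _) p
  have hp : p ∈ t.baseSet := FiberBundle.mem_baseSet_trivializationAt' p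
  let β := Module.finBasis ℝ E
  let e : Fin (Module.finrank ℝ E) → Π q : M, TangentSpace I q := t.localFrame β
  let g : Fin (Module.finrank ℝ E) → Π q : M, TangentSpace I q :=
    fun i q ↦ gramSchmidt ℝ (fun j ↦ e j q) i
  have he : ∀ q ∈ t.baseSet, ∀ i, ContMDiffAt I I.tangent ∞ (T% (e i)) q := fun q hq i ↦
    contMDiffAt_localFrame_of_mem ∞ _ β i hq
  have hli : ∀ q ∈ t.baseSet, LinearIndependent ℝ (fun j ↦ e j q) := fun q hq ↦
    (t.isLocalFrameOn_localFrame_baseSet I 1 β).linearIndependent hq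
  have hg : ∀ q ∈ t.baseSet, ∀ i, ContMDiffAt I I.tangent ∞ (T% (g i)) q := by
    intro q hq i
    induction i using WellFoundedLT.induction with
    | ind i ih =>
      have h1 : ContMDiffAt I I.tangent ∞ (T% (fun q ↦ ∑ j ∈ Finset.Iio i,
          (inner ℝ (g j q) (e i q) / inner ℝ (g j q) (g j q) : ℝ) • g j q)) q := by
        refine ContMDiffAt.sum_section fun j hj ↦ ?_
        have hj := ih j (Finset.mem_Iio.1 hj)
        refine ContMDiffAt.smul_section (ContMDiffAt.div₀ (contMDiffAt_inner hj (he q hq i) le_rfl)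
          (contMDiffAt_inner hj hj le_rfl) ?_) hj
        exact inner_self_ne_zero.2 (gramSchmidt_ne_zero j (hli q hq))
      have h2 : g i = e i - fun q ↦ ∑ j ∈ Finset.Iio i,
          (inner ℝ (g j q) (e i q) / inner ℝ (g j q) (g j q) : ℝ) • g j q := by
        funext q
        have := gramSchmidt_def'' ℝ (fun j ↦ e j q) i
        rw [Pi.sub_apply, eq_sub_iff_add_eq]
        simp only [real_inner_self_eq_norm_sq]
        exact this.symm
      rw [h2]
      exact (he q hq i).sub_section h1
  refine ⟨fun i q ↦ (Real.sqrt (inner ℝ (g i q) (g i q)))⁻¹ • g i q, ?_, ?_⟩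
  · filter_upwards [t.open_baseSet.mem_nhds hp] with q hq i
    have h0 : (inner ℝ (g i q) (g i q) : ℝ) ≠ 0 :=
      inner_self_ne_zero.2 (gramSchmidt_ne_zero i (hli q hq))
    have h1 := contMDiffAt_inner (hg q hq i) (hg q hq i) le_rfl
    have h2 : ContMDiffAt I 𝓘(ℝ, ℝ) ∞
        (fun q ↦ (Real.sqrt (inner ℝ (g i q) (g i q)))⁻¹) q := by
      have h3 : ContMDiffAt I 𝓘(ℝ, ℝ) ∞ (fun q ↦ Real.sqrt (inner ℝ (g i q) (g i q))) q :=
        (Real.contDiffAt_sqrt (n := ∞) h0).contMDiffAt.comp q h1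
      refine ContMDiffAt.inv₀ h3 ?_
      rw [Real.sqrt_ne_zero']
      exact lt_of_le_of_ne real_inner_self_nonneg h0.symm
    exact h2.smul_section (hg q hq i)
  · filter_upwards [t.open_baseSet.mem_nhds hp] with q hq
    have := gramSchmidtNormed_orthonormal (𝕜 := ℝ) (hli q hq)
    convert! this using 2 with i

theorem IsOrthonormalFrameAt.eventually_sum_inner {b : Fin (Module.finrank ℝ E) →
    Π q : M, TangentSpace I q} {p : M} (hb : IsOrthonormalFrameAt I b p) :
    ∀ᶠ q in 𝓝 p, ∀ v : TangentSpace I q, v = ∑ i, (inner ℝ (b i q) v : ℝ) • b i q := by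
  filter_upwards [hb.orthonormal] with q hq v
  have h1 : Fintype.card (Fin (Module.finrank ℝ E)) = Module.finrank ℝ (TangentSpace I q) := by
    rw [Fintype.card_fin]; rfl
  have h2 : ⊤ ≤ Submodule.span ℝ (Set.range fun i ↦ b i q) :=
    (hq.linearIndependent.span_eq_top_of_card_eq_finrank' h1).ge
  have h3 := (OrthonormalBasis.mk hq h2).sum_repr' v
  simpa using h3.symm

/-- A vector field along `f` in terms of a frame around `f x`. -/
theorem IsOrthonormalFrameAt.eventually_eq_sum {b : Fin (Module.finrank ℝ E) →
    Π q : M, TangentSpace I q} (hb : IsOrthonormalFrameAt I b (f x)) (hf : ContinuousAt f x)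
    (V : Π y : N, TangentSpace I (f y)) :
    ∀ᶠ y in 𝓝 x, V y = (∑ i, (fun y ↦ (inner ℝ (b i (f y)) (V y) : ℝ)) • fun y ↦ b i (f y)) y := by
  filter_upwards [hf.eventually hb.eventually_sum_inner] with y hy
  rw [Finset.sum_apply]
  exact hy (V y)

theorem IsOrthonormalFrameAt.contMDiffAlongAt {b : Fin (Module.finrank ℝ E) →
    Π q : M, TangentSpace I q} (hb : IsOrthonormalFrameAt I b (f x))
    (hf : ContMDiffAt I' I n f x) (hn : n ≤ ∞) (i : Fin (Module.finrank ℝ E)) :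
    ContMDiffAlongAt I I' n f (fun y ↦ b i (f y)) x :=
  contMDiffAlongAt_comp ((hb.smooth.self_of_nhds i).of_le hn) hf

theorem IsOrthonormalFrameAt.contMDiffAlongAt_of_inner {b : Fin (Module.finrank ℝ E) →
    Π q : M, TangentSpace I q} (hb : IsOrthonormalFrameAt I b (f x))
    (hf : ContMDiffAt I' I n f x) (hn : n ≤ ∞) {V : Π y : N, TangentSpace I (f y)}
    (hV : ∀ i, ContMDiffAt I' 𝓘(ℝ, ℝ) n (fun y ↦ (inner ℝ (b i (f y)) (V y) : ℝ)) x) :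
    ContMDiffAlongAt I I' n f V x :=
  (ContMDiffAlongAt.sum hf fun i _ ↦ ContMDiffAlongAt.smul (hV i)
    (hb.contMDiffAlongAt hf hn i)).congr (hb.eventually_eq_sum hf.continuousAt V)

theorem contMDiffAt_koszul {X Y Z : Π q : M, TangentSpace I q} {p : M}
    (hX : ContMDiffAt I I.tangent m (T% X) p) (hY : ContMDiffAt I I.tangent m (T% Y) p)
    (hZ : ContMDiffAt I I.tangent m (T% Z) p) (hnm : n + 1 ≤ m) (hm : m ≤ ∞) :
    ContMDiffAt I 𝓘(ℝ, ℝ) n (koszul X Y Z) p := by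
  have := FiniteDimensional.complete ℝ E
  have hn : n ≤ m := le_self_add.trans hnm
  have hd : ∀ {X Y Z : Π q : M, TangentSpace I q}, ContMDiffAt I I.tangent m (T% X) p →
      ContMDiffAt I I.tangent m (T% Y) p → ContMDiffAt I I.tangent m (T% Z) p →
      ContMDiffAt I 𝓘(ℝ, ℝ) n
        (fun y ↦ mvfderiv I (fun y ↦ inner ℝ (Y y) (Z y)) y (X y)) p := fun hX hY hZ ↦
    contMDiffAt_mvfderiv_apply (contMDiffAt_inner hY hZ hm) (hX.of_le hn) hnm
  have hl : ∀ {X Y Z : Π q : M, TangentSpace I q}, ContMDiffAt I I.tangent m (T% X) p →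
      ContMDiffAt I I.tangent m (T% Y) p → ContMDiffAt I I.tangent m (T% Z) p →
      ContMDiffAt I 𝓘(ℝ, ℝ) n
        (fun y ↦ inner ℝ (VectorField.mlieBracket I X Y y) (Z y)) p := by
    intro X Y Z hX hY hZ
    refine contMDiffAt_inner ?_ (hZ.of_le hn) (hn.trans hm)
    lift m to ℕ∞ using (hm.trans_lt (by simp)).ne
    lift n to ℕ∞ using ((hn.trans hm).trans_lt (by simp)).ne
    have : IsManifold I ((m : WithTop ℕ∞) + 1) M := .of_le (n := ∞) (by exact_mod_cast le_top)
    have : IsManifold I (minSmoothness ℝ 2) M := .of_le (n := ∞) (by simpa using ENat.LEInfty.out)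
    exact hX.mlieBracket_vectorField hY (by simpa using hnm)
  exact (((((hd hX hY hZ).add (hd hY hX hZ)).sub (hd hZ hX hY)).add (hl hX hY hZ)).sub
    (hl hX hZ hY)).sub (hl hY hZ hX)

theorem IsOrthonormalFrameAt.eventually {κ : Type*} {b : κ → Π q : M, TangentSpace I q} {p : M}
    (hb : IsOrthonormalFrameAt I b p) : ∀ᶠ q in 𝓝 p, IsOrthonormalFrameAt I b q := by
  filter_upwards [hb.smooth.eventually_nhds, hb.orthonormal.eventually_nhds] with q h1 h2
  exact ⟨h1, h2⟩

theorem contMDiffAt_leviCivita {X Y : Π q : M, TangentSpace I q} {p : M}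
    (hX : ContMDiffAt I I.tangent n (T% X) p) (hY : ContMDiffAt I I.tangent m (T% Y) p)
    (hnm : n + 1 ≤ m) (hm : m ≤ ∞) :
    ContMDiffAt I I.tangent n (T% (fun q ↦ leviCivita I M Y q (X q))) p := by
  obtain ⟨b, hb⟩ := exists_isOrthonormalFrameAt I p
  have hn : n ≤ m := le_self_add.trans hnm
  have h1m : 1 ≤ m := le_add_self.trans hnm
  have hY1 : ∀ᶠ q in 𝓝 p, ContMDiffAt I I.tangent 1 (T% Y) q :=
    ContMDiffAlongAt.eventually (f := fun q : M ↦ q) (ContMDiffAt.of_le hY h1m)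
      (by exact_mod_cast ENat.natCast_lt_top 1)
  have hbY : ∀ j, ContMDiffAt I I.tangent n (T% (fun q ↦ leviCivita I M Y q (b j q))) p := by
    intro j
    refine hb.contMDiffAlongAt_of_inner (f := fun q : M ↦ q) contMDiffAt_id (hn.trans hm)
      fun i ↦ ?_
    have hk := contMDiffAt_koszul ((hb.smooth.self_of_nhds j).of_le hm) hY
      ((hb.smooth.self_of_nhds i).of_le hm) hnm hm
    refine ((contMDiffAt_const (c := (1 / 2 : ℝ))).mul hk).congr_of_eventuallyEq ?_
    filter_upwards [hY1, hb.smooth] with q hq hbq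
    rw [real_inner_comm]
    exact inner_leviCivita ((hbq j).mdifferentiableAt (by simp)) (hq.mdifferentiableAt one_ne_zero)
      ((hbq i).mdifferentiableAt (by simp))
  have hs : ContMDiffAlongAt I I n (fun q : M ↦ q) (∑ j, (fun q ↦ (inner ℝ (b j q) (X q) : ℝ)) •
      fun q ↦ leviCivita I M Y q (b j q)) p :=
    ContMDiffAlongAt.sum contMDiffAt_id fun j _ ↦ ContMDiffAlongAt.smul
      (contMDiffAt_inner ((hb.smooth.self_of_nhds j).of_le (hn.trans hm)) hX (hn.trans hm)) (hbY j)
  refine ContMDiffAlongAt.congr (f := fun q : M ↦ q) hs ?_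
  filter_upwards [hb.eventually_sum_inner] with q hq
  conv_lhs => rw [hq (X q)]
  simp [map_sum]

theorem IsOrthonormalFrameAt.covAlong_eq_sum {b : Fin (Module.finrank ℝ E) →
    Π q : M, TangentSpace I q} (hb : IsOrthonormalFrameAt I b (f x))
    {V : Π y : N, TangentSpace I (f y)} (hV : ContMDiffAlongAt I I' 1 f V x)
    (u : TangentSpace I' x) :
    covAlong I I' f V x u = ∑ i,
      ((inner ℝ (b i (f x)) (V x) : ℝ) • leviCivita I M (b i) (f x) (mfderiv I' I f x u)
        + mvfderiv I' (fun y ↦ (inner ℝ (b i (f y)) (V y) : ℝ)) x u • b i (f x)) := by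
  have hf := hV.contMDiffAt
  have h1 : (1 : WithTop ℕ∞) ≤ ∞ := by exact_mod_cast le_top
  have hbf := hb.contMDiffAlongAt hf h1
  rw [covAlong_congr (hb.eventually_eq_sum hf.continuousAt V),
    covAlong_sum hf fun i _ ↦ ContMDiffAlongAt.smul (contMDiffAt_inner_along (hbf i) hV h1) (hbf i)]
  simp only [_root_.sum_apply]
  refine Finset.sum_congr rfl fun i _ ↦ ?_
  rw [covAlong_smul (contMDiffAt_inner_along (hbf i) hV h1) (hbf i), add_apply, smul_apply,
    covAlong_comp_field ((hb.smooth.self_of_nhds i).of_le h1) hf,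
    ContinuousLinearMap.smulRight_apply]

theorem contMDiffAlongAt_covAlong [IsManifold I' ∞ N] {V : Π y : N, TangentSpace I (f y)}
    {W : Π y : N, TangentSpace I' y} (hV : ContMDiffAlongAt I I' m f V x)
    (hW : ContMDiffAt I' I'.tangent n (T% W) x) (hnm : n + 1 ≤ m) (hm : m ≤ ∞) :
    ContMDiffAlongAt I I' n f (fun y ↦ covAlong I I' f V y (W y)) x := by
  obtain ⟨b, hb⟩ := exists_isOrthonormalFrameAt I (f x)
  have hn : n ≤ m := le_self_add.trans hnm
  have hf := hV.contMDiffAt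
  have hfn := hf.of_le hn
  have hbf := hb.contMDiffAlongAt hf hm
  have hbn := fun i ↦ (hbf i).of_le hn
  have h1m : 1 ≤ m := le_add_self.trans hnm
  have hdf := contMDiffAlongAt_mfderiv hf hW hnm
  have hV1 := (hV.of_le h1m).eventually (by exact_mod_cast ENat.natCast_lt_top 1)
  have hs : ContMDiffAlongAt I I' n f (∑ i,
      ((fun y ↦ (inner ℝ (b i (f y)) (V y) : ℝ)) • (∑ j,
          (fun y ↦ (inner ℝ (b j (f y)) (mfderiv I' I f y (W y)) : ℝ)) •
            fun y ↦ leviCivita I M (b i) (f y) (b j (f y)))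
        + (fun y ↦ mvfderiv I' (fun y ↦ (inner ℝ (b i (f y)) (V y) : ℝ)) y (W y)) •
            fun y ↦ b i (f y))) x := by
    refine ContMDiffAlongAt.sum hfn fun i _ ↦ ContMDiffAlongAt.add (ContMDiffAlongAt.smul
      (contMDiffAt_inner_along (hbn i) (hV.of_le hn) (hn.trans hm)) (ContMDiffAlongAt.sum hfn fun j _ ↦
        ContMDiffAlongAt.smul (contMDiffAt_inner_along (hbn j) hdf (hn.trans hm)) ?_)) (ContMDiffAlongAt.smul ?_
          (hbn i))
    · exact contMDiffAlongAt_comp (contMDiffAt_leviCivita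
        ((hb.smooth.self_of_nhds j).of_le (hn.trans hm)) ((hb.smooth.self_of_nhds i).of_le hm)
        hnm hm) hfn
    · exact contMDiffAt_mvfderiv_apply (contMDiffAt_inner_along (hbf i) hV hm) hW hnm
  refine hs.congr ?_
  filter_upwards [hV1, hf.continuousAt.eventually hb.eventually,
    hf.continuousAt.eventually hb.eventually_sum_inner] with y hy hby hsy
  rw [hby.covAlong_eq_sum hy]
  simp only [Finset.sum_apply, Pi.add_apply, Pi.smul_apply']
  refine Finset.sum_congr rfl fun i _ ↦ ?_
  conv_lhs => rw [hsy (mfderiv I' I f y (W y))]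
  simp [map_sum]

theorem mvfderiv_fun_sum {ι : Type*} {s : Finset ι} {g : ι → N → ℝ}
    (hg : ∀ i ∈ s, MDifferentiableAt I' 𝓘(ℝ, ℝ) (g i) x) :
    mvfderiv I' (fun y ↦ ∑ i ∈ s, g i y) x = ∑ i ∈ s, mvfderiv I' (g i) x := by
  classical
  have h : MDifferentiableAt I' 𝓘(ℝ, ℝ) (fun y ↦ ∑ i ∈ s, g i y) x ∧
      mvfderiv I' (fun y ↦ ∑ i ∈ s, g i y) x = ∑ i ∈ s, mvfderiv I' (g i) x := by
    induction s using Finset.induction_on with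
    | empty => simpa using ⟨mdifferentiableAt_const, mvfderiv_const 0⟩
    | insert a s ha ih =>
      obtain ⟨h1, h2⟩ := ih fun i hi ↦ hg i (by simp [hi])
      simp only [Finset.sum_insert ha]
      exact ⟨(hg a (by simp)).add h1, by rw [mvfderiv_fun_add (hg a (by simp)) h1, h2]⟩
  exact h.2

/-- The induced connection is compatible with the metric. -/
theorem mvfderiv_inner_along {V W : Π y : N, TangentSpace I (f y)}
    (hV : ContMDiffAlongAt I I' 1 f V x) (hW : ContMDiffAlongAt I I' 1 f W x)
    (u : TangentSpace I' x) :
    mvfderiv I' (fun y ↦ (inner ℝ (V y) (W y) : ℝ)) x u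
      = inner ℝ (covAlong I I' f V x u) (W x) + inner ℝ (V x) (covAlong I I' f W x u) := by
  obtain ⟨b, hb⟩ := exists_isOrthonormalFrameAt I (f x)
  have hf := hV.contMDiffAt
  have h1 : (1 : WithTop ℕ∞) ≤ ∞ := ENat.LEInfty.out
  have hbf := hb.contMDiffAlongAt hf h1
  have hVi := fun i ↦ contMDiffAt_inner_along (hbf i) hV h1
  have hWi := fun i ↦ contMDiffAt_inner_along (hbf i) hW h1
  have hsum := hf.continuousAt.eventually hb.eventually_sum_inner
  have hexp : ∀ᶠ y in 𝓝 x, (inner ℝ (V y) (W y) : ℝ)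
      = ∑ i, (inner ℝ (b i (f y)) (V y) : ℝ) * inner ℝ (b i (f y)) (W y) := by
    filter_upwards [hsum] with y hy
    conv_lhs => rw [hy (V y), sum_inner]
    simp only [real_inner_smul_left]
  have hskew : ∀ i j, (inner ℝ (leviCivita I M (b i) (f x) (mfderiv I' I f x u)) (b j (f x)) : ℝ)
      + inner ℝ (b i (f x)) (leviCivita I M (b j) (f x) (mfderiv I' I f x u)) = 0 := by
    intro i j
    have hbi := (hb.smooth.self_of_nhds i).mdifferentiableAt (by simp)
    have hbj := (hb.smooth.self_of_nhds j).mdifferentiableAt (by simp)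
    have h := leviCivita_metric (mdifferentiableAt_extend I E (mfderiv I' I f x u)) hbi hbj
    rw [extend_apply_self] at h
    rw [← h]
    have hc : ∀ᶠ q in 𝓝 (f x), (inner ℝ (b i q) (b j q) : ℝ) = if i = j then 1 else 0 := by
      filter_upwards [hb.orthonormal] with q hq
      exact orthonormal_iff_ite.1 hq i j
    rw [mvfderiv_congr hc, mvfderiv_const]
    rfl
  have hd : mvfderiv I' (fun y ↦ (inner ℝ (V y) (W y) : ℝ)) x u
      = ∑ i, (mvfderiv I' (fun y ↦ (inner ℝ (b i (f y)) (V y) : ℝ)) x u * inner ℝ (b i (f x)) (W x)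
        + inner ℝ (b i (f x)) (V x) * mvfderiv I' (fun y ↦ (inner ℝ (b i (f y)) (W y) : ℝ)) x u) := by
    rw [mvfderiv_congr hexp, mvfderiv_fun_sum
      (g := fun i y ↦ (inner ℝ (b i (f y)) (V y) : ℝ) * inner ℝ (b i (f y)) (W y))
      fun i _ ↦ ((hVi i).mul (hWi i)).mdifferentiableAt one_ne_zero]
    simp only [_root_.sum_apply]
    refine Finset.sum_congr rfl fun i _ ↦ ?_
    rw [mvfderiv_fun_mul ((hVi i).mdifferentiableAt one_ne_zero)
      ((hWi i).mdifferentiableAt one_ne_zero)]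
    simp only [add_apply, smul_apply, smul_eq_mul]
    ring
  have hVx := hsum.self_of_nhds (V x)
  have hWx := hsum.self_of_nhds (W x)
  have hl : (inner ℝ (covAlong I I' f V x u) (W x) : ℝ) = ∑ i,
      (mvfderiv I' (fun y ↦ (inner ℝ (b i (f y)) (V y) : ℝ)) x u * inner ℝ (b i (f x)) (W x)
        + ∑ j, inner ℝ (b i (f x)) (V x) * inner ℝ (b j (f x)) (W x) *
          inner ℝ (leviCivita I M (b i) (f x) (mfderiv I' I f x u)) (b j (f x))) := by
    rw [hb.covAlong_eq_sum hV, sum_inner]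
    refine Finset.sum_congr rfl fun i _ ↦ ?_
    rw [inner_add_left, real_inner_smul_left, real_inner_smul_left, add_comm]
    congr 1
    conv_lhs => rw [hWx, inner_sum]
    simp only [real_inner_smul_right, Finset.mul_sum, mul_assoc]
  have hr : (inner ℝ (V x) (covAlong I I' f W x u) : ℝ) = ∑ i,
      (inner ℝ (b i (f x)) (V x) * mvfderiv I' (fun y ↦ (inner ℝ (b i (f y)) (W y) : ℝ)) x u
        + ∑ j, inner ℝ (b i (f x)) (V x) * inner ℝ (b j (f x)) (W x) *
          inner ℝ (b i (f x)) (leviCivita I M (b j) (f x) (mfderiv I' I f x u))) := by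
    conv_lhs => rw [hVx, sum_inner]
    refine Finset.sum_congr rfl fun i _ ↦ ?_
    rw [hb.covAlong_eq_sum hW, real_inner_smul_left, inner_sum]
    have hi : ∀ j, (inner ℝ (b i (f x)) (b j (f x)) : ℝ) = if i = j then 1 else 0 :=
      orthonormal_iff_ite.1 hb.orthonormal.self_of_nhds i
    simp only [inner_add_right, real_inner_smul_right, hi, Finset.sum_add_distrib, mul_ite, mul_one,
      mul_zero, Finset.sum_ite_eq, Finset.mem_univ, if_true, mul_add, Finset.mul_sum]
    rw [add_comm]
    simp only [mul_assoc]
  rw [hd, hl, hr, ← Finset.sum_add_distrib]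
  refine Finset.sum_congr rfl fun i _ ↦ ?_
  have h0 : ∑ j, inner ℝ (b i (f x)) (V x) * inner ℝ (b j (f x)) (W x) *
        (inner ℝ (leviCivita I M (b i) (f x) (mfderiv I' I f x u)) (b j (f x)) : ℝ)
      + ∑ j, inner ℝ (b i (f x)) (V x) * inner ℝ (b j (f x)) (W x) *
        (inner ℝ (b i (f x)) (leviCivita I M (b j) (f x) (mfderiv I' I f x u)) : ℝ) = 0 := by
    rw [← Finset.sum_add_distrib]
    exact Finset.sum_eq_zero fun j _ ↦ by rw [← mul_add, hskew, mul_zero]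
  linear_combination -h0

end Frames

noncomputable section Torsion

variable {E' : Type*} [NormedAddCommGroup E'] [NormedSpace ℝ E'] [CompleteSpace E']
  {H' : Type*} [TopologicalSpace H'] {I' : ModelWithCorners ℝ E' H'} [I'.Boundaryless]
  {N : Type*} [TopologicalSpace N] [ChartedSpace H' N] [IsManifold I' ∞ N]
  {F : Type*} [NormedAddCommGroup F] [NormedSpace ℝ F] {x : N}

/-- `X(Yg) - Y(Xg) = [X, Y]g` for a vector-valued function `g`. -/
theorem mvfderiv_mvfderiv_sub {g : N → F} {X Y : Π y : N, TangentSpace I' y}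
    (hg : ContMDiffAt I' 𝓘(ℝ, F) 2 g x) (hX : ContMDiffAt I' I'.tangent 1 (T% X) x)
    (hY : ContMDiffAt I' I'.tangent 1 (T% Y) x) :
    mvfderiv I' (fun y ↦ mvfderiv I' g y (Y y)) x (X x)
      - mvfderiv I' (fun y ↦ mvfderiv I' g y (X y)) x (Y x)
      = mvfderiv I' g x (VectorField.mlieBracket I' X Y x) := by
  set c := extChartAt I' x with hc
  let G : E' → F := g ∘ c.symm
  have hr : range I' = univ := I'.range_eq_univ
  have hG : ContDiffAt ℝ 2 G (c x) := by
    have := (contMDiffAt_iff.1 hg).2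
    rw [hr, contDiffWithinAt_univ] at this
    exact this
  let hat : (Π y : N, TangentSpace I' y) → E' → E' := fun Z z ↦
    VectorField.mpullbackWithin 𝓘(ℝ, E') I' c.symm Z (range I') z
  have hhat : ∀ {Z : Π y : N, TangentSpace I' y}, ContMDiffAt I' I'.tangent 1 (T% Z) x →
      DifferentiableAt ℝ (hat Z) (c x) := by
    intro Z hZ
    have := (hZ.mdifferentiableAt one_ne_zero).mdifferentiableWithinAt (s := univ)
    have h : DifferentiableWithinAt ℝ (hat Z) (c.symm ⁻¹' univ ∩ range I') (c x) :=
      this.differentiableWithinAt_mpullbackWithin_vectorField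
    rw [preimage_univ, univ_inter, hr] at h
    exact differentiableWithinAt_univ.1 h
  have hhatx : ∀ Z : Π y : N, TangentSpace I' y, hat Z (c x) = Z x := by
    intro Z
    have h1 : hat Z (c x) = Z (c.symm (c x)) :=
      mfderivWithin_extChartAt_symm_inverse_apply (I := I') (x := x) (Z (c.symm (c x)))
    have h2 : ∀ y, y = x → (Z y : E') = Z x := by rintro y rfl; rfl
    exact h1.trans (h2 _ (extChartAt_to_inv x))
  have hev : ∀ Z : Π y : N, TangentSpace I' y, ∀ᶠ z in 𝓝 (c x),
      mvfderiv I' g (c.symm z) (Z (c.symm z)) = fderiv ℝ G z (hat Z z) := by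
    intro Z
    have hg1 : ∀ᶠ y in 𝓝 x, ContMDiffAt I' 𝓘(ℝ, F) 1 g y := by
      have : IsManifold I' 1 N := .of_le (n := ∞) ENat.LEInfty.out
      exact (contMDiffAt_iff_contMDiffAt_nhds (by simp)).1 (hg.of_le one_le_two)
    have hsymm : Tendsto c.symm (𝓝 (c x)) (𝓝 x) := by
      have := continuousAt_extChartAt_symm (I := I') x
      rwa [ContinuousAt, extChartAt_to_inv] at this
    have htar : ∀ᶠ z in 𝓝 (c x), z ∈ c.target := by
      have := extChartAt_target_mem_nhdsWithin (I := I') x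
      rwa [hr, nhdsWithin_univ] at this
    filter_upwards [hsymm.eventually hg1, htar] with z hz hzt
    have hinv : (mfderivWithin 𝓘(ℝ, E') I' c.symm (range I') z).IsInvertible :=
      isInvertible_mfderivWithin_extChartAt_symm hzt
    have h1 : mfderivWithin 𝓘(ℝ, E') I' c.symm (range I') z (hat Z z) = Z (c.symm z) := by
      simp only [hat, VectorField.mpullbackWithin_apply]
      exact hinv.self_apply_inverse _
    have h2 : MDifferentiableAt 𝓘(ℝ, E') I' c.symm z := by
      have := mdifferentiableWithinAt_extChartAt_symm (I := I') (x := x) hzt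
      rwa [hr, mdifferentiableWithinAt_univ] at this
    have h3 := mfderiv_comp_apply z (hz.mdifferentiableAt one_ne_zero) h2 (hat Z z)
    rw [mfderiv_eq_fderiv] at h3
    rw [hr, mfderivWithin_univ] at h1
    rw [h1] at h3
    exact h3.symm
  have hd : ∀ {Z W : Π y : N, TangentSpace I' y}, ContMDiffAt I' I'.tangent 1 (T% Z) x →
      mvfderiv I' (fun y ↦ mvfderiv I' g y (Z y)) x (W x)
        = fderiv ℝ (fderiv ℝ G) (c x) (hat W (c x)) (hat Z (c x))
          + fderiv ℝ G (c x) (fderiv ℝ (hat Z) (c x) (hat W (c x))) := by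
    intro Z W hZ
    have h1 : MDifferentiableAt I' 𝓘(ℝ, F) (fun y ↦ mvfderiv I' g y (Z y)) x :=
      (contMDiffAt_mvfderiv_apply hg hZ (by norm_num)).mdifferentiableAt one_ne_zero
    have h2 := h1.mvfderiv
    have h3 : writtenInExtChartAt I' 𝓘(ℝ, F) x (fun y ↦ mvfderiv I' g y (Z y))
        =ᶠ[𝓝 (c x)] fun z ↦ fderiv ℝ G z (hat Z z) := (hev Z).mono fun z hz ↦ hz
    have h4 : DifferentiableAt ℝ (fderiv ℝ G) (c x) :=
      (hG.fderiv_right (m := 1) (by norm_num)).differentiableAt one_ne_zero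
    have h5 : fderiv ℝ (fun z ↦ fderiv ℝ G z (hat Z z)) (c x) (hat W (c x))
        = fderiv ℝ (fderiv ℝ G) (c x) (hat W (c x)) (hat Z (c x))
          + fderiv ℝ G (c x) (fderiv ℝ (hat Z) (c x) (hat W (c x))) := by
      rw [fderiv_clm_apply h4 (hhat hZ)]
      simp only [add_apply, ContinuousLinearMap.comp_apply, ContinuousLinearMap.flip_apply]
      rw [add_comm]
    rw [← h5, ← h3.fderiv_eq, hhatx W, h2, hr, fderivWithin_univ]
    rfl
  have hsymm : IsSymmSndFDerivAt ℝ G (c x) :=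
    hG.isSymmSndFDerivAt (by simp)
  have hgx : ∀ w : E', mvfderiv I' g x w = fderiv ℝ G (c x) w := by
    intro w
    rw [(hg.mdifferentiableAt two_ne_zero).mvfderiv, hr, fderivWithin_univ]
    rfl
  have hbr : VectorField.mlieBracket I' X Y x = fderiv ℝ (hat Y) (c x) (hat X (c x))
      - fderiv ℝ (hat X) (c x) (hat Y (c x)) := by
    rw [← VectorField.mlieBracketWithin_univ, VectorField.mlieBracketWithin_apply,
      mfderiv_extChartAt_self, preimage_univ, univ_inter]
    have h1 : VectorField.lieBracketWithin ℝ (hat X) (hat Y) (range I') (c x)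
        = fderiv ℝ (hat Y) (c x) (hat X (c x)) - fderiv ℝ (hat X) (c x) (hat Y (c x)) := by
      rw [hr, VectorField.lieBracketWithin_univ]
      rfl
    rw [← h1]
    exact congrArg (fun A : E' →L[ℝ] E' ↦ A _) (ContinuousLinearMap.inverse_id (M := E') (R := ℝ))
  rw [hd hX, hd hY, hbr, hgx, map_sub, hsymm (hat X (c x)) (hat Y (c x))]
  abel

variable {E : Type*} [NormedAddCommGroup E] [NormedSpace ℝ E] [FiniteDimensional ℝ E]
  {H : Type*} [TopologicalSpace H] {I : ModelWithCorners ℝ E H} [I.Boundaryless]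
  {M : Type*} [TopologicalSpace M] [ChartedSpace H M] [IsManifold I ∞ M]
  [RiemannianBundle (fun x : M ↦ TangentSpace I x)]
  [IsContMDiffRiemannianBundle I ∞ E (fun x : M ↦ TangentSpace I x)]
  {f : N → M}

theorem coordAlong_eq_mfderiv_extChartAt {p : M} {V : Π y : N, TangentSpace I (f y)} {y : N}
    (hy : f y ∈ (trivializationAt E (TangentSpace I : M → Type _) p).baseSet) :
    coordAlong I p f V y = mfderiv I 𝓘(ℝ, E) (extChartAt I p) (f y) (V y) := by
  rw [coordAlong_eq hy, Trivialization.coe_continuousLinearEquivAt_eq _ hy,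
    TangentBundle.continuousLinearMapAt_trivializationAt hy]
  rfl

/-- Coordinate vector fields commute. -/
theorem mlieBracket_extend {p : M} (v w : TangentSpace I p) :
    VectorField.mlieBracket I (extend E v) (extend E w) p = 0 := by
  have := FiniteDimensional.complete ℝ E
  have hc : ∀ v : TangentSpace I p, ∀ᶠ q in 𝓝 p,
      mvfderiv I (extChartAt I p) q (extend E v q)
        = (trivializationAt E (TangentSpace I : M → Type _) p ⟨p, v⟩).2 := by
    intro v
    filter_upwards [eventually_coordAlong_extend v,
      eventually_mem_baseSet (I := I) (continuousAt_id (x := p))] with q hq hqb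
    rw [← hq]
    exact (coordAlong_eq_mfderiv_extChartAt (f := fun q : M ↦ q) (V := extend E v) hqb).symm
  have h := mvfderiv_mvfderiv_sub (x := p) (g := extChartAt I p) contMDiffAt_extChartAt
    (contMDiffAt_extend I E v) (contMDiffAt_extend I E w)
  rw [mvfderiv_congr (hc v), mvfderiv_congr (hc w), mvfderiv_const, mvfderiv_const] at h
  have h2 : mvfderiv I (extChartAt I p) p (VectorField.mlieBracket I (extend E v) (extend E w) p)
      = VectorField.mlieBracket I (extend E v) (extend E w) p := by
    simp only [mvfderiv, mfderiv_extChartAt_self]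
    rfl
  exact h2.symm.trans (h.symm.trans (by simp; rfl))

theorem leviCivita_extend_comm {p : M} (v w : TangentSpace I p) :
    leviCivita I M (extend E w) p v = leviCivita I M (extend E v) p w := by
  have := FiniteDimensional.complete ℝ E
  have h := (CovariantDerivative.torsion_eq_zero_iff (leviCivita I M)).1 leviCivita_torsion
    (mdifferentiableAt_extend I E v) (mdifferentiableAt_extend I E w)
  rw [mlieBracket_extend, extend_apply_self, extend_apply_self, sub_eq_zero] at h
  exact h

/-- The induced connection has no torsion: `∇^f_X df(Y) - ∇^f_Y df(X) = df([X, Y])`. -/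
theorem covAlong_mfderiv_sub {X Y : Π y : N, TangentSpace I' y}
    (hf : ContMDiffAt I' I 2 f x) (hX : ContMDiffAt I' I'.tangent 1 (T% X) x)
    (hY : ContMDiffAt I' I'.tangent 1 (T% Y) x) :
    covAlong I I' f (fun y ↦ mfderiv I' I f y (Y y)) x (X x)
      - covAlong I I' f (fun y ↦ mfderiv I' I f y (X y)) x (Y x)
      = mfderiv I' I f x (VectorField.mlieBracket I' X Y x) := by
  have hx := FiberBundle.mem_baseSet_trivializationAt' (F := E)
    (E := (TangentSpace I : M → Type _)) (f x)
  have hf1 : ∀ᶠ y in 𝓝 x, ContMDiffAt I' I 1 f y := by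
    have : IsManifold I' 1 N := .of_le (n := ∞) ENat.LEInfty.out
    have : IsManifold I 1 M := .of_le (n := ∞) ENat.LEInfty.out
    exact (contMDiffAt_iff_contMDiffAt_nhds (by simp)).1 (hf.of_le one_le_two)
  have hg : ContMDiffAt I' 𝓘(ℝ, E) 2 (extChartAt I (f x) ∘ f) x :=
    contMDiffAt_extChartAt.comp x hf
  have hc : ∀ {y : N}, f y ∈ (trivializationAt E (TangentSpace I : M → Type _) (f x)).baseSet →
      ContMDiffAt I' I 1 f y → ∀ Z : Π y : N, TangentSpace I' y,
      coordAlong I (f x) f (fun y ↦ mfderiv I' I f y (Z y)) y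
        = mvfderiv I' (extChartAt I (f x) ∘ f) y (Z y) := by
    intro y hy hfy Z
    rw [coordAlong_eq_mfderiv_extChartAt hy]
    have h1 : MDifferentiableAt I 𝓘(ℝ, E) (extChartAt I (f x)) (f y) :=
      mdifferentiableAt_extChartAt hy
    exact (mfderiv_comp_apply y h1 (hfy.mdifferentiableAt one_ne_zero) (Z y)).symm
  have hcev : ∀ Z : Π y : N, TangentSpace I' y, ∀ᶠ y in 𝓝 x,
      coordAlong I (f x) f (fun y ↦ mfderiv I' I f y (Z y)) y
        = mvfderiv I' (extChartAt I (f x) ∘ f) y (Z y) := fun Z ↦ by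
    filter_upwards [eventually_mem_baseSet (I := I) hf.continuousAt, hf1] with y h1 h2
    exact hc h1 h2 Z
  rw [covAlong_apply, covAlong_apply, mvfderiv_congr (hcev X), mvfderiv_congr (hcev Y),
    leviCivita_extend_comm, add_sub_add_right_eq_sub, ← map_sub, mvfderiv_mvfderiv_sub hg hX hY,
    ← hc hx (hf.of_le one_le_two) (VectorField.mlieBracket I' X Y)]
  exact symmL_coordAlong (V := fun y ↦ mfderiv I' I f y (VectorField.mlieBracket I' X Y y)) hx

/-- Koszul's formula for the induced connection. -/
theorem two_mul_inner_covAlong_mfderiv {X Y Z : Π y : N, TangentSpace I' y}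
    (hf : ContMDiffAt I' I 2 f x) (hX : ContMDiffAt I' I'.tangent 1 (T% X) x)
    (hY : ContMDiffAt I' I'.tangent 1 (T% Y) x) (hZ : ContMDiffAt I' I'.tangent 1 (T% Z) x) :
    2 * (inner ℝ (covAlong I I' f (fun y ↦ mfderiv I' I f y (Y y)) x (X x))
        (mfderiv I' I f x (Z x)) : ℝ)
      = mvfderiv I' (fun y ↦ (inner ℝ (mfderiv I' I f y (Y y)) (mfderiv I' I f y (Z y)) : ℝ)) x (X x)
      + mvfderiv I' (fun y ↦ (inner ℝ (mfderiv I' I f y (X y)) (mfderiv I' I f y (Z y)) : ℝ)) x (Y x)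
      - mvfderiv I' (fun y ↦ (inner ℝ (mfderiv I' I f y (X y)) (mfderiv I' I f y (Y y)) : ℝ)) x (Z x)
      + inner ℝ (mfderiv I' I f x (VectorField.mlieBracket I' X Y x)) (mfderiv I' I f x (Z x))
      - inner ℝ (mfderiv I' I f x (VectorField.mlieBracket I' X Z x)) (mfderiv I' I f x (Y x))
      - inner ℝ (mfderiv I' I f x (VectorField.mlieBracket I' Y Z x)) (mfderiv I' I f x (X x)) := by
  have hd : ∀ {W : Π y : N, TangentSpace I' y}, ContMDiffAt I' I'.tangent 1 (T% W) x →
      ContMDiffAlongAt I I' 1 f (fun y ↦ mfderiv I' I f y (W y)) x := fun hW ↦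
    contMDiffAlongAt_mfderiv hf hW (by norm_num)
  rw [mvfderiv_inner_along (hd hY) (hd hZ), mvfderiv_inner_along (hd hX) (hd hZ),
    mvfderiv_inner_along (hd hX) (hd hY), ← covAlong_mfderiv_sub hf hX hY,
    ← covAlong_mfderiv_sub hf hX hZ, ← covAlong_mfderiv_sub hf hY hZ]
  simp only [inner_sub_left]
  have c1 := real_inner_comm (mfderiv I' I f x (X x))
    (covAlong I I' f (fun y ↦ mfderiv I' I f y (Y y)) x (Z x))
  have c2 := real_inner_comm (mfderiv I' I f x (Y x))
    (covAlong I I' f (fun y ↦ mfderiv I' I f y (Z y)) x (X x))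
  have c3 := real_inner_comm (mfderiv I' I f x (X x))
    (covAlong I I' f (fun y ↦ mfderiv I' I f y (Z y)) x (Y x))
  linarith

end Torsion

noncomputable section Immersions

variable {E : Type*} [NormedAddCommGroup E] [NormedSpace ℝ E] [FiniteDimensional ℝ E]
  {H : Type*} [TopologicalSpace H] {I : ModelWithCorners ℝ E H} [I.Boundaryless]
  {M : Type*} [TopologicalSpace M] [ChartedSpace H M] [IsManifold I ∞ M]
  [RiemannianBundle (fun x : M ↦ TangentSpace I x)]
  [IsContMDiffRiemannianBundle I ∞ E (fun x : M ↦ TangentSpace I x)]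
  {E' : Type*} [NormedAddCommGroup E'] [NormedSpace ℝ E'] [FiniteDimensional ℝ E']
  {H' : Type*} [TopologicalSpace H'] {I' : ModelWithCorners ℝ E' H'} [I'.Boundaryless]
  {N : Type*} [TopologicalSpace N] [ChartedSpace H' N] [IsManifold I' ∞ N]
  [RiemannianBundle (fun x : N ↦ TangentSpace I' x)]
  [IsContMDiffRiemannianBundle I' ∞ E' (fun x : N ↦ TangentSpace I' x)]
  {f : N → M} {x : N}

/-- The tangential part of `∇^f df(Y)` for an isometric immersion `f`. -/
theorem inner_covAlong_mfderiv_of_isometric {Y : Π y : N, TangentSpace I' y}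
    (hf : ContMDiffAt I' I 2 f x)
    (hiso : ∀ (y : N) (u v : TangentSpace I' y),
      (inner ℝ (mfderiv I' I f y u) (mfderiv I' I f y v) : ℝ) = inner ℝ u v)
    (hY : ContMDiffAt I' I'.tangent 1 (T% Y) x) (u w : TangentSpace I' x) :
    (inner ℝ (covAlong I I' f (fun y ↦ mfderiv I' I f y (Y y)) x u) (mfderiv I' I f x w) : ℝ)
      = inner ℝ (leviCivita I' N Y x u) w := by
  have := FiniteDimensional.complete ℝ E'
  have hu := contMDiffAt_extend (k := 1) I' E' u
  have hw := contMDiffAt_extend (k := 1) I' E' w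
  have h1 := two_mul_inner_covAlong_mfderiv hf hu hY hw
  have h2 := inner_leviCivita (hu.mdifferentiableAt one_ne_zero)
    (hY.mdifferentiableAt one_ne_zero) (hw.mdifferentiableAt one_ne_zero)
  simp only [hiso] at h1
  simp only [extend_apply_self, koszul] at h1 h2
  linarith

/-- The trace of the covariant derivative of a section `A` of `Hom(TN, f^*TM)`, computed in an
orthonormal frame `e` that is parallel at `x`. -/
theorem sum_covAlong_hom_eq {κ : Type*} [Fintype κ] {e : κ → Π y : N, TangentSpace I' y}
    (he : ∀ k, ContMDiffAt I' I'.tangent 1 (T% (e k)) x)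
    (hsum : ∀ᶠ y in 𝓝 x, ∀ v : TangentSpace I' y, v = ∑ k, (inner ℝ (e k y) v : ℝ) • e k y)
    (hpar : ∀ k, leviCivita I' N (e k) x = 0)
    {A : Π y : N, TangentSpace I' y →L[ℝ] TangentSpace I (f y)}
    (hA : ∀ k, ContMDiffAlongAt I I' 1 f (fun y ↦ A y (e k y)) x) (hf : ContMDiffAt I' I 1 f x)
    {ι : Type*} [Fintype ι] (β : OrthonormalBasis ι ℝ (TangentSpace I' x)) :
    ∑ i, (covAlong I I' f (fun y ↦ A y (extend E' (β i) y)) x (β i)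
        - A x (leviCivita I' N (extend E' (β i)) x (β i)))
      = ∑ k, covAlong I I' f (fun y ↦ A y (e k y)) x (e k x) := by
  have h1 : (1 : WithTop ℕ∞) ≤ ∞ := ENat.LEInfty.out
  have key : ∀ i, covAlong I I' f (fun y ↦ A y (extend E' (β i) y)) x (β i)
        - A x (leviCivita I' N (extend E' (β i)) x (β i))
      = ∑ k, (inner ℝ (e k x) (β i) : ℝ) • covAlong I I' f (fun y ↦ A y (e k y)) x (β i) := by
    intro i
    set W := extend E' (β i) with hWdef
    have hW : ContMDiffAt I' I'.tangent 1 (T% W) x := contMDiffAt_extend I' E' (β i)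
    have hWx : W x = β i := extend_apply_self E' (β i)
    have hc : ∀ k, ContMDiffAt I' 𝓘(ℝ, ℝ) 1 (fun y ↦ (inner ℝ (e k y) (W y) : ℝ)) x := fun k ↦
      contMDiffAt_inner (he k) hW h1
    have hL : covAlong I I' f (fun y ↦ A y (W y)) x (β i)
        = ∑ k, ((inner ℝ (e k x) (β i) : ℝ) • covAlong I I' f (fun y ↦ A y (e k y)) x (β i)
          + mvfderiv I' (fun y ↦ (inner ℝ (e k y) (W y) : ℝ)) x (β i) • A x (e k x)) := by
      have hexp : ∀ᶠ y in 𝓝 x, A y (W y)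
          = (∑ k, (fun y ↦ (inner ℝ (e k y) (W y) : ℝ)) • fun y ↦ A y (e k y)) y := by
        filter_upwards [hsum] with y hy
        conv_lhs => rw [hy (W y)]
        simp [map_sum]
      rw [covAlong_congr hexp, covAlong_sum hf fun k _ ↦ ContMDiffAlongAt.smul (hc k) (hA k)]
      simp only [_root_.sum_apply]
      refine Finset.sum_congr rfl fun k _ ↦ ?_
      rw [covAlong_smul (hc k) (hA k), add_apply, smul_apply, ContinuousLinearMap.smulRight_apply,
        hWx]
    have hR : leviCivita I' N W x (β i)
        = ∑ k, mvfderiv I' (fun y ↦ (inner ℝ (e k y) (W y) : ℝ)) x (β i) • e k x := by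
      have hd : ∀ k, mvfderiv I' (fun y ↦ (inner ℝ (e k y) (W y) : ℝ)) x (β i)
          = inner ℝ (e k x) (leviCivita I' N W x (β i)) := by
        intro k
        have := leviCivita_metric (hW.mdifferentiableAt one_ne_zero)
          ((he k).mdifferentiableAt one_ne_zero) (hW.mdifferentiableAt one_ne_zero)
        rw [hWx, hpar k, zero_apply, inner_zero_left, zero_add] at this
        exact this
      conv_lhs => rw [hsum.self_of_nhds (leviCivita I' N W x (β i))]
      simp only [hd]
    rw [hL, hR, map_sum, ← Finset.sum_sub_distrib]
    refine Finset.sum_congr rfl fun k _ ↦ ?_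
    rw [map_smul]
    abel
  simp only [key]
  rw [Finset.sum_comm]
  refine Finset.sum_congr rfl fun k _ ↦ ?_
  conv_rhs => rw [← β.sum_repr' (e k x), map_sum]
  refine Finset.sum_congr rfl fun i _ ↦ ?_
  rw [map_smul, real_inner_comm]

theorem tensionField_eq_sum {κ : Type*} [Fintype κ] {e : κ → Π y : N, TangentSpace I' y}
    (he : ∀ k, ContMDiffAt I' I'.tangent 1 (T% (e k)) x)
    (hsum : ∀ᶠ y in 𝓝 x, ∀ v : TangentSpace I' y, v = ∑ k, (inner ℝ (e k y) v : ℝ) • e k y)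
    (hpar : ∀ k, leviCivita I' N (e k) x = 0) (hf : ContMDiffAt I' I 2 f x) :
    tensionField I I' f x
      = ∑ k, covAlong I I' f (fun y ↦ mfderiv I' I f y (e k y)) x (e k x) :=
  sum_covAlong_hom_eq (A := fun y ↦ mfderiv I' I f y) he hsum hpar
    (fun k ↦ contMDiffAlongAt_mfderiv hf (he k) (by norm_num)) (hf.of_le one_le_two) _

theorem roughLaplacian_eq_sum {κ : Type*} [Fintype κ] {e : κ → Π y : N, TangentSpace I' y}
    (he : ∀ k, ContMDiffAt I' I'.tangent 1 (T% (e k)) x)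
    (hsum : ∀ᶠ y in 𝓝 x, ∀ v : TangentSpace I' y, v = ∑ k, (inner ℝ (e k y) v : ℝ) • e k y)
    (hpar : ∀ k, leviCivita I' N (e k) x = 0) {V : Π y : N, TangentSpace I (f y)}
    (hV : ContMDiffAlongAt I I' 2 f V x) :
    roughLaplacian I I' f V x
      = -∑ k, covAlong I I' f (fun y ↦ covAlong I I' f V y (e k y)) x (e k x) :=
  congrArg Neg.neg (sum_covAlong_hom_eq (A := fun y ↦ covAlong I I' f V y) he hsum hpar
    (fun k ↦ contMDiffAlongAt_covAlong hV (he k) (by norm_num) ENat.LEInfty.out)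
    (hV.contMDiffAt.of_le one_le_two) _)

end Immersions

noncomputable section Curvature

variable {E : Type*} [NormedAddCommGroup E] [NormedSpace ℝ E] [FiniteDimensional ℝ E]
  {H : Type*} [TopologicalSpace H] {I : ModelWithCorners ℝ E H} [I.Boundaryless]
  {M : Type*} [TopologicalSpace M] [ChartedSpace H M] [IsManifold I ∞ M]
  [RiemannianBundle (fun x : M ↦ TangentSpace I x)]
  [IsContMDiffRiemannianBundle I ∞ E (fun x : M ↦ TangentSpace I x)] {p : M}

/-- `(∇_U ∇_V - ∇_V ∇_U) W` at `p` for commuting fields `U`, `V` is skew-symmetric in `W`. -/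
theorem inner_leviCivita_comm_skew {U V W Z : Π q : M, TangentSpace I q}
    (hU : ContMDiffAt I I.tangent 1 (T% U) p) (hV : ContMDiffAt I I.tangent 1 (T% V) p)
    (hW : ContMDiffAt I I.tangent 2 (T% W) p) (hZ : ContMDiffAt I I.tangent 2 (T% Z) p)
    (hUV : VectorField.mlieBracket I U V p = 0) :
    (inner ℝ (leviCivita I M (fun q ↦ leviCivita I M W q (V q)) p (U p)
        - leviCivita I M (fun q ↦ leviCivita I M W q (U q)) p (V p)) (Z p) : ℝ)
      = -inner ℝ (W p) (leviCivita I M (fun q ↦ leviCivita I M Z q (V q)) p (U p)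
        - leviCivita I M (fun q ↦ leviCivita I M Z q (U q)) p (V p)) := by
  have := FiniteDimensional.complete ℝ E
  have h1 : (1 : WithTop ℕ∞) ≤ ∞ := ENat.LEInfty.out
  have h2 : (2 : WithTop ℕ∞) ≤ ∞ := ENat.LEInfty.out
  have ev : ∀ {X : Π q : M, TangentSpace I q}, ContMDiffAt I I.tangent 1 (T% X) p →
      ∀ᶠ q in 𝓝 p, MDiffAt (T% X) q := fun hX ↦
    (ContMDiffAlongAt.eventually (f := fun q : M ↦ q) hX
      (by exact_mod_cast ENat.natCast_lt_top 1)).mono fun q hq ↦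
        ContMDiffAt.mdifferentiableAt hq one_ne_zero
  have hW1 := hW.of_le one_le_two
  have hZ1 := hZ.of_le one_le_two
  have hcov : ∀ {X Y : Π q : M, TangentSpace I q}, ContMDiffAt I I.tangent 1 (T% X) p →
      ContMDiffAt I I.tangent 2 (T% Y) p →
      ContMDiffAt I I.tangent 1 (T% (fun q ↦ leviCivita I M Y q (X q))) p := fun hX hY ↦
    contMDiffAt_leviCivita hX hY (by norm_num) h2
  have key : ∀ {X Y : Π q : M, TangentSpace I q}, ContMDiffAt I I.tangent 1 (T% X) p →
      ContMDiffAt I I.tangent 1 (T% Y) p →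
      mvfderiv I (fun q ↦ mvfderiv I (fun q ↦ (inner ℝ (W q) (Z q) : ℝ)) q (Y q)) p (X p)
        = inner ℝ (leviCivita I M (fun q ↦ leviCivita I M W q (Y q)) p (X p)) (Z p)
          + inner ℝ (leviCivita I M W p (Y p)) (leviCivita I M Z p (X p))
          + (inner ℝ (leviCivita I M W p (X p)) (leviCivita I M Z p (Y p))
          + inner ℝ (W p) (leviCivita I M (fun q ↦ leviCivita I M Z q (Y q)) p (X p))) := by
    intro X Y hX hY
    have he : ∀ᶠ q in 𝓝 p, mvfderiv I (fun q ↦ (inner ℝ (W q) (Z q) : ℝ)) q (Y q)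
        = inner ℝ (leviCivita I M W q (Y q)) (Z q) + inner ℝ (W q) (leviCivita I M Z q (Y q)) := by
      filter_upwards [ev hW1, ev hZ1, ev hY] with q a b c
      exact leviCivita_metric c a b
    have hX' := hX.mdifferentiableAt one_ne_zero
    have a1 := (hcov hY hW).mdifferentiableAt one_ne_zero
    have a2 := (hcov hY hZ).mdifferentiableAt one_ne_zero
    have b1 := hW1.mdifferentiableAt one_ne_zero
    have b2 := hZ1.mdifferentiableAt one_ne_zero
    rw [mvfderiv_congr he, mvfderiv_fun_add (mdifferentiableAt_inner a1 b2)
      (mdifferentiableAt_inner b1 a2), add_apply, leviCivita_metric hX' a1 b2,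
      leviCivita_metric hX' b1 a2]
  have h := mvfderiv_mvfderiv_sub (contMDiffAt_inner hW hZ h2) hU hV
  rw [hUV, map_zero, key hU hV, key hV hU] at h
  rw [inner_sub_left, inner_sub_right]
  linarith

theorem curvatureTensor_eq (u v w : TangentSpace I p) :
    curvatureTensor p u v w
      = leviCivita I M (fun y ↦ leviCivita I M (extend E w) y (extend E v y)) p u
        - leviCivita I M (fun y ↦ leviCivita I M (extend E w) y (extend E u y)) p v := by
  rw [curvatureTensor, mlieBracket_extend, map_zero, sub_zero]

theorem curvatureTensor_swap (u v w : TangentSpace I p) :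
    curvatureTensor p u v w = -curvatureTensor p v u w := by
  rw [curvatureTensor_eq, curvatureTensor_eq, neg_sub]

/-- Skew-symmetry of the curvature, for an arbitrary extension `Z` of the fourth argument. -/
theorem inner_curvatureTensor_field {Z : Π q : M, TangentSpace I q}
    (hZ : ContMDiffAt I I.tangent 2 (T% Z) p) (u v w : TangentSpace I p) :
    (inner ℝ (curvatureTensor p u v w) (Z p) : ℝ)
      = -inner ℝ w (leviCivita I M (fun y ↦ leviCivita I M Z y (extend E v y)) p u
        - leviCivita I M (fun y ↦ leviCivita I M Z y (extend E u y)) p v) := by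
  have h := inner_leviCivita_comm_skew (contMDiffAt_extend (k := 1) I E u)
    (contMDiffAt_extend (k := 1) I E v) (contMDiffAt_extend (k := 2) I E w) hZ
    (mlieBracket_extend u v)
  simp only [extend_apply_self] at h
  rw [curvatureTensor_eq, h]

theorem inner_curvatureTensor_skew (u v w z : TangentSpace I p) :
    (inner ℝ (curvatureTensor p u v w) z : ℝ) = -inner ℝ w (curvatureTensor p u v z) := by
  have h := inner_curvatureTensor_field (contMDiffAt_extend (k := 2) I E z) u v w
  rwa [extend_apply_self, ← curvatureTensor_eq] at h

/-- The curvature `R(u, v)Z` may be computed with any extension of the third argument. -/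
theorem curvatureTensor_field {Z : Π q : M, TangentSpace I q}
    (hZ : ContMDiffAt I I.tangent 2 (T% Z) p) (u v : TangentSpace I p) :
    curvatureTensor p u v (Z p)
      = leviCivita I M (fun y ↦ leviCivita I M Z y (extend E v y)) p u
        - leviCivita I M (fun y ↦ leviCivita I M Z y (extend E u y)) p v := by
  refine ext_inner_left ℝ fun w ↦ ?_
  have h := inner_curvatureTensor_field hZ u v w
  rw [inner_curvatureTensor_skew] at h
  linarith

theorem curvatureTensor_add_right (u v w w' : TangentSpace I p) :
    curvatureTensor p u v (w + w') = curvatureTensor p u v w + curvatureTensor p u v w' := by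
  refine ext_inner_right ℝ fun z ↦ ?_
  simp only [inner_add_left, inner_curvatureTensor_skew]
  ring

theorem curvatureTensor_smul_right (a : ℝ) (u v w : TangentSpace I p) :
    curvatureTensor p u v (a • w) = a • curvatureTensor p u v w := by
  refine ext_inner_right ℝ fun z ↦ ?_
  simp only [real_inner_smul_left, inner_curvatureTensor_skew]
  ring

theorem curvatureTensor_add_middle (u v v' w : TangentSpace I p) :
    curvatureTensor p u (v + v') w = curvatureTensor p u v w + curvatureTensor p u v' w := by
  have hs : ∀ v : TangentSpace I p, MDiffAt
      (T% (fun y ↦ leviCivita I M (extend E w) y (extend E v y))) p := fun v ↦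
    (contMDiffAt_leviCivita (n := 1) (m := 2) (contMDiffAt_extend I E v) (contMDiffAt_extend I E w)
      (by norm_num) ENat.LEInfty.out).mdifferentiableAt one_ne_zero
  have h : ∀ᶠ y in 𝓝 p, leviCivita I M (extend E w) y (extend E (v + v') y)
      = ((fun y ↦ leviCivita I M (extend E w) y (extend E v y))
        + fun y ↦ leviCivita I M (extend E w) y (extend E v' y)) y :=
    (extend_add v v').mono fun y hy ↦ by rw [hy, map_add]; rfl
  rw [curvatureTensor_eq, curvatureTensor_eq, curvatureTensor_eq, leviCivita_congr (hs _) h,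
    leviCivita_add (hs v) (hs v'), add_apply, map_add]
  abel

theorem curvatureTensor_smul_middle (a : ℝ) (u v w : TangentSpace I p) :
    curvatureTensor p u (a • v) w = a • curvatureTensor p u v w := by
  have hs : ∀ v : TangentSpace I p, MDiffAt
      (T% (fun y ↦ leviCivita I M (extend E w) y (extend E v y))) p := fun v ↦
    (contMDiffAt_leviCivita (n := 1) (m := 2) (contMDiffAt_extend I E v) (contMDiffAt_extend I E w)
      (by norm_num) ENat.LEInfty.out).mdifferentiableAt one_ne_zero
  have h : ∀ᶠ y in 𝓝 p, leviCivita I M (extend E w) y (extend E (a • v) y)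
      = (a • fun y ↦ leviCivita I M (extend E w) y (extend E v y)) y :=
    (extend_smul a v).mono fun y hy ↦ by rw [hy, map_smul]; rfl
  rw [curvatureTensor_eq, curvatureTensor_eq, leviCivita_congr (hs _) h,
    leviCivita_const_smul a (hs v), smul_apply, map_smul, smul_sub]

theorem curvatureTensor_smul_left (a : ℝ) (u v w : TangentSpace I p) :
    curvatureTensor p (a • u) v w = a • curvatureTensor p u v w := by
  rw [curvatureTensor_swap, curvatureTensor_smul_middle, curvatureTensor_swap u v, smul_neg]

end Curvature

noncomputable section SasakianIdentities

variable {E : Type*} [NormedAddCommGroup E] [NormedSpace ℝ E] [FiniteDimensional ℝ E]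
  {H : Type*} [TopologicalSpace H] {I : ModelWithCorners ℝ E H}
  {M : Type*} [TopologicalSpace M] [ChartedSpace H M] [IsManifold I ∞ M]
  [RiemannianBundle (fun x : M ↦ TangentSpace I x)]
  [IsContMDiffRiemannianBundle I ∞ E (fun x : M ↦ TangentSpace I x)]
  {E' : Type*} [NormedAddCommGroup E'] [NormedSpace ℝ E']
  {H' : Type*} [TopologicalSpace H'] {I' : ModelWithCorners ℝ E' H'}
  {N : Type*} [TopologicalSpace N] [ChartedSpace H' N]
  {n : WithTop ℕ∞} {f : N → M} {x : N}
  {ξ : Π x : M, TangentSpace I x} {η : Π x : M, TangentSpace I x →L[ℝ] ℝ}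
  {φ : Π x : M, TangentSpace I x →L[ℝ] TangentSpace I x}

namespace IsSasakian

theorem inner_xi_xi (h : IsSasakian I ξ η φ) (p : M) : (inner ℝ (ξ p) (ξ p) : ℝ) = 1 := by
  rw [h.metric_xi, h.eta_xi]

theorem norm_xi (h : IsSasakian I ξ η φ) (p : M) : ‖ξ p‖ = 1 := by
  have := h.inner_xi_xi p
  rw [real_inner_self_eq_norm_sq] at this
  nlinarith [norm_nonneg (ξ p)]

theorem xi_ne_zero (h : IsSasakian I ξ η φ) (p : M) : ξ p ≠ 0 := by
  rw [← norm_ne_zero_iff, h.norm_xi p]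
  exact one_ne_zero

theorem phi_xi (h : IsSasakian I ξ η φ) (p : M) : φ p (ξ p) = 0 := by
  have h1 := h.metric p (ξ p) (ξ p)
  rw [h.inner_xi_xi, h.eta_xi] at h1
  exact inner_self_eq_zero.1 (h1.trans (by norm_num))

theorem eta_phi (h : IsSasakian I ξ η φ) (p : M) (u : TangentSpace I p) : η p (φ p u) = 0 := by
  have h1 := h.sq p (φ p u)
  rw [h.sq p u, map_add, map_neg, map_smul, h.phi_xi, smul_zero, add_zero] at h1
  have h2 : η p (φ p u) • ξ p = 0 := by simpa using h1
  exact (smul_eq_zero.1 h2).resolve_right (h.xi_ne_zero p)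

theorem inner_xi_phi (h : IsSasakian I ξ η φ) (p : M) (u : TangentSpace I p) :
    (inner ℝ (ξ p) (φ p u) : ℝ) = 0 := by
  rw [h.metric_xi, h.eta_phi]

theorem inner_phi_left (h : IsSasakian I ξ η φ) (p : M) (u v : TangentSpace I p) :
    (inner ℝ (φ p u) v : ℝ) = -inner ℝ u (φ p v) := by
  have h1 := h.metric p u (φ p v)
  rw [h.sq, h.eta_phi, inner_add_right, inner_neg_right, real_inner_smul_right,
    real_inner_comm (ξ p) (φ p u), h.inner_xi_phi] at h1
  linarith

theorem inner_phi_self (h : IsSasakian I ξ η φ) (p : M) (u : TangentSpace I p) :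
    (inner ℝ u (φ p u) : ℝ) = 0 := by
  have := h.inner_phi_left p u u
  rw [real_inner_comm] at this
  linarith

theorem contMDiffAt_xi (h : IsSasakian I ξ η φ) (hn : n ≤ ∞) (p : M) :
    ContMDiffAt I I.tangent n (T% ξ) p :=
  (h.smooth_xi p).of_le hn

theorem mdifferentiableAt_xi (h : IsSasakian I ξ η φ) (p : M) : MDiffAt (T% ξ) p :=
  (h.contMDiffAt_xi (n := 1) ENat.LEInfty.out p).mdifferentiableAt one_ne_zero

theorem contMDiffAlongAt_phi (h : IsSasakian I ξ η φ) (hn : n ≤ ∞)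
    {V : Π y : N, TangentSpace I (f y)} (hV : ContMDiffAlongAt I I' n f V x) :
    ContMDiffAlongAt I I' n f (fun y ↦ φ (f y) (V y)) x := by
  have hf := hV.contMDiffAt
  have h1 : ContMDiffAt I (I.prod 𝓘(ℝ, E →L[ℝ] E)) n
    (fun x ↦ TotalSpace.mk' (E →L[ℝ] E)
      (E := fun x : M ↦ TangentSpace I x →L[ℝ] TangentSpace I x) x (φ x)) (f x) :=
    (h.smooth_phi (f x)).of_le hn
  have h2 := ContMDiffAt.comp x h1 hf
  exact ContMDiffAt.clm_bundle_apply (b := f) (ϕ := fun y ↦ φ (f y)) h2 hV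

theorem contMDiffAt_phi (h : IsSasakian I ξ η φ) (hn : n ≤ ∞) {p : M}
    {V : Π q : M, TangentSpace I q} (hV : ContMDiffAt I I.tangent n (T% V) p) :
    ContMDiffAt I I.tangent n (T% (fun q ↦ φ q (V q))) p :=
  h.contMDiffAlongAt_phi (f := fun q : M ↦ q) hn hV

theorem leviCivita_xi (h : IsSasakian I ξ η φ) (p : M) (u : TangentSpace I p) :
    leviCivita I M ξ p u = -φ p u := by
  have hξ := h.mdifferentiableAt_xi p
  have h1 := h.cov_phi ξ p u hξ
  have h0 : leviCivita I M (fun y ↦ φ y (ξ y)) p = 0 := by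
    have : (fun y ↦ φ y (ξ y)) = 0 := funext h.phi_xi
    rw [this]
    exact congrFun (leviCivita I M).zero p
  rw [h0, zero_apply, zero_sub, h.eta_xi, one_smul] at h1
  have h2 := congrArg (φ p) h1
  rw [map_neg, h.sq, map_sub, map_smul, h.phi_xi, smul_zero, zero_sub] at h2
  have hu := mdifferentiableAt_extend I E u
  have h3 := leviCivita_metric hu hξ hξ
  simp only [h.inner_xi_xi, extend_apply_self] at h3
  have h4 : η p (leviCivita I M ξ p u) = 0 := by
    rw [mvfderiv_const, zero_apply, real_inner_comm, h.metric_xi] at h3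
    linarith
  rw [h4, zero_smul, add_zero, neg_neg] at h2
  exact h2

/-- The structure equation `(∇_u φ)V = g(u, V)ξ - η(V)u` for sections along a map. -/
theorem covAlong_phi (h : IsSasakian I ξ η φ) {V : Π y : N, TangentSpace I (f y)}
    (hV : ContMDiffAlongAt I I' 1 f V x) (u : TangentSpace I' x) :
    covAlong I I' f (fun y ↦ φ (f y) (V y)) x u
      = φ (f x) (covAlong I I' f V x u)
        + ((inner ℝ (mfderiv I' I f x u) (V x) : ℝ) • ξ (f x)
          - η (f x) (V x) • mfderiv I' I f x u) := by
  obtain ⟨b, hb⟩ := exists_isOrthonormalFrameAt I (f x)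
  have hf := hV.contMDiffAt
  have h1 : (1 : WithTop ℕ∞) ≤ ∞ := ENat.LEInfty.out
  have hbf := hb.contMDiffAlongAt hf h1
  have hbx : ∀ i, ContMDiffAt I I.tangent 1 (T% (b i)) (f x) := fun i ↦
    (hb.smooth.self_of_nhds i).of_le h1
  have hc : ∀ i, ContMDiffAt I' 𝓘(ℝ, ℝ) 1 (fun y ↦ (inner ℝ (b i (f y)) (V y) : ℝ)) x := fun i ↦
    contMDiffAt_inner_along (hbf i) hV h1
  have hVs := (hb.eventually_eq_sum hf.continuousAt V).self_of_nhds
  have hexp : ∀ᶠ y in 𝓝 x, φ (f y) (V y)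
      = (∑ i, (fun y ↦ (inner ℝ (b i (f y)) (V y) : ℝ)) • fun y ↦ φ (f y) (b i (f y))) y := by
    filter_upwards [hb.eventually_eq_sum hf.continuousAt V] with y hy
    conv_lhs => rw [hy]
    simp [map_sum]
  have hφb := fun i ↦ h.contMDiffAlongAt_phi h1 (hbf i)
  rw [covAlong_congr hexp, covAlong_sum hf fun i _ ↦ ContMDiffAlongAt.smul (hc i) (hφb i),
    hb.covAlong_eq_sum hV u, map_sum]
  simp only [Finset.sum_apply, Pi.smul_apply'] at hVs
  have e1 : (inner ℝ (mfderiv I' I f x u) (V x) : ℝ) • ξ (f x) - η (f x) (V x) • mfderiv I' I f x u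
      = ∑ i, (inner ℝ (b i (f x)) (V x) : ℝ) •
        ((inner ℝ (mfderiv I' I f x u) (b i (f x)) : ℝ) • ξ (f x)
          - η (f x) (b i (f x)) • mfderiv I' I f x u) := by
    conv_lhs => rw [hVs]
    simp only [inner_sum, map_sum, map_smul, real_inner_smul_right, Finset.sum_smul, smul_sub,
      Finset.sum_sub_distrib, smul_smul, smul_eq_mul]
  rw [e1, ← Finset.sum_add_distrib, _root_.sum_apply]
  refine Finset.sum_congr rfl fun i _ ↦ ?_
  rw [covAlong_smul (hc i) (hφb i), add_apply, smul_apply, ContinuousLinearMap.smulRight_apply,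
    covAlong_comp_field (V := fun q ↦ φ q (b i q)) (h.contMDiffAt_phi h1 (hbx i)) hf u,
    eq_add_of_sub_eq' (h.cov_phi (b i) (f x) (mfderiv I' I f x u)
      ((hbx i).mdifferentiableAt one_ne_zero)), map_add, map_smul, map_smul, smul_add]
  abel

theorem covAlong_xi (h : IsSasakian I ξ η φ) (hf : ContMDiffAt I' I 1 f x)
    (u : TangentSpace I' x) :
    covAlong I I' f (fun y ↦ ξ (f y)) x u = -φ (f x) (mfderiv I' I f x u) := by
  rw [covAlong_comp_field (h.contMDiffAt_xi ENat.LEInfty.out _) hf, h.leviCivita_xi]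

variable [I.Boundaryless]

theorem curvatureTensor_xi (h : IsSasakian I ξ η φ) {p : M} (u v : TangentSpace I p) :
    curvatureTensor p u v (ξ p) = η p v • u - η p u • v := by
  have h1 : (1 : WithTop ℕ∞) ≤ ∞ := ENat.LEInfty.out
  have key : ∀ u v : TangentSpace I p,
      leviCivita I M (fun y ↦ leviCivita I M ξ y (extend E v y)) p u
        = -(φ p (leviCivita I M (extend E v) p u) + ((inner ℝ u v : ℝ) • ξ p - η p v • u)) := by
    intro u v
    have hv := contMDiffAt_extend (k := 1) I E v
    have hφ := h.contMDiffAt_phi h1 hv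
    have e1 : (fun y ↦ leviCivita I M ξ y (extend E v y))
        = (-1 : ℝ) • fun y ↦ φ y (extend E v y) := by
      funext y
      rw [h.leviCivita_xi, Pi.smul_apply, neg_one_smul]
    rw [e1, leviCivita_const_smul _ (hφ.mdifferentiableAt one_ne_zero), smul_apply,
      eq_add_of_sub_eq' (h.cov_phi _ p u (hv.mdifferentiableAt one_ne_zero)), neg_one_smul,
      extend_apply_self]
  rw [curvatureTensor_field (h.contMDiffAt_xi ENat.LEInfty.out p), key, key,
    leviCivita_extend_comm, real_inner_comm]
  abel

/-- In dimension three, a unit vector `u` orthogonal to `ξ` gives the orthonormal basis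
`(u, φ u, ξ)`. -/
theorem eq_sum_inner (h : IsSasakian I ξ η φ) (hE : Module.finrank ℝ E = 3) {p : M}
    {u : TangentSpace I p} (hu : (inner ℝ u u : ℝ) = 1) (hξ : η p u = 0) (v : TangentSpace I p) :
    v = (inner ℝ u v : ℝ) • u + (inner ℝ (φ p u) v : ℝ) • φ p u + η p v • ξ p := by
  have ho : Orthonormal ℝ ![u, φ p u, ξ p] := by
    have hφ : (inner ℝ (φ p u) (φ p u) : ℝ) = 1 := by rw [h.metric, hu, hξ]; ring
    have huφ := h.inner_phi_self p u
    have hφu : (inner ℝ (φ p u) u : ℝ) = 0 := (real_inner_comm _ _).trans huφ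
    have hξu : (inner ℝ (ξ p) u : ℝ) = 0 := by rw [h.metric_xi, hξ]
    have huξ : (inner ℝ u (ξ p) : ℝ) = 0 := (real_inner_comm _ _).trans hξu
    have hξφ := h.inner_xi_phi p u
    have hφξ : (inner ℝ (φ p u) (ξ p) : ℝ) = 0 := (real_inner_comm _ _).trans hξφ
    rw [orthonormal_iff_ite]
    intro i j
    have hn : ∀ v : TangentSpace I p, (inner ℝ v v : ℝ) = 1 → ‖v‖ = 1 := fun v hv ↦ by
      rw [real_inner_self_eq_norm_sq] at hv
      nlinarith [norm_nonneg v]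
    fin_cases i <;> fin_cases j <;>
      simp [huφ, hφu, hξu, huξ, hξφ, hφξ, hn u hu, hn _ hφ, h.norm_xi p]
  have h1 : Fintype.card (Fin 3) = Module.finrank ℝ (TangentSpace I p) := by
    rw [Fintype.card_fin]; exact hE.symm
  have h2 : ⊤ ≤ Submodule.span ℝ (Set.range ![u, φ p u, ξ p]) :=
    (ho.linearIndependent.span_eq_top_of_card_eq_finrank' h1).ge
  have h3 := (OrthonormalBasis.mk ho h2).sum_repr' v
  simp only [OrthonormalBasis.coe_mk, Fin.sum_univ_three] at h3
  rw [← h.metric_xi]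
  exact h3.symm

/-- `R(φ u, u)u = c φ u` for a unit vector `u` orthogonal to `ξ`. -/
theorem curvatureTensor_phi (h : IsSasakian I ξ η φ) (hE : Module.finrank ℝ E = 3) {c : ℝ}
    (hc : HasConstHolSectionalCurvature I φ c) {p : M}
    {u : TangentSpace I p} (hu : (inner ℝ u u : ℝ) = 1) (hξ : η p u = 0) :
    curvatureTensor p (φ p u) u u = c • φ p u := by
  have hφ : (inner ℝ (φ p u) (φ p u) : ℝ) = 1 := by rw [h.metric, hu, hξ]; ring
  have hn : ∀ v : TangentSpace I p, (inner ℝ v v : ℝ) = 1 → ‖v‖ = 1 := fun v hv ↦ by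
    rw [real_inner_self_eq_norm_sq] at hv
    nlinarith [norm_nonneg v]
  have hφu : (inner ℝ (φ p u) u : ℝ) = 0 := (real_inner_comm _ _).trans (h.inner_phi_self p u)
  have h1 : (inner ℝ (φ p u) (curvatureTensor p (φ p u) u u) : ℝ) = c := by
    rw [real_inner_comm]
    refine hc p (φ p u) u (hn _ hφ) (hn _ hu) hφu fun w hw ↦ ?_
    rw [Submodule.mem_span_pair] at hw ⊢
    obtain ⟨a, b, rfl⟩ := hw
    refine ⟨b, -a, ?_⟩
    rw [map_add, map_smul, map_smul, h.sq, hξ, zero_smul, add_zero, smul_neg, neg_smul]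
    abel
  have h2 : (inner ℝ u (curvatureTensor p (φ p u) u u) : ℝ) = 0 := by
    have := inner_curvatureTensor_skew (φ p u) u u u
    rw [real_inner_comm] at this
    linarith
  have h3 : η p (curvatureTensor p (φ p u) u u) = 0 := by
    rw [← h.metric_xi, real_inner_comm, inner_curvatureTensor_skew, h.curvatureTensor_xi, hξ,
      h.eta_phi, zero_smul, zero_smul, sub_zero, inner_zero_right, neg_zero]
  rw [h.eq_sum_inner hE hu hξ (curvatureTensor p (φ p u) u u), h1, h2, h3]
  simp

/-- The curvature term of a normal section `a • φ u` along a surface tangent to `u` and `ξ`. -/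
theorem sum_curvatureTensor (h : IsSasakian I ξ η φ) (hE : Module.finrank ℝ E = 3) {c : ℝ}
    (hc : HasConstHolSectionalCurvature I φ c) {p : M}
    {u : TangentSpace I p} (hu : (inner ℝ u u : ℝ) = 1) (hξ : η p u = 0) (a : ℝ)
    {F : Type*} [NormedAddCommGroup F] [InnerProductSpace ℝ F] {κ : Type*} [Fintype κ]
    (β : OrthonormalBasis κ ℝ F) {t s : F} (ht : ‖t‖ = 1) (hs : ‖s‖ = 1)
    (hts : (inner ℝ t s : ℝ) = 0) :
    ∑ i, curvatureTensor p (a • φ p u) ((inner ℝ t (β i) : ℝ) • u + (inner ℝ s (β i) : ℝ) • ξ p)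
        ((inner ℝ t (β i) : ℝ) • u + (inner ℝ s (β i) : ℝ) • ξ p)
      = (a * (c + 1)) • φ p u := by
  have e : ∀ x y : F, ∑ i, (inner ℝ x (β i) : ℝ) * inner ℝ y (β i) = inner ℝ x y := fun x y ↦ by
    rw [← β.sum_inner_mul_inner x y]
    exact Finset.sum_congr rfl fun i _ ↦ by rw [real_inner_comm y]
  simp only [curvatureTensor_add_right, curvatureTensor_add_middle, curvatureTensor_smul_right,
    curvatureTensor_smul_middle, curvatureTensor_smul_left, smul_smul, smul_add,
    Finset.sum_add_distrib]
  simp only [mul_comm _ a, mul_left_comm _ a, ← Finset.sum_smul, ← Finset.mul_sum, e, hts,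
    real_inner_comm t s, real_inner_self_eq_norm_sq, ht, hs, h.curvatureTensor_phi hE hc hu hξ,
    h.curvatureTensor_xi, h.eta_xi, h.eta_phi]
  simp [smul_smul, mul_add, add_smul]

end IsSasakian

end SasakianIdentities

noncomputable section Submersions

variable {E : Type*} [NormedAddCommGroup E] [NormedSpace ℝ E] [FiniteDimensional ℝ E]
  {H : Type*} [TopologicalSpace H] {I : ModelWithCorners ℝ E H} [I.Boundaryless]
  {M : Type*} [TopologicalSpace M] [ChartedSpace H M] [IsManifold I ∞ M]
  [RiemannianBundle (fun x : M ↦ TangentSpace I x)]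
  [IsContMDiffRiemannianBundle I ∞ E (fun x : M ↦ TangentSpace I x)]
  {E' : Type*} [NormedAddCommGroup E'] [NormedSpace ℝ E'] [FiniteDimensional ℝ E']
  {H' : Type*} [TopologicalSpace H'] {I' : ModelWithCorners ℝ E' H'} [I'.Boundaryless]
  {N : Type*} [TopologicalSpace N] [ChartedSpace H' N] [IsManifold I' ∞ N]
  [RiemannianBundle (fun x : N ↦ TangentSpace I' x)]
  [IsContMDiffRiemannianBundle I' ∞ E' (fun x : N ↦ TangentSpace I' x)]
  {E'' : Type*} [NormedAddCommGroup E''] [NormedSpace ℝ E'']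
  {H'' : Type*} [TopologicalSpace H''] {I'' : ModelWithCorners ℝ E'' H''}
  {P : Type*} [TopologicalSpace P] [ChartedSpace H'' P]
  {ξ : Π y : N, TangentSpace I' y} {f : N → M} {x : N}

/-- The horizontal part of a vector field, for the unit vertical field `ξ`. -/
def horizontal (ξ V : Π y : N, TangentSpace I' y) (y : N) : TangentSpace I' y :=
  V y - (inner ℝ (ξ y) (V y) : ℝ) • ξ y

theorem inner_horizontal (hξ : ∀ y, (inner ℝ (ξ y) (ξ y) : ℝ) = 1) (V : Π y : N, TangentSpace I' y)
    (y : N) : (inner ℝ (ξ y) (horizontal ξ V y) : ℝ) = 0 := by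
  rw [horizontal, inner_sub_right, real_inner_smul_right, hξ, mul_one, sub_self]

theorem horizontal_eq_self {V : Π y : N, TangentSpace I' y} {y : N}
    (h : (inner ℝ (ξ y) (V y) : ℝ) = 0) : horizontal ξ V y = V y := by
  rw [horizontal, h, zero_smul, sub_zero]

theorem contMDiffAt_horizontal {V : Π y : N, TangentSpace I' y}
    (hξ : ContMDiffAt I' I'.tangent 1 (T% ξ) x) (hV : ContMDiffAt I' I'.tangent 1 (T% V) x) :
    ContMDiffAt I' I'.tangent 1 (T% (horizontal ξ V)) x :=
  hV.sub_section ((contMDiffAt_inner hξ hV ENat.LEInfty.out).smul_section hξ)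

/-- For a Riemannian submersion, the connection of the base is the horizontal part of the
connection of the total space, on horizontal fields. -/
theorem covAlong_mfderiv_horizontal (hf : ContMDiffAt I' I 2 f x)
    (hξ : ContMDiffAt I' I'.tangent 1 (T% ξ) x) (hξξ : ∀ y, (inner ℝ (ξ y) (ξ y) : ℝ) = 1)
    (hiso : ∀ (y : N) (u v : TangentSpace I' y),
      (inner ℝ (mfderiv I' I f y u) (mfderiv I' I f y v) : ℝ)
        = inner ℝ u v - inner ℝ (ξ y) u * inner ℝ (ξ y) v)
    (hsurj : Function.Surjective (mfderiv I' I f x)) {Y : Π y : N, TangentSpace I' y}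
    (hY : ContMDiffAt I' I'.tangent 1 (T% Y) x) (hYξ : ∀ y, (inner ℝ (ξ y) (Y y) : ℝ) = 0)
    {u : TangentSpace I' x} (hu : (inner ℝ (ξ x) u : ℝ) = 0) :
    covAlong I I' f (fun y ↦ mfderiv I' I f y (Y y)) x u
      = mfderiv I' I f x (leviCivita I' N Y x u) := by
  have := FiniteDimensional.complete ℝ E'
  refine ext_inner_right ℝ fun w ↦ ?_
  obtain ⟨z, rfl⟩ := hsurj w
  set X := horizontal ξ (extend E' u) with hX
  set Z := horizontal ξ (extend E' z) with hZ
  have hXs : ContMDiffAt I' I'.tangent 1 (T% X) x :=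
    contMDiffAt_horizontal hξ (contMDiffAt_extend I' E' u)
  have hZs : ContMDiffAt I' I'.tangent 1 (T% Z) x :=
    contMDiffAt_horizontal hξ (contMDiffAt_extend I' E' z)
  have hXx : X x = u := by
    rw [hX, horizontal_eq_self, extend_apply_self]
    rw [extend_apply_self, hu]
  have hXξ : ∀ y, (inner ℝ (ξ y) (X y) : ℝ) = 0 := inner_horizontal hξξ _
  have hZξ : ∀ y, (inner ℝ (ξ y) (Z y) : ℝ) = 0 := inner_horizontal hξξ _
  have hZx : mfderiv I' I f x z = mfderiv I' I f x (Z x) := by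
    have h0 : mfderiv I' I f x (ξ x) = 0 := by
      have := hiso x (ξ x) (ξ x)
      rw [hξξ] at this
      exact inner_self_eq_zero.1 (this.trans (by norm_num))
    rw [hZ, horizontal, map_sub, map_smul, h0, smul_zero, sub_zero, extend_apply_self]
  have h1 := two_mul_inner_covAlong_mfderiv hf hXs hY hZs
  have h2 := inner_leviCivita (hXs.mdifferentiableAt one_ne_zero)
    (hY.mdifferentiableAt one_ne_zero) (hZs.mdifferentiableAt one_ne_zero)
  simp only [hiso, hXξ, hYξ, hZξ, mul_zero, sub_zero] at h1
  rw [koszul] at h2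
  rw [hZx, hiso, hZξ, mul_zero, sub_zero]
  rw [hXx] at h1 h2
  linarith

theorem covAlong_mfderiv_comp_horizontal {g : P → N} {z : P} (hf : ContMDiffAt I' I 2 f (g z))
    (hg : ContMDiffAt I'' I' 1 g z)
    (hξ : ContMDiffAt I' I'.tangent 1 (T% ξ) (g z))
    (hξξ : ∀ y, (inner ℝ (ξ y) (ξ y) : ℝ) = 1)
    (hiso : ∀ (y : N) (u v : TangentSpace I' y),
      (inner ℝ (mfderiv I' I f y u) (mfderiv I' I f y v) : ℝ)
        = inner ℝ u v - inner ℝ (ξ y) u * inner ℝ (ξ y) v)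
    (hsurj : Function.Surjective (mfderiv I' I f (g z))) {V : Π y : P, TangentSpace I' (g y)}
    (hV : ContMDiffAlongAt I' I'' 1 g V z) (hVξ : ∀ᶠ y in 𝓝 z, (inner ℝ (ξ (g y)) (V y) : ℝ) = 0)
    {u : TangentSpace I'' z} (hu : (inner ℝ (ξ (g z)) (mfderiv I'' I' g z u) : ℝ) = 0) :
    covAlong I I'' (f ∘ g) (fun y ↦ mfderiv I' I f (g y) (V y)) z u
      = mfderiv I' I f (g z) (covAlong I' I'' g V z u) := by
  obtain ⟨b, hb⟩ := exists_isOrthonormalFrameAt I' (g z)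
  have h1 : (1 : WithTop ℕ∞) ≤ ∞ := ENat.LEInfty.out
  have hbf := hb.contMDiffAlongAt hg h1
  have hbx : ∀ i, ContMDiffAt I' I'.tangent 1 (T% (b i)) (g z) := fun i ↦
    (hb.smooth.self_of_nhds i).of_le h1
  set h : Fin (Module.finrank ℝ E') → Π y : N, TangentSpace I' y := fun i ↦ horizontal ξ (b i)
  have hh : ∀ i, ContMDiffAt I' I'.tangent 1 (T% (h i)) (g z) := fun i ↦
    contMDiffAt_horizontal hξ (hbx i)
  have hhξ : ∀ i y, (inner ℝ (ξ y) (h i y) : ℝ) = 0 := fun i ↦ inner_horizontal hξξ (b i)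
  set v : Fin (Module.finrank ℝ E') → P → ℝ := fun i y ↦ inner ℝ (b i (g y)) (V y)
  have hv : ∀ i, ContMDiffAt I'' 𝓘(ℝ, ℝ) 1 (v i) z := fun i ↦
    contMDiffAt_inner_along (hbf i) hV h1
  have hVs : ∀ᶠ y in 𝓝 z, V y = (∑ i, v i • fun y ↦ h i (g y)) y := by
    filter_upwards [hb.eventually_eq_sum hg.continuousAt V, hVξ] with y hy hy'
    have e : (inner ℝ (ξ (g y)) (V y) : ℝ) = ∑ i, v i y * inner ℝ (ξ (g y)) (b i (g y)) := by
      conv_lhs => rw [hy]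
      simp only [Finset.sum_apply, Pi.smul_apply', inner_sum, real_inner_smul_right]
      rfl
    rw [hy'] at e
    conv_lhs => rw [hy]
    simp only [Finset.sum_apply, Pi.smul_apply', h, horizontal, smul_sub, Finset.sum_sub_distrib,
      smul_smul, ← Finset.sum_smul]
    rw [← e, zero_smul, sub_zero]
  have hd : ∀ i, ContMDiffAlongAt I I' 1 f (fun y ↦ mfderiv I' I f y (h i y)) (g z) := fun i ↦
    contMDiffAlongAt_mfderiv hf (hh i) (by norm_num)
  have hdV : ∀ᶠ y in 𝓝 z, mfderiv I' I f (g y) (V y)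
      = (∑ i, v i • (fun y ↦ mfderiv I' I f (g y) (h i (g y)) : Π y : P, TangentSpace I ((f ∘ g) y)))
        y := by
    filter_upwards [hVs] with y hy
    rw [hy, Finset.sum_apply, Finset.sum_apply, map_sum]
    exact Finset.sum_congr rfl fun i _ ↦ map_smul _ _ _
  have hhg : ∀ i, ContMDiffAlongAt I' I'' 1 g (fun y ↦ h i (g y)) z := fun i ↦
    contMDiffAlongAt_comp (hh i) hg
  have hfg : ContMDiffAt I'' I 1 (f ∘ g) z := (hf.of_le one_le_two).comp z hg
  have hdg : ∀ i, ContMDiffAlongAt I I'' 1 (f ∘ g) (fun y ↦ mfderiv I' I f (g y) (h i (g y))) z :=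
    fun i ↦ (hd i).comp hg
  let w : Fin (Module.finrank ℝ E') → TangentSpace I ((f ∘ g) z) := fun i ↦
    mfderiv I' I f (g z) (h i (g z))
  have e1 : covAlong I I'' (f ∘ g) (fun y ↦ mfderiv I' I f (g y) (V y)) z u
      = ∑ i, (v i z • covAlong I I'' (f ∘ g) (fun y ↦ mfderiv I' I f (g y) (h i (g y))) z u
        + mvfderiv I'' (v i) z u • w i) := by
    rw [covAlong_congr (f := f ∘ g) hdV,
      covAlong_sum hfg fun i _ ↦ ContMDiffAlongAt.smul (hv i) (hdg i), _root_.sum_apply]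
    refine Finset.sum_congr rfl fun i _ ↦ ?_
    rw [covAlong_smul (hv i) (hdg i)]
    rfl
  have e2 : covAlong I' I'' g V z u
      = ∑ i, (v i z • covAlong I' I'' g (fun y ↦ h i (g y)) z u
        + mvfderiv I'' (v i) z u • h i (g z)) := by
    rw [covAlong_congr hVs,
      covAlong_sum hg fun i _ ↦ ContMDiffAlongAt.smul (hv i) (hhg i), _root_.sum_apply]
    refine Finset.sum_congr rfl fun i _ ↦ ?_
    rw [covAlong_smul (hv i) (hhg i)]
    rfl
  rw [e1, e2, map_sum]
  refine Finset.sum_congr rfl fun i _ ↦ ?_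
  rw [map_add, map_smul, map_smul, covAlong_comp_field (hh i) hg u,
    ← covAlong_mfderiv_horizontal hf hξ hξξ hiso hsurj (hh i) (hhξ i) hu]
  have e3 := covAlong_comp (hd i) hg u
  rw [e3]

/-- The induced connection depends only on the germ of the section, as a map into the tangent
bundle. -/
theorem mk_covAlong_congr {f₁ f₂ : P → M} {V₁ : Π y, TangentSpace I (f₁ y)}
    {V₂ : Π y, TangentSpace I (f₂ y)} {z : P}
    (h : ∀ᶠ y in 𝓝 z, (TotalSpace.mk' E (f₁ y) (V₁ y) : TangentBundle I M)
      = TotalSpace.mk' E (f₂ y) (V₂ y)) (u : TangentSpace I'' z) :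
    (TotalSpace.mk' E (f₁ z) (covAlong I I'' f₁ V₁ z u) : TangentBundle I M)
      = TotalSpace.mk' E (f₂ z) (covAlong I I'' f₂ V₂ z u) := by
  let aux : TangentBundle I M → (TangentBundle I M → E) → E → TangentBundle I M := fun q a b ↦
    TotalSpace.mk' E q.proj
      ((trivializationAt E (TangentSpace I : M → Type _) q.proj).symmL ℝ q.proj (a q)
        + leviCivita I M (extend E q.2) q.proj (show TangentSpace I q.proj from b))
  have key : ∀ (f : P → M) (V : Π y, TangentSpace I (f y)),
      (TotalSpace.mk' E (f z) (covAlong I I'' f V z u) : TangentBundle I M)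
        = aux (TotalSpace.mk' E (f z) (V z)) (fun q ↦ mvfderiv I''
          (fun y ↦ (trivializationAt E (TangentSpace I : M → Type _) q.proj
            (TotalSpace.mk' E (f y) (V y))).2) z u) (mfderiv I'' I f z u) := fun f V ↦ rfl
  have hf : f₁ =ᶠ[𝓝 z] f₂ := h.mono fun y hy ↦ congrArg TotalSpace.proj hy
  have hm : (fun q : TangentBundle I M ↦ mvfderiv I''
        (fun y ↦ (trivializationAt E (TangentSpace I : M → Type _) q.proj
          (TotalSpace.mk' E (f₁ y) (V₁ y))).2) z u)
      = fun q : TangentBundle I M ↦ mvfderiv I''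
        (fun y ↦ (trivializationAt E (TangentSpace I : M → Type _) q.proj
          (TotalSpace.mk' E (f₂ y) (V₂ y))).2) z u := funext fun q ↦ by
    rw [mvfderiv_congr (h.mono fun y hy ↦ by rw [hy])]
  rw [key, key, h.self_of_nhds, hf.mfderiv_eq, hm]
  rfl

end Submersions

noncomputable section Curves

variable {E : Type*} [NormedAddCommGroup E] [NormedSpace ℝ E] [FiniteDimensional ℝ E]
  {H : Type*} [TopologicalSpace H] {I : ModelWithCorners ℝ E H}
  {M : Type*} [TopologicalSpace M] [ChartedSpace H M] [IsManifold I ∞ M]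
  [RiemannianBundle (fun x : M ↦ TangentSpace I x)]
  [IsContMDiffRiemannianBundle I ∞ E (fun x : M ↦ TangentSpace I x)]
  {γ : ℝ → M} {n m : WithTop ℕ∞} {s : ℝ}

theorem contMDiffAt_unit_field :
    ContMDiffAt 𝓘(ℝ, ℝ) 𝓘(ℝ, ℝ).tangent n 
      (fun t : ℝ ↦ TotalSpace.mk' ℝ (E := fun t : ℝ ↦ TangentSpace 𝓘(ℝ, ℝ) t) t (1 : ℝ)) s :=
  (contMDiffAt_vectorSpace_iff_contDiffAt (V := fun _ : ℝ ↦ (1 : ℝ))).2 contDiffAt_const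

theorem contMDiffAlongAt_velocity (hγ : ContMDiffAt 𝓘(ℝ, ℝ) I n γ s) (hmn : m + 1 ≤ n) :
    ContMDiffAlongAt I 𝓘(ℝ, ℝ) m γ (velocity I γ) s :=
  contMDiffAlongAt_mfderiv (Y := fun _ : ℝ ↦ (1 : ℝ)) hγ contMDiffAt_unit_field hmn

theorem contMDiffAlongAt_covCurve {V : Π s : ℝ, TangentSpace I (γ s)}
    (hV : ContMDiffAlongAt I 𝓘(ℝ, ℝ) n γ V s) (hmn : m + 1 ≤ n) (hn : n ≤ ∞) :
    ContMDiffAlongAt I 𝓘(ℝ, ℝ) m γ (covCurve I γ V) s :=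
  contMDiffAlongAt_covAlong (W := fun _ : ℝ ↦ (1 : ℝ)) hV contMDiffAt_unit_field hmn hn

end Curves

noncomputable section Fibration

variable {M : Type*} [TopologicalSpace M] [ChartedSpace (EuclideanSpace ℝ (Fin 3)) M]
  [IsManifold (𝓡 3) ∞ M]
  [RiemannianBundle (fun x : M ↦ TangentSpace (𝓡 3) x)]
  [IsContMDiffRiemannianBundle (𝓡 3) ∞ (EuclideanSpace ℝ (Fin 3))
      (fun x : M ↦ TangentSpace (𝓡 3) x)]
  {B : Type*} [TopologicalSpace B] [ChartedSpace (EuclideanSpace ℝ (Fin 2)) B]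
  [IsManifold (𝓡 2) ∞ B]
  [RiemannianBundle (fun x : B ↦ TangentSpace (𝓡 2) x)]
  [IsContMDiffRiemannianBundle (𝓡 2) ∞ (EuclideanSpace ℝ (Fin 2))
      (fun x : B ↦ TangentSpace (𝓡 2) x)]
  {S : Type*} [TopologicalSpace S] [ChartedSpace (EuclideanSpace ℝ (Fin 2)) S]
  [IsManifold (𝓡 2) ∞ S]
  [RiemannianBundle (fun x : S ↦ TangentSpace (𝓡 2) x)]
  [IsContMDiffRiemannianBundle (𝓡 2) ∞ (EuclideanSpace ℝ (Fin 2))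
      (fun x : S ↦ TangentSpace (𝓡 2) x)]
  {ξ : Π x : M, TangentSpace (𝓡 3) x} {η : Π x : M, TangentSpace (𝓡 3) x →L[ℝ] ℝ}
  {φ : Π x : M, TangentSpace (𝓡 3) x →L[ℝ] TangentSpace (𝓡 3) x} {pr : M → B}

namespace IsBoothbyWangFibration

theorem mfderiv_xi (h : IsBoothbyWangFibration ξ pr) (p : M) :
    mfderiv (𝓡 3) (𝓡 2) pr p (ξ p) = 0 := by
  obtain ⟨θ, hθ, rfl, -⟩ := (h.fibre p p).1 rfl
  have hc : pr ∘ θ = fun _ ↦ pr (θ 0) := funext fun t ↦ ((h.fibre (θ 0) (θ t)).2 ⟨θ, hθ, rfl, t, rfl⟩).symm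
  have h1 := HasMFDerivAt.comp (0 : ℝ)
    (((h.smooth (θ 0)).mdifferentiableAt (by simp)).hasMFDerivAt) (hθ 0)
  rw [hc] at h1
  have h2 := hasMFDerivAt_unique h1 (hasMFDerivAt_const (pr (θ 0)) (0 : ℝ))
  have h3 := congrArg (fun L ↦ L (1 : ℝ)) h2
  have h4 : mfderiv (𝓡 3) (𝓡 2) pr (θ 0) ((1 : ℝ) • ξ (θ 0)) = 0 := h3
  rwa [one_smul] at h4

theorem inner_mfderiv (h : IsBoothbyWangFibration ξ pr) (hs : IsSasakian (𝓡 3) ξ η φ) (p : M)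
    (u v : TangentSpace (𝓡 3) p) :
    (inner ℝ (mfderiv (𝓡 3) (𝓡 2) pr p u) (mfderiv (𝓡 3) (𝓡 2) pr p v) : ℝ)
      = inner ℝ u v - inner ℝ (ξ p) u * inner ℝ (ξ p) v := by
  have hh : ∀ w : TangentSpace (𝓡 3) p,
      (inner ℝ (ξ p) (w - (inner ℝ (ξ p) w : ℝ) • ξ p) : ℝ) = 0 := fun w ↦ by
    rw [inner_sub_right, real_inner_smul_right, hs.inner_xi_xi, mul_one, sub_self]
  have h1 := h.isometric p _ _ (hh u) (hh v)
  simp only [map_sub, map_smul, h.mfderiv_xi, smul_zero, sub_zero] at h1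
  rw [h1]
  simp only [inner_sub_left, inner_sub_right, real_inner_smul_left, real_inner_smul_right,
    hs.inner_xi_xi, real_inner_comm (ξ p) u]
  ring

theorem surjective_mfderiv (h : IsBoothbyWangFibration ξ pr) (hs : IsSasakian (𝓡 3) ξ η φ)
    (p : M) : Function.Surjective (mfderiv (𝓡 3) (𝓡 2) pr p) := by
  set L : TangentSpace (𝓡 3) p →ₗ[ℝ] TangentSpace (𝓡 2) (pr p) := (mfderiv (𝓡 3) (𝓡 2) pr p).toLinearMap with hL
  have hker : LinearMap.ker L ≤ Submodule.span ℝ {ξ p} := by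
    intro u hu
    have hu : mfderiv (𝓡 3) (𝓡 2) pr p u = 0 := hu
    refine Submodule.mem_span_singleton.2 ⟨inner ℝ (ξ p) u, ?_⟩
    have h1 := h.inner_mfderiv hs p u u
    rw [hu, inner_zero_left] at h1
    rw [eq_comm, ← sub_eq_zero, ← inner_self_eq_zero (𝕜 := ℝ)]
    simp only [inner_sub_left, inner_sub_right, real_inner_smul_left, real_inner_smul_right,
      hs.inner_xi_xi, real_inner_comm (ξ p) u]
    linarith
  have h1 : Module.finrank ℝ (LinearMap.ker L) ≤ 1 :=
    (Submodule.finrank_mono hker).trans (finrank_span_singleton (hs.xi_ne_zero p)).le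
  have h2 := L.finrank_range_add_finrank_ker
  have h3 : Module.finrank ℝ (TangentSpace (𝓡 3) p) = 3 := finrank_euclideanSpace_fin (n := 3)
  have h4 : Module.finrank ℝ (TangentSpace (𝓡 2) (pr p)) = 2 := finrank_euclideanSpace_fin (n := 2)
  have h5 : LinearMap.range L = ⊤ := Submodule.eq_top_of_finrank_eq
    (le_antisymm (Submodule.finrank_le _) (by omega))
  exact LinearMap.range_eq_top.1 h5

/-- The geodesic curvature of the base curve, computed on a lift. -/
theorem norm_covCurve_velocity (h : IsBoothbyWangFibration ξ pr) (hs : IsSasakian (𝓡 3) ξ η φ)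
    {J : Set ℝ} (hJ : IsOpen J) {γ : ℝ → B} (hγ : ContMDiffOn 𝓘(ℝ, ℝ) (𝓡 2) ∞ γ J)
    {ι : S → M} (hι : ContMDiff (𝓡 2) (𝓡 3) ∞ ι) {σ : S → ℝ} {x : S}
    (hσ : ContMDiffAt (𝓡 2) 𝓘(ℝ, ℝ) 1 σ x) (hpr : ∀ᶠ y in 𝓝 x, σ y ∈ J ∧ pr (ι y) = γ (σ y))
    {T : Π y : S, TangentSpace (𝓡 2) y} (hT : ContMDiffAt (𝓡 2) (𝓡 2).tangent 1 (T% T) x)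
    (hTξ : ∀ᶠ y in 𝓝 x, (inner ℝ (ξ (ι y)) (mfderiv (𝓡 2) (𝓡 3) ι y (T y)) : ℝ) = 0)
    (hTσ : ∀ᶠ y in 𝓝 x, mvfderiv (𝓡 2) σ y (T y) = 1) :
    ‖covCurve (𝓡 2) γ (velocity (𝓡 2) γ) (σ x)‖
      = ‖mfderiv (𝓡 3) (𝓡 2) pr (ι x) (covAlong (𝓡 3) (𝓡 2) ι
        (fun y ↦ mfderiv (𝓡 2) (𝓡 3) ι y (T y)) x (T x))‖ := by
  have h1 : (1 : WithTop ℕ∞) ≤ ∞ := ENat.LEInfty.out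
  have h2 : (2 : WithTop ℕ∞) ≤ ∞ := ENat.LEInfty.out
  have hγs : ∀ s ∈ J, ContMDiffAt 𝓘(ℝ, ℝ) (𝓡 2) ∞ γ s := fun s hs ↦
    hγ.contMDiffAt (hJ.mem_nhds hs)
  have hσx := hpr.self_of_nhds.1
  have e1 := covAlong_mfderiv_comp_horizontal (f := pr) ((h.smooth (ι x)).of_le h2)
    ((hι x).of_le h1) (hs.contMDiffAt_xi h1 _) hs.inner_xi_xi (h.inner_mfderiv hs)
    (h.surjective_mfderiv hs _)
    (contMDiffAlongAt_mfderiv ((hι x).of_le h2) hT (by norm_num)) hTξ hTξ.self_of_nhds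
  rw [← e1]
  have hσ1 : ∀ᶠ y in 𝓝 x, ContMDiffAt (𝓡 2) 𝓘(ℝ, ℝ) 1 σ y := by
    have : IsManifold (𝓡 2) 1 S := .of_le h1
    exact (contMDiffAt_iff_contMDiffAt_nhds (by simp)).1 hσ
  have hev : ∀ᶠ y in 𝓝 x, (TotalSpace.mk' (EuclideanSpace ℝ (Fin 2)) ((pr ∘ ι) y)
        (mfderiv (𝓡 3) (𝓡 2) pr (ι y) (mfderiv (𝓡 2) (𝓡 3) ι y (T y))) : TangentBundle (𝓡 2) B)
      = TotalSpace.mk' (EuclideanSpace ℝ (Fin 2)) ((γ ∘ σ) y) (velocity (𝓡 2) γ (σ y)) := by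
    filter_upwards [hpr.eventually_nhds, hTσ, hσ1] with y hy hy' hy1
    have hc : pr ∘ ι =ᶠ[𝓝 y] γ ∘ σ := hy.mono fun z hz ↦ hz.2
    have a1 := mfderiv_comp_apply y ((h.smooth (ι y)).mdifferentiableAt (by simp))
      ((hι y).mdifferentiableAt (by simp)) (T y)
    have a2 := mfderiv_comp_apply y
      ((hγs _ hy.self_of_nhds.1).mdifferentiableAt (by simp))
      (hy1.mdifferentiableAt one_ne_zero) (T y)
    have a3 : mfderiv (𝓡 2) 𝓘(ℝ, ℝ) σ y (T y) = (1 : ℝ) := hy'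
    rw [a3] at a2
    have a4 : mfderiv (𝓡 2) (𝓡 2) (pr ∘ ι) y = mfderiv (𝓡 2) (𝓡 2) (γ ∘ σ) y := hc.mfderiv_eq
    have a5 : (mfderiv (𝓡 3) (𝓡 2) pr (ι y) (mfderiv (𝓡 2) (𝓡 3) ι y (T y)) :
        EuclideanSpace ℝ (Fin 2)) = velocity (𝓡 2) γ (σ y) :=
      a1.symm.trans ((congrArg (fun L ↦ L (T y)) a4).trans a2)
    rw [TotalSpace.mk.injEq]
    exact ⟨hy.self_of_nhds.2, heq_of_eq a5⟩
  have e2 := mk_covAlong_congr (I := 𝓡 2) hev (T x)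
  have e3 := covAlong_comp (contMDiffAlongAt_velocity (m := 1) ((hγs _ hσx).of_le h2) (by norm_num)) hσ (T x)
  have e4 : mfderiv (𝓡 2) 𝓘(ℝ, ℝ) σ x (T x) = (1 : ℝ) := hTσ.self_of_nhds
  rw [e4] at e3
  rw [e3] at e2
  exact (congrArg (fun q : TangentBundle (𝓡 2) B ↦ ‖q.2‖) e2).symm

end IsBoothbyWangFibration

end Fibration

theorem eq_inner_smul_add_inner_smul {F : Type*} [NormedAddCommGroup F] [InnerProductSpace ℝ F]
    (hF : Module.finrank ℝ F = 2) {t s : F} (ht : ‖t‖ = 1) (hs : ‖s‖ = 1)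
    (hts : (inner ℝ t s : ℝ) = 0) (v : F) :
    v = (inner ℝ t v : ℝ) • t + (inner ℝ s v : ℝ) • s := by
  have : FiniteDimensional ℝ F := .of_finrank_pos (by omega)
  have hst : (inner ℝ s t : ℝ) = 0 := (real_inner_comm _ _).trans hts
  have ho : Orthonormal ℝ ![t, s] := by
    rw [orthonormal_iff_ite]
    intro i j
    fin_cases i <;> fin_cases j <;> simp [hts, hst, ht, hs]
  have h1 : Fintype.card (Fin 2) = Module.finrank ℝ F := by rw [Fintype.card_fin, hF]
  have h2 : ⊤ ≤ Submodule.span ℝ (Set.range ![t, s]) :=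
    (ho.linearIndependent.span_eq_top_of_card_eq_finrank' h1).ge
  have h3 := (OrthonormalBasis.mk ho h2).sum_repr' v
  simp only [OrthonormalBasis.coe_mk, Fin.sum_univ_two] at h3
  exact h3.symm

noncomputable section AdaptedFrames

variable {E : Type*} [NormedAddCommGroup E] [NormedSpace ℝ E] [FiniteDimensional ℝ E]
  {H : Type*} [TopologicalSpace H] {I : ModelWithCorners ℝ E H} [I.Boundaryless]
  {M : Type*} [TopologicalSpace M] [ChartedSpace H M] [IsManifold I ∞ M]
  [RiemannianBundle (fun x : M ↦ TangentSpace I x)]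
  [IsContMDiffRiemannianBundle I ∞ E (fun x : M ↦ TangentSpace I x)]
  {E' : Type*} [NormedAddCommGroup E'] [NormedSpace ℝ E'] [FiniteDimensional ℝ E']
  {H' : Type*} [TopologicalSpace H'] {I' : ModelWithCorners ℝ E' H'} [I'.Boundaryless]
  {N : Type*} [TopologicalSpace N] [ChartedSpace H' N] [IsManifold I' ∞ N]
  [RiemannianBundle (fun x : N ↦ TangentSpace I' x)]
  [IsContMDiffRiemannianBundle I' ∞ E' (fun x : N ↦ TangentSpace I' x)]
  {f : N → M} {x : N}
  {ξ : Π x : M, TangentSpace I x} {η : Π x : M, TangentSpace I x →L[ℝ] ℝ}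
  {φ : Π x : M, TangentSpace I x →L[ℝ] TangentSpace I x} {T Ξ : Π y : N, TangentSpace I' y}

variable (I I') in
/-- The section `df(T)` along `f`. -/
def pushField (f : N → M) (T : Π y : N, TangentSpace I' y) (y : N) : TangentSpace I (f y) :=
  mfderiv I' I f y (T y)

variable (I I') in
/-- The section `φ(df(T))` along `f`. -/
def phiPushField (φ : Π x : M, TangentSpace I x →L[ℝ] TangentSpace I x) (f : N → M)
    (T : Π y : N, TangentSpace I' y) (y : N) : TangentSpace I (f y) :=
  φ (f y) (pushField I I' f T y)

variable (I I') in
/-- The curvature `⟨∇_T df(T), φ df(T)⟩` of the integral curves of `T`, with respect to the normal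
`φ df(T)`. -/
def fieldCurvature (φ : Π x : M, TangentSpace I x →L[ℝ] TangentSpace I x) (f : N → M)
    (T : Π y : N, TangentSpace I' y) (y : N) : ℝ :=
  inner ℝ (covAlong I I' f (pushField I I' f T) y (T y)) (phiPushField I I' φ f T y)

variable (I I') in
/-- `(T, Ξ)` is an orthonormal frame near `x` on a surface immersed by `f`, with `df(Ξ) = ξ`. -/
structure IsAdaptedFrameAt (ξ : Π x : M, TangentSpace I x) (f : N → M)
    (T Ξ : Π y : N, TangentSpace I' y) (x : N) : Prop where
  smooth_left : ContMDiffAt I' I'.tangent 3 (T% T) x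
  smooth_right : ContMDiffAt I' I'.tangent 3 (T% Ξ) x
  norm_left : ∀ᶠ y in 𝓝 x, ‖T y‖ = 1
  norm_right : ∀ᶠ y in 𝓝 x, ‖Ξ y‖ = 1
  inner_eq_zero : ∀ᶠ y in 𝓝 x, (inner ℝ (T y) (Ξ y) : ℝ) = 0
  mfderiv_right : ∀ᶠ y in 𝓝 x, mfderiv I' I f y (Ξ y) = ξ (f y)

namespace IsAdaptedFrameAt

theorem eventually (h : IsAdaptedFrameAt I I' ξ f T Ξ x) :
    ∀ᶠ y in 𝓝 x, IsAdaptedFrameAt I I' ξ f T Ξ y := by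
  have ev : ∀ {X : Π q : N, TangentSpace I' q}, ContMDiffAt I' I'.tangent 3 (T% X) x →
      ∀ᶠ q in 𝓝 x, ContMDiffAt I' I'.tangent 3 (T% X) q := fun hX ↦
    ContMDiffAlongAt.eventually (f := fun q : N ↦ q) hX (WithTop.coe_lt_coe.2 (ENat.natCast_lt_top 3))
  filter_upwards [ev h.smooth_left, ev h.smooth_right, h.norm_left.eventually_nhds,
    h.norm_right.eventually_nhds, h.inner_eq_zero.eventually_nhds,
    h.mfderiv_right.eventually_nhds] with y h1 h2 h3 h4 h5 h6
  exact ⟨h1, h2, h3, h4, h5, h6⟩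

theorem eq_sum (h : IsAdaptedFrameAt I I' ξ f T Ξ x) (hE' : Module.finrank ℝ E' = 2)
    (v : TangentSpace I' x) :
    v = (inner ℝ (T x) v : ℝ) • T x + (inner ℝ (Ξ x) v : ℝ) • Ξ x :=
  eq_inner_smul_add_inner_smul (F := TangentSpace I' x) hE' h.norm_left.self_of_nhds
    h.norm_right.self_of_nhds h.inner_eq_zero.self_of_nhds v

theorem mfderiv_eq (h : IsAdaptedFrameAt I I' ξ f T Ξ x) (hE' : Module.finrank ℝ E' = 2)
    (v : TangentSpace I' x) :
    mfderiv I' I f x v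
      = (inner ℝ (T x) v : ℝ) • pushField I I' f T x + (inner ℝ (Ξ x) v : ℝ) • ξ (f x) := by
  conv_lhs => rw [h.eq_sum hE' v]
  rw [map_add, map_smul, map_smul, h.mfderiv_right.self_of_nhds]
  rfl

theorem eventually_inner_pushField (h : IsAdaptedFrameAt I I' ξ f T Ξ x)
    (hiso : ∀ (y : N) (u v : TangentSpace I' y),
    (inner ℝ (mfderiv I' I f y u) (mfderiv I' I f y v) : ℝ) = inner ℝ u v) :
    ∀ᶠ y in 𝓝 x, (inner ℝ (pushField I I' f T y) (pushField I I' f T y) : ℝ) = 1 := by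
  filter_upwards [h.norm_left] with y hy
  rw [pushField, hiso, real_inner_self_eq_norm_sq, hy, one_pow]

theorem eventually_inner_xi (h : IsAdaptedFrameAt I I' ξ f T Ξ x)
    (hiso : ∀ (y : N) (u v : TangentSpace I' y),
    (inner ℝ (mfderiv I' I f y u) (mfderiv I' I f y v) : ℝ) = inner ℝ u v) :
    ∀ᶠ y in 𝓝 x, (inner ℝ (ξ (f y)) (pushField I I' f T y) : ℝ) = 0 := by
  filter_upwards [h.mfderiv_right, h.inner_eq_zero] with y hy hy'
  rw [← hy, pushField, hiso, real_inner_comm, hy']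

theorem contMDiffAlongAt_pushField (h : IsAdaptedFrameAt I I' ξ f T Ξ x)
    (hf : ContMDiff I' I ∞ f) :
    ContMDiffAlongAt I I' 3 f (pushField I I' f T) x :=
  contMDiffAlongAt_mfderiv (n := 4) ((hf x).of_le ENat.LEInfty.out) h.smooth_left (by norm_num)

theorem contMDiffAlongAt_phiPushField (h : IsAdaptedFrameAt I I' ξ f T Ξ x)
    (hs : IsSasakian I ξ η φ) (hf : ContMDiff I' I ∞ f) :
    ContMDiffAlongAt I I' 3 f (phiPushField I I' φ f T) x :=
  hs.contMDiffAlongAt_phi ENat.LEInfty.out (h.contMDiffAlongAt_pushField hf)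

theorem contMDiffAt_fieldCurvature (h : IsAdaptedFrameAt I I' ξ f T Ξ x)
    (hs : IsSasakian I ξ η φ) (hf : ContMDiff I' I ∞ f) :
    ContMDiffAt I' 𝓘(ℝ, ℝ) 2 (fieldCurvature I I' φ f T) x :=
  contMDiffAt_inner_along (contMDiffAlongAt_covAlong (h.contMDiffAlongAt_pushField hf)
    (h.smooth_left.of_le (by norm_num)) (by norm_num) ENat.LEInfty.out)
    ((h.contMDiffAlongAt_phiPushField hs hf).of_le (by norm_num)) ENat.LEInfty.out

theorem covAlong_xi_left (hs : IsSasakian I ξ η φ) (hf : ContMDiff I' I ∞ f) :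
    covAlong I I' f (fun y ↦ ξ (f y)) x (T x) = -phiPushField I I' φ f T x :=
  hs.covAlong_xi ((hf x).of_le ENat.LEInfty.out) _

theorem covAlong_xi_right (h : IsAdaptedFrameAt I I' ξ f T Ξ x)
    (hs : IsSasakian I ξ η φ) (hf : ContMDiff I' I ∞ f) :
    covAlong I I' f (fun y ↦ ξ (f y)) x (Ξ x) = 0 := by
  rw [hs.covAlong_xi ((hf x).of_le ENat.LEInfty.out), h.mfderiv_right.self_of_nhds, hs.phi_xi,
    neg_zero]

theorem eta_pushField (h : IsAdaptedFrameAt I I' ξ f T Ξ x)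
    (hs : IsSasakian I ξ η φ)
    (hiso : ∀ (y : N) (u v : TangentSpace I' y),
      (inner ℝ (mfderiv I' I f y u) (mfderiv I' I f y v) : ℝ) = inner ℝ u v) :
    η (f x) (pushField I I' f T x) = 0 := by
  rw [← hs.metric_xi, (h.eventually_inner_xi hiso).self_of_nhds]

/-- The covariant derivatives of `df(T)` are normal to the surface. -/
theorem covAlong_pushField_eq (h : IsAdaptedFrameAt I I' ξ f T Ξ x)
    (hs : IsSasakian I ξ η φ) (hf : ContMDiff I' I ∞ f)
    (hiso : ∀ (y : N) (u v : TangentSpace I' y),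
      (inner ℝ (mfderiv I' I f y u) (mfderiv I' I f y v) : ℝ) = inner ℝ u v)
    (hE : Module.finrank ℝ E = 3) {u : TangentSpace I' x}
    (hu : (inner ℝ (pushField I I' f T x) (covAlong I I' f (fun y ↦ ξ (f y)) x u) : ℝ) = 0) :
    covAlong I I' f (pushField I I' f T) x u
      = (inner ℝ (covAlong I I' f (pushField I I' f T) x u) (phiPushField I I' φ f T x) : ℝ)
        • phiPushField I I' φ f T x := by
  have hτ := (h.contMDiffAlongAt_pushField hf).of_le (m := 1) (by norm_num)
  have hξ : ContMDiffAlongAt I I' 1 f (fun y ↦ ξ (f y)) x :=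
    contMDiffAlongAt_comp (hs.contMDiffAt_xi ENat.LEInfty.out _) ((hf x).of_le ENat.LEInfty.out)
  have h1 := mvfderiv_inner_along hτ hτ u
  rw [mvfderiv_congr (h.eventually_inner_pushField hiso), mvfderiv_const, zero_apply,
    real_inner_comm (covAlong I I' f (pushField I I' f T) x u)] at h1
  have h2 := mvfderiv_inner_along hξ hτ u
  rw [mvfderiv_congr (h.eventually_inner_xi hiso), mvfderiv_const, zero_apply, real_inner_comm,
    hu, hs.metric_xi, zero_add] at h2
  have h3 := hs.eq_sum_inner hE (h.eventually_inner_pushField hiso).self_of_nhds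
    (h.eta_pushField hs hiso) (covAlong I I' f (pushField I I' f T) x u)
  have h4 : (inner ℝ (pushField I I' f T x) (covAlong I I' f (pushField I I' f T) x u) : ℝ) = 0 := by
    rw [real_inner_comm]
    linarith
  rw [h4, ← h2, zero_smul, zero_smul, zero_add, add_zero, real_inner_comm] at h3
  exact h3

theorem covAlong_pushField_left (h : IsAdaptedFrameAt I I' ξ f T Ξ x)
    (hs : IsSasakian I ξ η φ) (hf : ContMDiff I' I ∞ f)
    (hiso : ∀ (y : N) (u v : TangentSpace I' y),
      (inner ℝ (mfderiv I' I f y u) (mfderiv I' I f y v) : ℝ) = inner ℝ u v)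
    (hE : Module.finrank ℝ E = 3) :
    covAlong I I' f (pushField I I' f T) x (T x)
      = fieldCurvature I I' φ f T x • phiPushField I I' φ f T x := by
  refine h.covAlong_pushField_eq hs hf hiso hE ?_
  rw [covAlong_xi_left hs hf, inner_neg_right, phiPushField, hs.inner_phi_self, neg_zero]

theorem inner_phiPushField_mfderiv (h : IsAdaptedFrameAt I I' ξ f T Ξ x)
    (hs : IsSasakian I ξ η φ)
    (hE' : Module.finrank ℝ E' = 2) (v : TangentSpace I' x) :
    (inner ℝ (phiPushField I I' φ f T x) (mfderiv I' I f x v) : ℝ) = 0 := by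
  rw [h.mfderiv_eq hE' v, inner_add_right, real_inner_smul_right, real_inner_smul_right,
    phiPushField, hs.inner_phi_left, hs.inner_phi_self, hs.inner_phi_left, hs.phi_xi,
    inner_zero_right]
  ring

theorem inner_phiPushField_self (h : IsAdaptedFrameAt I I' ξ f T Ξ x)
    (hs : IsSasakian I ξ η φ)
    (hiso : ∀ (y : N) (u v : TangentSpace I' y),
      (inner ℝ (mfderiv I' I f y u) (mfderiv I' I f y v) : ℝ) = inner ℝ u v) :
    (inner ℝ (phiPushField I I' φ f T x) (phiPushField I I' φ f T x) : ℝ) = 1 := by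
  rw [phiPushField, hs.metric, (h.eventually_inner_pushField hiso).self_of_nhds,
    h.eta_pushField hs hiso]
  ring

theorem covAlong_pushField_right (h : IsAdaptedFrameAt I I' ξ f T Ξ x)
    (hs : IsSasakian I ξ η φ) (hf : ContMDiff I' I ∞ f)
    (hiso : ∀ (y : N) (u v : TangentSpace I' y),
      (inner ℝ (mfderiv I' I f y u) (mfderiv I' I f y v) : ℝ) = inner ℝ u v)
    (hE : Module.finrank ℝ E = 3) (hE' : Module.finrank ℝ E' = 2) :
    covAlong I I' f (pushField I I' f T) x (Ξ x) = -phiPushField I I' φ f T x := by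
  have h0 : (inner ℝ (pushField I I' f T x) (covAlong I I' f (fun y ↦ ξ (f y)) x (Ξ x)) : ℝ) = 0 := by
    rw [h.covAlong_xi_right hs hf, inner_zero_right]
  have h1 := covAlong_mfderiv_sub (f := f) (x := x) (X := Ξ) (Y := T)
    ((hf x).of_le ENat.LEInfty.out) (h.smooth_right.of_le (by norm_num))
    (h.smooth_left.of_le (by norm_num))
  have h2 : covAlong I I' f (fun y ↦ mfderiv I' I f y (Ξ y)) x (T x)
      = -phiPushField I I' φ f T x := by
    rw [covAlong_congr h.mfderiv_right, covAlong_xi_left hs hf]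
  have h3 : (inner ℝ (covAlong I I' f (pushField I I' f T) x (Ξ x))
      (phiPushField I I' φ f T x) : ℝ) = -1 := by
    rw [h2, sub_neg_eq_add] at h1
    have h4 := congrArg (fun w ↦ (inner ℝ (phiPushField I I' φ f T x) w : ℝ)) h1
    simp only [inner_add_right, h.inner_phiPushField_mfderiv hs hE',
      h.inner_phiPushField_self hs hiso] at h4
    rw [real_inner_comm]
    exact eq_neg_of_add_eq_zero_left h4
  rw [h.covAlong_pushField_eq hs hf hiso hE h0, h3, neg_one_smul]

theorem covAlong_phiPushField_left (h : IsAdaptedFrameAt I I' ξ f T Ξ x)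
    (hs : IsSasakian I ξ η φ) (hf : ContMDiff I' I ∞ f)
    (hiso : ∀ (y : N) (u v : TangentSpace I' y),
      (inner ℝ (mfderiv I' I f y u) (mfderiv I' I f y v) : ℝ) = inner ℝ u v)
    (hE : Module.finrank ℝ E = 3) :
    covAlong I I' f (phiPushField I I' φ f T) x (T x)
      = -(fieldCurvature I I' φ f T x • pushField I I' f T x) + ξ (f x) := by
  have h1 := hs.covAlong_phi ((h.contMDiffAlongAt_pushField hf).of_le (m := 1) (by norm_num)) (T x)
  rw [h.covAlong_pushField_left hs hf hiso hE, h.eta_pushField hs hiso, map_smul, phiPushField,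
    hs.sq, h.eta_pushField hs hiso] at h1
  have h2 : (inner ℝ (mfderiv I' I f x (T x)) (pushField I I' f T x) : ℝ) = 1 :=
    (h.eventually_inner_pushField hiso).self_of_nhds
  rw [h2, zero_smul, zero_smul, add_zero, sub_zero, one_smul, smul_neg] at h1
  exact h1

theorem covAlong_phiPushField_right (h : IsAdaptedFrameAt I I' ξ f T Ξ x)
    (hs : IsSasakian I ξ η φ) (hf : ContMDiff I' I ∞ f)
    (hiso : ∀ (y : N) (u v : TangentSpace I' y),
      (inner ℝ (mfderiv I' I f y u) (mfderiv I' I f y v) : ℝ) = inner ℝ u v)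
    (hE : Module.finrank ℝ E = 3)
    (hE' : Module.finrank ℝ E' = 2) :
    covAlong I I' f (phiPushField I I' φ f T) x (Ξ x) = pushField I I' f T x := by
  have h1 := hs.covAlong_phi ((h.contMDiffAlongAt_pushField hf).of_le (m := 1) (by norm_num)) (Ξ x)
  rw [h.covAlong_pushField_right hs hf hiso hE hE', h.eta_pushField hs hiso, map_neg,
    phiPushField, hs.sq, h.eta_pushField hs hiso, h.mfderiv_right.self_of_nhds,
    (h.eventually_inner_xi hiso).self_of_nhds] at h1
  rw [zero_smul, add_zero, sub_zero, add_zero, neg_neg] at h1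
  exact h1

theorem leviCivita_eq_zero (h : IsAdaptedFrameAt I I' ξ f T Ξ x)
    (hs : IsSasakian I ξ η φ) (hf : ContMDiff I' I ∞ f)
    (hiso : ∀ (y : N) (u v : TangentSpace I' y),
      (inner ℝ (mfderiv I' I f y u) (mfderiv I' I f y v) : ℝ) = inner ℝ u v)
    (hE : Module.finrank ℝ E = 3) (hE' : Module.finrank ℝ E' = 2)
    (k : Fin 2) : leviCivita I' N (![T, Ξ] k) x = 0 := by
  have hf2 : ContMDiffAt I' I 2 f x := (hf x).of_le ENat.LEInfty.out
  have hν := h.inner_phiPushField_mfderiv hs hE'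
  have key : ∀ X : Π y : N, TangentSpace I' y, ContMDiffAt I' I'.tangent 1 (T% X) x →
      (∃ a : ℝ, covAlong I I' f (fun y ↦ mfderiv I' I f y (X y)) x (T x)
        = a • phiPushField I I' φ f T x) →
      (∃ a : ℝ, covAlong I I' f (fun y ↦ mfderiv I' I f y (X y)) x (Ξ x)
        = a • phiPushField I I' φ f T x) → leviCivita I' N X x = 0 := by
    rintro X hX ⟨a, ha⟩ ⟨b, hb⟩
    have h0 : ∀ u : TangentSpace I' x, (∃ a : ℝ, covAlong I I' f (fun y ↦ mfderiv I' I f y (X y)) x u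
        = a • phiPushField I I' φ f T x) → leviCivita I' N X x u = 0 := by
      rintro u ⟨a, ha⟩
      refine ext_inner_right ℝ fun w ↦ ?_
      rw [← inner_covAlong_mfderiv_of_isometric hf2 hiso hX, ha, real_inner_smul_left, hν,
        mul_zero, inner_zero_left]
    ext u : 1
    rw [h.eq_sum hE' u, map_add, map_smul, map_smul, h0 _ ⟨a, ha⟩, h0 _ ⟨b, hb⟩]
    simp
  fin_cases k
  · exact key T (h.smooth_left.of_le (by norm_num))
      ⟨_, h.covAlong_pushField_left hs hf hiso hE⟩
      ⟨-1, by rw [neg_one_smul]; exact h.covAlong_pushField_right hs hf hiso hE hE'⟩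
  · refine key Ξ (h.smooth_right.of_le (by norm_num)) ⟨-1, ?_⟩ ⟨0, ?_⟩
    · rw [covAlong_congr h.mfderiv_right, neg_one_smul, covAlong_xi_left hs hf]
    · rw [covAlong_congr h.mfderiv_right, zero_smul, h.covAlong_xi_right hs hf]

end IsAdaptedFrameAt

end AdaptedFrames

noncomputable section JacobiOperator

variable {E : Type*} [NormedAddCommGroup E] [NormedSpace ℝ E] [FiniteDimensional ℝ E]
  {H : Type*} [TopologicalSpace H] {I : ModelWithCorners ℝ E H} [I.Boundaryless]
  {M : Type*} [TopologicalSpace M] [ChartedSpace H M] [IsManifold I ∞ M]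
  [RiemannianBundle (fun x : M ↦ TangentSpace I x)]
  [IsContMDiffRiemannianBundle I ∞ E (fun x : M ↦ TangentSpace I x)]
  {E' : Type*} [NormedAddCommGroup E'] [NormedSpace ℝ E'] [FiniteDimensional ℝ E']
  {H' : Type*} [TopologicalSpace H'] {I' : ModelWithCorners ℝ E' H'} [I'.Boundaryless]
  {N : Type*} [TopologicalSpace N] [ChartedSpace H' N] [IsManifold I' ∞ N]
  [RiemannianBundle (fun x : N ↦ TangentSpace I' x)]
  [IsContMDiffRiemannianBundle I' ∞ E' (fun x : N ↦ TangentSpace I' x)]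
  {f : N → M} {x : N}
  {ξ : Π x : M, TangentSpace I x} {η : Π x : M, TangentSpace I x →L[ℝ] ℝ}
  {φ : Π x : M, TangentSpace I x →L[ℝ] TangentSpace I x} {T Ξ : Π y : N, TangentSpace I' y}

theorem mvfderiv_const_mul (a : ℝ) {g : N → ℝ} (hg : MDifferentiableAt I' 𝓘(ℝ, ℝ) g x)
    (u : TangentSpace I' x) :
    mvfderiv I' (fun y ↦ a * g y) x u = a * mvfderiv I' g x u := by
  rw [mvfderiv_fun_mul mdifferentiableAt_const hg, mvfderiv_const, smul_zero, add_zero]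
  rfl

theorem mvfderiv_sq {g : N → ℝ} (hg : MDifferentiableAt I' 𝓘(ℝ, ℝ) g x)
    (u : TangentSpace I' x) :
    mvfderiv I' (fun y ↦ g y ^ 2) x u = 2 * (g x * mvfderiv I' g x u) := by
  simp only [pow_two]
  rw [mvfderiv_fun_mul hg hg, add_apply, smul_apply, smul_eq_mul, two_mul]

variable (I I') in
/-- The section `a φ(df(T)) + b df(T) + r ξ` along `f`. -/
def frameSection (ξ : Π x : M, TangentSpace I x)
    (φ : Π x : M, TangentSpace I x →L[ℝ] TangentSpace I x) (f : N → M)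
    (T : Π y : N, TangentSpace I' y) (a b r : N → ℝ) (y : N) : TangentSpace I (f y) :=
  a y • phiPushField I I' φ f T y + b y • pushField I I' f T y + r y • ξ (f y)

namespace IsAdaptedFrameAt

variable {a b r : N → ℝ}

theorem covAlong_frameSection (h : IsAdaptedFrameAt I I' ξ f T Ξ x)
    (hs : IsSasakian I ξ η φ) (hf : ContMDiff I' I ∞ f)
    (ha : ContMDiffAt I' 𝓘(ℝ, ℝ) 1 a x)
    (hb : ContMDiffAt I' 𝓘(ℝ, ℝ) 1 b x) (hr : ContMDiffAt I' 𝓘(ℝ, ℝ) 1 r x)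
    (u : TangentSpace I' x) :
    covAlong I I' f (frameSection I I' ξ φ f T a b r) x u
      = (a x • covAlong I I' f (phiPushField I I' φ f T) x u
          + mvfderiv I' a x u • phiPushField I I' φ f T x)
        + (b x • covAlong I I' f (pushField I I' f T) x u
          + mvfderiv I' b x u • pushField I I' f T x)
        + (r x • covAlong I I' f (fun y ↦ ξ (f y)) x u + mvfderiv I' r x u • ξ (f x)) := by
  have h1 := (h.contMDiffAlongAt_phiPushField hs hf).of_le (m := 1) (by norm_num)
  have h2 := (h.contMDiffAlongAt_pushField hf).of_le (m := 1) (by norm_num)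
  have h3 : ContMDiffAlongAt I I' 1 f (fun y ↦ ξ (f y)) x :=
    contMDiffAlongAt_comp (hs.contMDiffAt_xi ENat.LEInfty.out _) ((hf x).of_le ENat.LEInfty.out)
  have e : frameSection I I' ξ φ f T a b r
      = a • phiPushField I I' φ f T + b • pushField I I' f T + r • fun y ↦ ξ (f y) := rfl
  have s1 := ContMDiffAlongAt.smul ha h1
  have s2 := ContMDiffAlongAt.smul hb h2
  have s3 := ContMDiffAlongAt.smul hr h3
  rw [e, covAlong_add (s1.add s2) s3, covAlong_add s1 s2, covAlong_smul ha h1,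
    covAlong_smul hb h2, covAlong_smul hr h3]
  rfl

theorem covAlong_frameSection_left (h : IsAdaptedFrameAt I I' ξ f T Ξ x)
    (hs : IsSasakian I ξ η φ) (hf : ContMDiff I' I ∞ f)
    (hiso : ∀ (y : N) (u v : TangentSpace I' y),
      (inner ℝ (mfderiv I' I f y u) (mfderiv I' I f y v) : ℝ) = inner ℝ u v)
    (hE : Module.finrank ℝ E = 3)
    (ha : ContMDiffAt I' 𝓘(ℝ, ℝ) 1 a x)
    (hb : ContMDiffAt I' 𝓘(ℝ, ℝ) 1 b x) (hr : ContMDiffAt I' 𝓘(ℝ, ℝ) 1 r x) :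
    covAlong I I' f (frameSection I I' ξ φ f T a b r) x (T x)
      = frameSection I I' ξ φ f T
        (fun y ↦ mvfderiv I' a y (T y) + b y * fieldCurvature I I' φ f T y - r y)
        (fun y ↦ mvfderiv I' b y (T y) - a y * fieldCurvature I I' φ f T y)
        (fun y ↦ mvfderiv I' r y (T y) + a y) x := by
  rw [h.covAlong_frameSection hs hf ha hb hr, h.covAlong_phiPushField_left hs hf hiso hE,
    h.covAlong_pushField_left hs hf hiso hE, covAlong_xi_left hs hf, frameSection]
  module

theorem covAlong_frameSection_right (h : IsAdaptedFrameAt I I' ξ f T Ξ x)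
    (hs : IsSasakian I ξ η φ) (hf : ContMDiff I' I ∞ f)
    (hiso : ∀ (y : N) (u v : TangentSpace I' y),
      (inner ℝ (mfderiv I' I f y u) (mfderiv I' I f y v) : ℝ) = inner ℝ u v)
    (hE : Module.finrank ℝ E = 3) (hE' : Module.finrank ℝ E' = 2)
    (ha : ContMDiffAt I' 𝓘(ℝ, ℝ) 1 a x)
    (hb : ContMDiffAt I' 𝓘(ℝ, ℝ) 1 b x) (hr : ContMDiffAt I' 𝓘(ℝ, ℝ) 1 r x) :
    covAlong I I' f (frameSection I I' ξ φ f T a b r) x (Ξ x)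
      = frameSection I I' ξ φ f T
        (fun y ↦ mvfderiv I' a y (Ξ y) - b y) (fun y ↦ mvfderiv I' b y (Ξ y) + a y)
        (fun y ↦ mvfderiv I' r y (Ξ y)) x := by
  rw [h.covAlong_frameSection hs hf ha hb hr, h.covAlong_phiPushField_right hs hf hiso hE hE',
    h.covAlong_pushField_right hs hf hiso hE hE', h.covAlong_xi_right hs hf, frameSection]
  module

theorem meanCurvatureVector_eq (h : IsAdaptedFrameAt I I' ξ f T Ξ x)
    (hs : IsSasakian I ξ η φ) (hf : ContMDiff I' I ∞ f)
    (hiso : ∀ (y : N) (u v : TangentSpace I' y),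
      (inner ℝ (mfderiv I' I f y u) (mfderiv I' I f y v) : ℝ) = inner ℝ u v)
    (hE : Module.finrank ℝ E = 3) (hE' : Module.finrank ℝ E' = 2) :
    meanCurvatureVector I I' f x
      = (fieldCurvature I I' φ f T x / 2) • phiPushField I I' φ f T x := by
  have hsm : ∀ k, ContMDiffAt I' I'.tangent 1 (T% (![T, Ξ] k)) x := fun k ↦ by
    fin_cases k
    · exact h.smooth_left.of_le (by norm_num)
    · exact h.smooth_right.of_le (by norm_num)
  have hsum : ∀ᶠ y in 𝓝 x, ∀ v : TangentSpace I' y,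
      v = ∑ k, (inner ℝ (![T, Ξ] k y) v : ℝ) • ![T, Ξ] k y := by
    filter_upwards [h.eventually] with y hy v
    rw [Fin.sum_univ_two]
    exact hy.eq_sum hE' v
  have h1 := tensionField_eq_sum hsm hsum (h.leviCivita_eq_zero hs hf hiso hE hE')
    ((hf x).of_le ENat.LEInfty.out)
  rw [Fin.sum_univ_two] at h1
  have h2 : tensionField I I' f x = covAlong I I' f (pushField I I' f T) x (T x)
      + covAlong I I' f (fun y ↦ mfderiv I' I f y (Ξ y)) x (Ξ x) := h1
  rw [covAlong_congr h.mfderiv_right, h.covAlong_xi_right hs hf, add_zero,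
    h.covAlong_pushField_left hs hf hiso hE] at h2
  rw [meanCurvatureVector, h2, hE', smul_smul]
  congr 1
  push_cast
  ring

theorem norm_meanCurvatureVector_sq (h : IsAdaptedFrameAt I I' ξ f T Ξ x)
    (hs : IsSasakian I ξ η φ) (hf : ContMDiff I' I ∞ f)
    (hiso : ∀ (y : N) (u v : TangentSpace I' y),
      (inner ℝ (mfderiv I' I f y u) (mfderiv I' I f y v) : ℝ) = inner ℝ u v)
    (hE : Module.finrank ℝ E = 3) (hE' : Module.finrank ℝ E' = 2) :
    4 * ‖meanCurvatureVector I I' f x‖ ^ 2 = fieldCurvature I I' φ f T x ^ 2 := by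
  rw [h.meanCurvatureVector_eq hs hf hiso hE hE', ← real_inner_self_eq_norm_sq,
    real_inner_smul_left, real_inner_smul_right, h.inner_phiPushField_self hs hiso]
  ring

/-- The Jacobi operator of the mean curvature vector field in the frame `(φ df(T), df(T), ξ)`. -/
theorem jacobiOperator_meanCurvatureVector (h : IsAdaptedFrameAt I I' ξ f T Ξ x)
    (hs : IsSasakian I ξ η φ) (hf : ContMDiff I' I ∞ f)
    (hiso : ∀ (y : N) (u v : TangentSpace I' y),
      (inner ℝ (mfderiv I' I f y u) (mfderiv I' I f y v) : ℝ) = inner ℝ u v)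
    (hE : Module.finrank ℝ E = 3) (hE' : Module.finrank ℝ E' = 2)
    {c : ℝ} (hc : HasConstHolSectionalCurvature I φ c) :
    jacobiOperator I I' f (meanCurvatureVector I I' f) x
      = frameSection I I' ξ φ f T
        (fun y ↦ (fieldCurvature I I' φ f T y ^ 3 + fieldCurvature I I' φ f T y * (1 - c)
          - mvfderiv I' (fun z ↦ mvfderiv I' (fieldCurvature I I' φ f T) z (T z)) y (T y)
          - mvfderiv I' (fun z ↦ mvfderiv I' (fieldCurvature I I' φ f T) z (Ξ z)) y (Ξ y)) / 2)
        (fun y ↦ 3 / 2 * (fieldCurvature I I' φ f T y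
            * mvfderiv I' (fieldCurvature I I' φ f T) y (T y))
          - mvfderiv I' (fieldCurvature I I' φ f T) y (Ξ y))
        (fun y ↦ -mvfderiv I' (fieldCurvature I I' φ f T) y (T y)) x := by
  set k := fieldCurvature I I' φ f T with hk
  have hk2 : ContMDiffAt I' 𝓘(ℝ, ℝ) 2 k x := h.contMDiffAt_fieldCurvature hs hf
  have hk1 : ∀ᶠ y in 𝓝 x, ContMDiffAt I' 𝓘(ℝ, ℝ) 1 k y := by
    have : IsManifold I' 1 N := .of_le (n := ∞) ENat.LEInfty.out
    exact (contMDiffAt_iff_contMDiffAt_nhds (by simp)).1 (hk2.of_le one_le_two)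
  have hkx := hk2.mdifferentiableAt two_ne_zero
  have c0 : ∀ y, ContMDiffAt I' 𝓘(ℝ, ℝ) 1 (fun _ : N ↦ (0 : ℝ)) y := fun y ↦ contMDiffAt_const
  have cm : ∀ (a : ℝ) {g : N → ℝ} {y : N}, ContMDiffAt I' 𝓘(ℝ, ℝ) 1 g y →
      ContMDiffAt I' 𝓘(ℝ, ℝ) 1 (fun y ↦ a * g y) y := fun a g y hg ↦
    contMDiffAt_const.mul hg
  have hT1 := h.smooth_left.of_le (m := 1) (by norm_num)
  have hΞ1 := h.smooth_right.of_le (m := 1) (by norm_num)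
  have hkT : ContMDiffAt I' 𝓘(ℝ, ℝ) 1 (fun y ↦ mvfderiv I' k y (T y)) x :=
    contMDiffAt_mvfderiv_apply hk2 hT1 (by norm_num)
  have hkΞ : ContMDiffAt I' 𝓘(ℝ, ℝ) 1 (fun y ↦ mvfderiv I' k y (Ξ y)) x :=
    contMDiffAt_mvfderiv_apply hk2 hΞ1 (by norm_num)
  have hmean : ∀ᶠ y in 𝓝 x, meanCurvatureVector I I' f y
      = frameSection I I' ξ φ f T (fun y ↦ 1 / 2 * k y) (fun _ ↦ 0) (fun _ ↦ 0) y := by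
    filter_upwards [h.eventually] with y hy
    rw [hy.meanCurvatureVector_eq hs hf hiso hE hE', frameSection]
    module
  have hmeans : ContMDiffAlongAt I I' 2 f (meanCurvatureVector I I' f) x :=
    (ContMDiffAlongAt.smul (contMDiffAt_const.mul hk2)
      ((h.contMDiffAlongAt_phiPushField hs hf).of_le (m := 2) (by norm_num))).congr
      (h.eventually.mono fun y hy ↦ by
        rw [hy.meanCurvatureVector_eq hs hf hiso hE hE', div_eq_inv_mul]; rfl)
  have hsm : ∀ k, ContMDiffAt I' I'.tangent 1 (T% (![T, Ξ] k)) x := fun k ↦ by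
    fin_cases k
    · exact hT1
    · exact hΞ1
  have hsum : ∀ᶠ y in 𝓝 x, ∀ v : TangentSpace I' y,
      v = ∑ k, (inner ℝ (![T, Ξ] k y) v : ℝ) • ![T, Ξ] k y := by
    filter_upwards [h.eventually] with y hy v
    rw [Fin.sum_univ_two]
    exact hy.eq_sum hE' v
  have h1 := roughLaplacian_eq_sum hsm hsum (h.leviCivita_eq_zero hs hf hiso hE hE') hmeans
  rw [Fin.sum_univ_two] at h1
  have h2 : roughLaplacian I I' f (meanCurvatureVector I I' f) x
      = -(covAlong I I' f (fun y ↦ covAlong I I' f (meanCurvatureVector I I' f) y (T y)) x (T x)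
        + covAlong I I' f (fun y ↦ covAlong I I' f (meanCurvatureVector I I' f) y (Ξ y)) x (Ξ x)) :=
    h1
  have hTcov : ∀ᶠ y in 𝓝 x, covAlong I I' f (meanCurvatureVector I I' f) y (T y)
      = frameSection I I' ξ φ f T (fun y ↦ 1 / 2 * mvfderiv I' k y (T y))
        (fun y ↦ -1 / 2 * k y ^ 2) (fun y ↦ 1 / 2 * k y) y := by
    filter_upwards [h.eventually, hmean.eventually_nhds, hk1] with y hy hm hky
    rw [covAlong_congr hm, hy.covAlong_frameSection_left hs hf hiso hE (cm _ hky) (c0 y) (c0 y)]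
    simp only [frameSection, mvfderiv_const_mul _ (hky.mdifferentiableAt one_ne_zero),
      mvfderiv_const, zero_apply, ← hk]
    module
  have hΞcov : ∀ᶠ y in 𝓝 x, covAlong I I' f (meanCurvatureVector I I' f) y (Ξ y)
      = frameSection I I' ξ φ f T (fun y ↦ 1 / 2 * mvfderiv I' k y (Ξ y))
        (fun y ↦ 1 / 2 * k y) (fun _ ↦ 0) y := by
    filter_upwards [h.eventually, hmean.eventually_nhds, hk1] with y hy hm hky
    rw [covAlong_congr hm, hy.covAlong_frameSection_right hs hf hiso hE hE' (cm _ hky) (c0 y) (c0 y)]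
    simp only [frameSection, mvfderiv_const_mul _ (hky.mdifferentiableAt one_ne_zero),
      mvfderiv_const, zero_apply]
    module
  have hksq : ContMDiffAt I' 𝓘(ℝ, ℝ) 1 (fun y ↦ k y ^ 2) x := (hk2.of_le one_le_two).pow 2
  have h3 : curvatureTerm I I' f (meanCurvatureVector I I' f) x
      = (k x / 2 * (c + 1)) • phiPushField I I' φ f T x := by
    simp only [curvatureTerm, h.meanCurvatureVector_eq hs hf hiso hE hE', h.mfderiv_eq hE']
    exact hs.sum_curvatureTensor hE hc (h.eventually_inner_pushField hiso).self_of_nhds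
      (h.eta_pushField hs hiso) (k x / 2) (stdOrthonormalBasis ℝ (TangentSpace I' x))
      h.norm_left.self_of_nhds h.norm_right.self_of_nhds h.inner_eq_zero.self_of_nhds
  rw [jacobiOperator, h2, h3, covAlong_congr hTcov, covAlong_congr hΞcov,
    h.covAlong_frameSection_left hs hf hiso hE (cm _ hkT) (cm _ hksq) (cm _ hk1.self_of_nhds),
    h.covAlong_frameSection_right hs hf hiso hE hE' (cm _ hkΞ) (cm _ hk1.self_of_nhds) (c0 x)]
  simp only [frameSection, mvfderiv_const_mul _ hkx,
    mvfderiv_const_mul _ (hkT.mdifferentiableAt one_ne_zero),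
    mvfderiv_const_mul _ (hkΞ.mdifferentiableAt one_ne_zero),
    mvfderiv_const_mul _ (hksq.mdifferentiableAt one_ne_zero), mvfderiv_sq hkx,
    mvfderiv_const, zero_apply, ← hk]
  module

/-- `a φ(df(T)) + b df(T) + r ξ` determines its coefficients. -/
theorem frameSection_eq_smul (h : IsAdaptedFrameAt I I' ξ f T Ξ x)
    (hs : IsSasakian I ξ η φ)
    (hiso : ∀ (y : N) (u v : TangentSpace I' y),
      (inner ℝ (mfderiv I' I f y u) (mfderiv I' I f y v) : ℝ) = inner ℝ u v)
    {l : ℝ}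
    (he : frameSection I I' ξ φ f T a b r x = l • phiPushField I I' φ f T x) :
    a x = l ∧ b x = 0 ∧ r x = 0 := by
  have n1 := h.inner_phiPushField_self hs hiso
  have n2 := (h.eventually_inner_pushField hiso).self_of_nhds
  have n3 := hs.inner_xi_xi (f x)
  have o1 : (inner ℝ (pushField I I' f T x) (phiPushField I I' φ f T x) : ℝ) = 0 :=
    hs.inner_phi_self _ _
  have o2 : (inner ℝ (ξ (f x)) (phiPushField I I' φ f T x) : ℝ) = 0 := hs.inner_xi_phi _ _
  have o3 := (h.eventually_inner_xi hiso).self_of_nhds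
  have o1' := (real_inner_comm _ _).trans o1
  have o2' := (real_inner_comm _ _).trans o2
  have o3' := (real_inner_comm _ _).trans o3
  have key : ∀ w : TangentSpace I (f x),
      (inner ℝ w (frameSection I I' ξ φ f T a b r x) : ℝ)
        = inner ℝ w (l • phiPushField I I' φ f T x) := fun w ↦ by rw [he]
  simp only [frameSection, inner_add_right, real_inner_smul_right] at key
  refine ⟨?_, ?_, ?_⟩
  · have := key (phiPushField I I' φ f T x)
    rw [n1, o1', o2'] at this
    linarith
  · have := key (pushField I I' f T x)
    rw [n2, o1, o3'] at this
    linarith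
  · have := key (ξ (f x))
    rw [n3, o2, o3] at this
    linarith

end IsAdaptedFrameAt

end JacobiOperator

noncomputable section JacobiEigenfields

variable {E : Type*} [NormedAddCommGroup E] [NormedSpace ℝ E] [FiniteDimensional ℝ E]
  {H : Type*} [TopologicalSpace H] {I : ModelWithCorners ℝ E H} [I.Boundaryless]
  {M : Type*} [TopologicalSpace M] [ChartedSpace H M] [IsManifold I ∞ M]
  [RiemannianBundle (fun x : M ↦ TangentSpace I x)]
  [IsContMDiffRiemannianBundle I ∞ E (fun x : M ↦ TangentSpace I x)]
  {E' : Type*} [NormedAddCommGroup E'] [NormedSpace ℝ E'] [FiniteDimensional ℝ E']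
  {H' : Type*} [TopologicalSpace H'] {I' : ModelWithCorners ℝ E' H'} [I'.Boundaryless]
  {N : Type*} [TopologicalSpace N] [ChartedSpace H' N] [IsManifold I' ∞ N]
  [RiemannianBundle (fun x : N ↦ TangentSpace I' x)]
  [IsContMDiffRiemannianBundle I' ∞ E' (fun x : N ↦ TangentSpace I' x)]
  {f : N → M} {x : N}
  {ξ : Π x : M, TangentSpace I x} {η : Π x : M, TangentSpace I x →L[ℝ] ℝ}
  {φ : Π x : M, TangentSpace I x →L[ℝ] TangentSpace I x} {T Ξ : Π y : N, TangentSpace I' y}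

theorem IsAdaptedFrameAt.of_jacobiOperator_eq (h : IsAdaptedFrameAt I I' ξ f T Ξ x)
    (hs : IsSasakian I ξ η φ) (hf : ContMDiff I' I ∞ f)
    (hiso : ∀ (y : N) (u v : TangentSpace I' y),
      (inner ℝ (mfderiv I' I f y u) (mfderiv I' I f y v) : ℝ) = inner ℝ u v)
    (hE : Module.finrank ℝ E = 3) (hE' : Module.finrank ℝ E' = 2) {c l : ℝ}
    (hc : HasConstHolSectionalCurvature I φ c)
    (hl : ∀ y, jacobiOperator I I' f (meanCurvatureVector I I' f) y
      = l • meanCurvatureVector I I' f y) :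
    mvfderiv I' (fieldCurvature I I' φ f T) x (T x) = 0 ∧
      (fieldCurvature I I' φ f T x ≠ 0 → l = fieldCurvature I I' φ f T x ^ 2 + 1 - c) := by
  set k := fieldCurvature I I' φ f T with hk
  have key : ∀ᶠ y in 𝓝 x,
      (k y ^ 3 + k y * (1 - c) - mvfderiv I' (fun z ↦ mvfderiv I' k z (T z)) y (T y)
        - mvfderiv I' (fun z ↦ mvfderiv I' k z (Ξ z)) y (Ξ y)) / 2 = l * (k y / 2) ∧
      3 / 2 * (k y * mvfderiv I' k y (T y)) - mvfderiv I' k y (Ξ y) = 0 ∧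
      -mvfderiv I' k y (T y) = 0 := by
    filter_upwards [h.eventually] with y hy
    have he := (hy.jacobiOperator_meanCurvatureVector hs hf hiso hE hE' hc).symm.trans (hl y)
    rw [hy.meanCurvatureVector_eq hs hf hiso hE hE', smul_smul] at he
    exact hy.frameSection_eq_smul hs hiso he
  have hT : ∀ᶠ y in 𝓝 x, mvfderiv I' k y (T y) = 0 := key.mono fun y hy ↦ neg_eq_zero.1 hy.2.2
  have hΞ : ∀ᶠ y in 𝓝 x, mvfderiv I' k y (Ξ y) = 0 := by
    filter_upwards [key, hT] with y hy hy'
    have := hy.2.1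
    rw [hy'] at this
    linarith
  refine ⟨hT.self_of_nhds, fun h0 ↦ ?_⟩
  have h1 := key.self_of_nhds.1
  rw [mvfderiv_congr hT, mvfderiv_congr hΞ, mvfderiv_const, zero_apply, zero_apply] at h1
  have h2 : k x * (k x ^ 2 + 1 - c - l) = 0 := by linarith
  linarith [(mul_eq_zero.1 h2).resolve_left h0]

theorem IsAdaptedFrameAt.jacobiOperator_eq_of_sq_eq (h : IsAdaptedFrameAt I I' ξ f T Ξ x)
    (hs : IsSasakian I ξ η φ) (hf : ContMDiff I' I ∞ f)
    (hiso : ∀ (y : N) (u v : TangentSpace I' y),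
      (inner ℝ (mfderiv I' I f y u) (mfderiv I' I f y v) : ℝ) = inner ℝ u v)
    (hE : Module.finrank ℝ E = 3) (hE' : Module.finrank ℝ E' = 2) {c K : ℝ}
    (hc : HasConstHolSectionalCurvature I φ c)
    (hK : ∀ᶠ y in 𝓝 x, fieldCurvature I I' φ f T y ^ 2 = K) :
    jacobiOperator I I' f (meanCurvatureVector I I' f) x
      = (K + 1 - c) • meanCurvatureVector I I' f x := by
  have hd : ∀ᶠ y in 𝓝 x, ∀ u, mvfderiv I' (fieldCurvature I I' φ f T) y u = 0 := by
    filter_upwards [h.eventually, hK.eventually_nhds] with y hy hKy u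
    by_cases h0 : fieldCurvature I I' φ f T y = 0
    · have hK0 : K = 0 := by rw [← hKy.self_of_nhds, h0]; ring
      have : ∀ᶠ z in 𝓝 y, fieldCurvature I I' φ f T z = 0 :=
        hKy.mono fun z hz ↦ pow_eq_zero_iff two_ne_zero |>.1 (hz.trans hK0)
      rw [mvfderiv_congr this, mvfderiv_const, zero_apply]
    · have h1 := mvfderiv_sq
        ((hy.contMDiffAt_fieldCurvature hs hf).mdifferentiableAt two_ne_zero) u
      rw [mvfderiv_congr hKy, mvfderiv_const, zero_apply] at h1
      have h2 : fieldCurvature I I' φ f T y * mvfderiv I' (fieldCurvature I I' φ f T) y u = 0 := by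
        linarith
      exact (mul_eq_zero.1 h2).resolve_left h0
  have hT : ∀ᶠ y in 𝓝 x, mvfderiv I' (fieldCurvature I I' φ f T) y (T y) = 0 :=
    hd.mono fun y hy ↦ hy _
  have hΞ : ∀ᶠ y in 𝓝 x, mvfderiv I' (fieldCurvature I I' φ f T) y (Ξ y) = 0 :=
    hd.mono fun y hy ↦ hy _
  rw [h.jacobiOperator_meanCurvatureVector hs hf hiso hE hE' hc,
    h.meanCurvatureVector_eq hs hf hiso hE hE', ← hK.self_of_nhds]
  simp only [frameSection]
  rw [mvfderiv_congr hT, mvfderiv_congr hΞ, mvfderiv_const, zero_apply, zero_apply, hT.self_of_nhds, hΞ.self_of_nhds]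
  module

end JacobiEigenfields

noncomputable section HopfCylinders

variable {M : Type*} [TopologicalSpace M] [ChartedSpace (EuclideanSpace ℝ (Fin 3)) M]
  [IsManifold (𝓡 3) ∞ M]
  [RiemannianBundle (fun x : M ↦ TangentSpace (𝓡 3) x)]
  [IsContMDiffRiemannianBundle (𝓡 3) ∞ (EuclideanSpace ℝ (Fin 3))
      (fun x : M ↦ TangentSpace (𝓡 3) x)]
  {B : Type*} [TopologicalSpace B] [ChartedSpace (EuclideanSpace ℝ (Fin 2)) B]
  [IsManifold (𝓡 2) ∞ B]
  [RiemannianBundle (fun x : B ↦ TangentSpace (𝓡 2) x)]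
  [IsContMDiffRiemannianBundle (𝓡 2) ∞ (EuclideanSpace ℝ (Fin 2))
      (fun x : B ↦ TangentSpace (𝓡 2) x)]
  {S : Type*} [TopologicalSpace S] [ChartedSpace (EuclideanSpace ℝ (Fin 2)) S]
  [IsManifold (𝓡 2) ∞ S]
  [RiemannianBundle (fun x : S ↦ TangentSpace (𝓡 2) x)]
  [IsContMDiffRiemannianBundle (𝓡 2) ∞ (EuclideanSpace ℝ (Fin 2))
      (fun x : S ↦ TangentSpace (𝓡 2) x)]
  {ξ : Π x : M, TangentSpace (𝓡 3) x} {η : Π x : M, TangentSpace (𝓡 3) x →L[ℝ] ℝ}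
  {φ : Π x : M, TangentSpace (𝓡 3) x →L[ℝ] TangentSpace (𝓡 3) x} {pr : M → B}
  {J : Set ℝ} {γ : ℝ → B} {ι : S → M} {σ : S → ℝ} {x : S}

theorem contMDiffAt_parameter_eventually {n : ℕ}
    (hσ : ContMDiffAt (𝓡 2) 𝓘(ℝ, ℝ) ∞ σ x) :
    ∀ᶠ y in 𝓝 x, ContMDiffAt (𝓡 2) 𝓘(ℝ, ℝ) n σ y := by
  have : IsManifold (𝓡 2) n S := .of_le (n := ∞) ENat.LEInfty.out
  exact (contMDiffAt_iff_contMDiffAt_nhds (by simp)).1 (hσ.of_le ENat.LEInfty.out)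

/-- The metric of a Hopf cylinder is `dσ² + (ι^*η)²`. -/
theorem IsHopfCylinder.eventually_inner_eq (hι : IsHopfCylinder pr γ J ι)
    (hpr : IsBoothbyWangFibration ξ pr) (hs : IsSasakian (𝓡 3) ξ η φ) (hJ : IsOpen J)
    (hγ : IsUnitSpeedOn (𝓡 2) γ J) (hσ : IsParameterAt pr γ J ι σ x) :
    ∀ᶠ y in 𝓝 x, ∀ u v : TangentSpace (𝓡 2) y,
      (inner ℝ u v : ℝ) = mvfderiv (𝓡 2) σ y u * mvfderiv (𝓡 2) σ y v
        + inner ℝ (ξ (ι y)) (mfderiv (𝓡 2) (𝓡 3) ι y u)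
          * inner ℝ (ξ (ι y)) (mfderiv (𝓡 2) (𝓡 3) ι y v) := by
  filter_upwards [hσ.2.eventually_nhds, contMDiffAt_parameter_eventually (n := 1) hσ.1]
    with y hy hy1 u v
  have hγy : MDifferentiableAt 𝓘(ℝ, ℝ) (𝓡 2) γ (σ y) :=
    (hγ.smooth.contMDiffAt (hJ.mem_nhds hy.self_of_nhds.1)).mdifferentiableAt (by simp)
  have hc : pr ∘ ι =ᶠ[𝓝 y] γ ∘ σ := hy.mono fun z hz ↦ hz.2
  have hd : ∀ u : TangentSpace (𝓡 2) y,
      (mfderiv (𝓡 3) (𝓡 2) pr (ι y) (mfderiv (𝓡 2) (𝓡 3) ι y u) : EuclideanSpace ℝ (Fin 2))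
        = mvfderiv (𝓡 2) σ y u • velocity (𝓡 2) γ (σ y) := by
    intro u
    have a1 := mfderiv_comp_apply y ((hpr.smooth (ι y)).mdifferentiableAt (by simp))
      ((hι.smooth y).mdifferentiableAt (by simp)) u
    have a2 := mfderiv_comp_apply y hγy (hy1.mdifferentiableAt one_ne_zero) u
    have a4 : mfderiv (𝓡 2) (𝓡 2) (pr ∘ ι) y = mfderiv (𝓡 2) (𝓡 2) (γ ∘ σ) y := hc.mfderiv_eq
    have a5 : mfderiv 𝓘(ℝ, ℝ) (𝓡 2) γ (σ y) (mfderiv (𝓡 2) 𝓘(ℝ, ℝ) σ y u)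
        = mvfderiv (𝓡 2) σ y u • velocity (𝓡 2) γ (σ y) := by
      have b1 : mfderiv 𝓘(ℝ, ℝ) (𝓡 2) γ (σ y) (mvfderiv (𝓡 2) σ y u • (1 : ℝ))
          = mvfderiv (𝓡 2) σ y u • velocity (𝓡 2) γ (σ y) := ContinuousLinearMap.map_smul _ _ _
      have b2 : mvfderiv (𝓡 2) σ y u • (1 : ℝ) = mfderiv (𝓡 2) 𝓘(ℝ, ℝ) σ y u := mul_one _
      exact (congrArg (fun t : ℝ ↦ mfderiv 𝓘(ℝ, ℝ) (𝓡 2) γ (σ y) t) b2).symm.trans b1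
    exact a1.symm.trans ((congrArg (fun L ↦ L u) a4).trans (a2.trans a5))
  have hcast : ∀ {p q : B} (_ : p = q) {a b : TangentSpace (𝓡 2) p} {a' b' : TangentSpace (𝓡 2) q}
      (_ : (a : EuclideanSpace ℝ (Fin 2)) = a') (_ : (b : EuclideanSpace ℝ (Fin 2)) = b'),
      (inner ℝ a b : ℝ) = inner ℝ a' b' := by
    rintro p q rfl a b a' b' rfl rfl
    rfl
  have h1 := hpr.inner_mfderiv hs (ι y) (mfderiv (𝓡 2) (𝓡 3) ι y u) (mfderiv (𝓡 2) (𝓡 3) ι y v)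
  have h2 := hcast hy.self_of_nhds.2 (hd u) (hd v)
  have h3 : (inner ℝ (mvfderiv (𝓡 2) σ y u • velocity (𝓡 2) γ (σ y))
      (mvfderiv (𝓡 2) σ y v • velocity (𝓡 2) γ (σ y)) : ℝ)
      = mvfderiv (𝓡 2) σ y u * mvfderiv (𝓡 2) σ y v := by
    rw [real_inner_smul_left, real_inner_smul_right, real_inner_self_eq_norm_sq,
      hγ.norm_velocity _ hy.self_of_nhds.1]
    ring
  have h4 := (h1.symm.trans h2).trans h3
  rw [hι.isometric] at h4
  linarith

end HopfCylinders

noncomputable section HopfCylinderCurvature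

variable {M : Type*} [TopologicalSpace M] [ChartedSpace (EuclideanSpace ℝ (Fin 3)) M]
  [IsManifold (𝓡 3) ∞ M]
  [RiemannianBundle (fun x : M ↦ TangentSpace (𝓡 3) x)]
  [IsContMDiffRiemannianBundle (𝓡 3) ∞ (EuclideanSpace ℝ (Fin 3))
      (fun x : M ↦ TangentSpace (𝓡 3) x)]
  {B : Type*} [TopologicalSpace B] [ChartedSpace (EuclideanSpace ℝ (Fin 2)) B]
  [IsManifold (𝓡 2) ∞ B]
  [RiemannianBundle (fun x : B ↦ TangentSpace (𝓡 2) x)]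
  [IsContMDiffRiemannianBundle (𝓡 2) ∞ (EuclideanSpace ℝ (Fin 2))
      (fun x : B ↦ TangentSpace (𝓡 2) x)]
  {S : Type*} [TopologicalSpace S] [ChartedSpace (EuclideanSpace ℝ (Fin 2)) S]
  [IsManifold (𝓡 2) ∞ S]
  [RiemannianBundle (fun x : S ↦ TangentSpace (𝓡 2) x)]
  [IsContMDiffRiemannianBundle (𝓡 2) ∞ (EuclideanSpace ℝ (Fin 2))
      (fun x : S ↦ TangentSpace (𝓡 2) x)]
  {ξ : Π x : M, TangentSpace (𝓡 3) x} {η : Π x : M, TangentSpace (𝓡 3) x →L[ℝ] ℝ}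
  {φ : Π x : M, TangentSpace (𝓡 3) x →L[ℝ] TangentSpace (𝓡 3) x} {pr : M → B}
  {J : Set ℝ} {γ : ℝ → B} {ι : S → M} {σ : S → ℝ} {x : S}

theorem exists_isOrthonormalFrameAt_two (x : S) :
    ∃ b : Fin 2 → Π q : S, TangentSpace (𝓡 2) q, IsOrthonormalFrameAt (𝓡 2) b x := by
  have h := exists_isOrthonormalFrameAt (𝓡 2) x
  rwa [finrank_euclideanSpace_fin] at h

/-- Two covectors `a`, `b` of the plane with `a ⊗ a + b ⊗ b` the metric are orthonormal. -/
theorem orthonormal_rows_of_columns {a b : Fin 2 → ℝ}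
    (h : ∀ i j, a i * a j + b i * b j = if i = j then 1 else 0) :
    a 0 * a 0 + a 1 * a 1 = 1 ∧ b 0 * b 0 + b 1 * b 1 = 1 ∧ a 0 * b 0 + a 1 * b 1 = 0 := by
  have h1 : (Matrix.of ![a, b]).transpose * Matrix.of ![a, b] = 1 := by
    ext i j
    simp [Matrix.mul_apply, Fin.sum_univ_two, Matrix.one_apply, h]
  have h2 := mul_eq_one_comm.1 h1
  have e := fun i j ↦ congrFun (congrFun h2 i) j
  have e00 := e 0 0
  have e11 := e 1 1
  have e01 := e 0 1
  simp [Matrix.mul_apply, Fin.sum_univ_two] at e00 e11 e01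
  exact ⟨e00, e11, e01⟩

theorem IsHopfCylinder.exists_isAdaptedFrameAt (hι : IsHopfCylinder pr γ J ι)
    (hpr : IsBoothbyWangFibration ξ pr) (hs : IsSasakian (𝓡 3) ξ η φ) (hJ : IsOpen J)
    (hγ : IsUnitSpeedOn (𝓡 2) γ J) (hσ : IsParameterAt pr γ J ι σ x) :
    ∃ T Ξ : Π y : S, TangentSpace (𝓡 2) y, IsAdaptedFrameAt (𝓡 3) (𝓡 2) ξ ι T Ξ x ∧
      ∀ᶠ y in 𝓝 x, mvfderiv (𝓡 2) σ y (T y) = 1 := by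
  obtain ⟨e, he⟩ := exists_isOrthonormalFrameAt_two x
  have h3 : (3 : WithTop ℕ∞) ≤ ∞ := ENat.LEInfty.out
  have hes : ∀ i, ContMDiffAt (𝓡 2) (𝓡 2).tangent 3 (T% (e i)) x := fun i ↦
    (he.smooth.self_of_nhds i).of_le h3
  set a : Fin 2 → S → ℝ := fun i y ↦ mvfderiv (𝓡 2) σ y (e i y) with ha
  set b : Fin 2 → S → ℝ := fun i y ↦ inner ℝ (ξ (ι y)) (mfderiv (𝓡 2) (𝓡 3) ι y (e i y)) with hb
  have has : ∀ i, ContMDiffAt (𝓡 2) 𝓘(ℝ, ℝ) 3 (a i) x := fun i ↦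
    contMDiffAt_mvfderiv_apply (n := 4) (hσ.1.of_le ENat.LEInfty.out) (hes i) (by norm_num)
  have hbs : ∀ i, ContMDiffAt (𝓡 2) 𝓘(ℝ, ℝ) 3 (b i) x := fun i ↦
    contMDiffAt_inner_along
      (contMDiffAlongAt_comp (hs.contMDiffAt_xi h3 _) ((hι.smooth x).of_le h3))
      (contMDiffAlongAt_mfderiv (n := 4) ((hι.smooth x).of_le ENat.LEInfty.out) (hes i)
        (by norm_num)) h3
  have hab : ∀ᶠ y in 𝓝 x, a 0 y * a 0 y + a 1 y * a 1 y = 1 ∧ b 0 y * b 0 y + b 1 y * b 1 y = 1 ∧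
      a 0 y * b 0 y + a 1 y * b 1 y = 0 := by
    filter_upwards [he.orthonormal, hι.eventually_inner_eq hpr hs hJ hγ hσ] with y hy hy'
    refine orthonormal_rows_of_columns (a := fun i ↦ a i y) (b := fun i ↦ b i y) fun i j ↦ ?_
    rw [← orthonormal_iff_ite.1 hy i j, hy']
  have hcomb : ∀ᶠ y in 𝓝 x, ∀ s t s' t' : ℝ,
      (inner ℝ (s • e 0 y + t • e 1 y) (s' • e 0 y + t' • e 1 y) : ℝ) = s * s' + t * t' := by
    filter_upwards [he.orthonormal] with y hy s t s' t'
    have h00 := orthonormal_iff_ite.1 hy 0 0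
    have h01 := orthonormal_iff_ite.1 hy 0 1
    have h10 := orthonormal_iff_ite.1 hy 1 0
    have h11 := orthonormal_iff_ite.1 hy 1 1
    simp only [Fin.isValue, one_ne_zero, zero_ne_one, if_true, if_false] at h00 h01 h10 h11
    simp only [inner_add_left, inner_add_right, real_inner_smul_left, real_inner_smul_right, h00,
      h01, h10, h11]
    ring
  have hn : ∀ {y : S} {v : TangentSpace (𝓡 2) y}, (inner ℝ v v : ℝ) = 1 → ‖v‖ = 1 := by
    intro y v hv
    rw [real_inner_self_eq_norm_sq] at hv
    nlinarith [norm_nonneg v]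
  refine ⟨fun y ↦ a 0 y • e 0 y + a 1 y • e 1 y, fun y ↦ b 0 y • e 0 y + b 1 y • e 1 y,
    ⟨?_, ?_, ?_, ?_, ?_, ?_⟩, ?_⟩
  · exact ((has 0).smul_section (hes 0)).add_section ((has 1).smul_section (hes 1))
  · exact ((hbs 0).smul_section (hes 0)).add_section ((hbs 1).smul_section (hes 1))
  · filter_upwards [hab, hcomb] with y hy hy'
    exact hn ((hy' _ _ _ _).trans hy.1)
  · filter_upwards [hab, hcomb] with y hy hy'
    exact hn ((hy' _ _ _ _).trans hy.2.1)
  · filter_upwards [hab, hcomb] with y hy hy'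
    exact (hy' _ _ _ _).trans hy.2.2
  · filter_upwards [hab, hcomb] with y hy hy'
    rw [← sub_eq_zero, ← inner_self_eq_zero (𝕜 := ℝ), inner_sub_left, inner_sub_right,
      inner_sub_right, hι.isometric, hy', hs.inner_xi_xi, real_inner_comm, map_add, map_smul,
      map_smul, inner_add_right, real_inner_smul_right, real_inner_smul_right]
    have : b 0 y * b 0 y + b 1 y * b 1 y = 1 := hy.2.1
    simp only [hb] at this ⊢
    linarith
  · filter_upwards [hab] with y hy
    rw [map_add, map_smul, map_smul]
    exact hy.1

/-- The squared curvature of the base curve is the squared curvature of its horizontal lifts. -/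
theorem IsHopfCylinder.eventually_fieldCurvature_sq (hι : IsHopfCylinder pr γ J ι)
    (hpr : IsBoothbyWangFibration ξ pr) (hs : IsSasakian (𝓡 3) ξ η φ) (hJ : IsOpen J)
    (hγ : IsUnitSpeedOn (𝓡 2) γ J) (hσ : IsParameterAt pr γ J ι σ x)
    {T Ξ : Π y : S, TangentSpace (𝓡 2) y} (hT : IsAdaptedFrameAt (𝓡 3) (𝓡 2) ξ ι T Ξ x)
    (hTσ : ∀ᶠ y in 𝓝 x, mvfderiv (𝓡 2) σ y (T y) = 1) :
    ∀ᶠ y in 𝓝 x, fieldCurvature (𝓡 3) (𝓡 2) φ ι T y ^ 2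
      = ‖covCurve (𝓡 2) γ (velocity (𝓡 2) γ) (σ y)‖ ^ 2 := by
  filter_upwards [hT.eventually, hTσ.eventually_nhds, hσ.2.eventually_nhds,
    contMDiffAt_parameter_eventually (n := 1) hσ.1] with y h1 h2 h3 h4
  have h5 := hpr.norm_covCurve_velocity hs hJ hγ.smooth hι.smooth h4 h3
    (h1.smooth_left.of_le (by norm_num)) (h1.eventually_inner_xi hι.isometric) h2
  have h6 : covAlong (𝓡 3) (𝓡 2) ι (fun y ↦ mfderiv (𝓡 2) (𝓡 3) ι y (T y)) y (T y) = _ :=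
    h1.covAlong_pushField_left hs hι.smooth hι.isometric finrank_euclideanSpace_fin
  rw [h5, h6, ← real_inner_self_eq_norm_sq, hpr.inner_mfderiv hs, real_inner_smul_left,
    real_inner_smul_right, real_inner_smul_right,
    h1.inner_phiPushField_self hs hι.isometric, phiPushField, hs.inner_xi_phi]
  ring

end HopfCylinderCurvature

noncomputable section CurvesOfConstantCurvature

variable {E : Type*} [NormedAddCommGroup E] [NormedSpace ℝ E] [FiniteDimensional ℝ E]
  {H : Type*} [TopologicalSpace H] {I : ModelWithCorners ℝ E H}
  {M : Type*} [TopologicalSpace M] [ChartedSpace H M] [IsManifold I ∞ M]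
  [RiemannianBundle (fun x : M ↦ TangentSpace I x)]
  [IsContMDiffRiemannianBundle I ∞ E (fun x : M ↦ TangentSpace I x)]
  {γ : ℝ → M} {J : Set ℝ} {s : ℝ}

theorem IsUnitSpeedOn.contMDiffAlongAt_velocity (hγ : IsUnitSpeedOn I γ J) (hJ : IsOpen J)
    (hs : s ∈ J) : ContMDiffAlongAt I 𝓘(ℝ, ℝ) 2 γ (velocity I γ) s :=
  _root_.contMDiffAlongAt_velocity (n := 3)
    ((hγ.smooth.contMDiffAt (hJ.mem_nhds hs)).of_le ENat.LEInfty.out) (by norm_num)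

theorem IsUnitSpeedOn.contMDiffAlongAt_covCurve (hγ : IsUnitSpeedOn I γ J) (hJ : IsOpen J)
    (hs : s ∈ J) : ContMDiffAlongAt I 𝓘(ℝ, ℝ) 1 γ (covCurve I γ (velocity I γ)) s :=
  _root_.contMDiffAlongAt_covCurve (hγ.contMDiffAlongAt_velocity hJ hs) (by norm_num)
    ENat.LEInfty.out

theorem IsUnitSpeedOn.contMDiffAt_norm_covCurve_sq (hγ : IsUnitSpeedOn I γ J) (hJ : IsOpen J)
    (hs : s ∈ J) :
    ContMDiffAt 𝓘(ℝ, ℝ) 𝓘(ℝ, ℝ) 1 (fun t ↦ ‖covCurve I γ (velocity I γ) t‖ ^ 2) s := by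
  simp only [← real_inner_self_eq_norm_sq]
  exact contMDiffAt_inner_along (hγ.contMDiffAlongAt_covCurve hJ hs)
    (hγ.contMDiffAlongAt_covCurve hJ hs) ENat.LEInfty.out

theorem mvfderiv_inner_curve {V W : Π s : ℝ, TangentSpace I (γ s)}
    (hV : ContMDiffAlongAt I 𝓘(ℝ, ℝ) 1 γ V s) (hW : ContMDiffAlongAt I 𝓘(ℝ, ℝ) 1 γ W s) {r : ℝ}
    (h : ∀ᶠ t in 𝓝 s, (inner ℝ (V t) (W t) : ℝ) = r) :
    (inner ℝ (covCurve I γ V s) (W s) : ℝ) + inner ℝ (V s) (covCurve I γ W s) = 0 := by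
  have h1 := mvfderiv_inner_along hV hW (1 : ℝ)
  rw [mvfderiv_congr h, mvfderiv_const] at h1
  exact h1.symm

theorem IsUnitSpeedOn.inner_velocity_covCurve (hγ : IsUnitSpeedOn I γ J) (hJ : IsOpen J)
    (hs : s ∈ J) : (inner ℝ (velocity I γ s) (covCurve I γ (velocity I γ) s) : ℝ) = 0 := by
  have hv := (hγ.contMDiffAlongAt_velocity hJ hs).of_le (m := 1) one_le_two
  have h1 : ∀ᶠ t in 𝓝 s, (inner ℝ (velocity I γ t) (velocity I γ t) : ℝ) = 1 := by
    filter_upwards [hJ.mem_nhds hs] with t ht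
    rw [real_inner_self_eq_norm_sq, hγ.norm_velocity t ht, one_pow]
  have h2 := mvfderiv_inner_curve hv hv h1
  rw [real_inner_comm (velocity I γ s)] at h2
  linarith

/-- On a surface, the curves of constant curvature are the geodesics and the circles. -/
theorem IsUnitSpeedOn.isGeodesicOn_or_isRiemannianCircleOn_iff (hγ : IsUnitSpeedOn I γ J)
    (hJ : IsOpen J) (hE : Module.finrank ℝ E = 2) :
    IsGeodesicOn I γ J ∨ IsRiemannianCircleOn I γ J ↔
      ∃ K : ℝ, ∀ s ∈ J, ‖covCurve I γ (velocity I γ) s‖ ^ 2 = K := by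
  constructor
  · rintro (h | ⟨κ, -, p, hp⟩)
    · exact ⟨0, fun s hs ↦ by rw [h s hs, norm_zero, zero_pow two_ne_zero]⟩
    · refine ⟨κ ^ 2, fun s hs ↦ ?_⟩
      rw [(hp s hs).2.2.1, norm_smul, (hp s hs).1, mul_one, Real.norm_eq_abs, sq_abs]
  rintro ⟨K, hK⟩
  by_cases hg : IsGeodesicOn I γ J
  · exact Or.inl hg
  right
  simp only [IsGeodesicOn, not_forall] at hg
  obtain ⟨s₀, hs₀, h0⟩ := hg
  set κ := ‖covCurve I γ (velocity I γ) s₀‖ with hκ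
  have hκ0 : 0 < κ := norm_pos_iff.2 h0
  have hn : ∀ s ∈ J, ‖covCurve I γ (velocity I γ) s‖ = κ := fun s hs ↦
    (pow_left_inj₀ (norm_nonneg _) hκ0.le two_ne_zero).1 ((hK s hs).trans (hK s₀ hs₀).symm)
  set p : Π s : ℝ, TangentSpace I (γ s) := (fun _ : ℝ ↦ κ⁻¹) • covCurve I γ (velocity I γ) with hpdef
  have hps : ∀ s, p s = κ⁻¹ • covCurve I γ (velocity I γ) s := fun s ↦ rfl
  have hcp : ∀ s, covCurve I γ (velocity I γ) s = κ • p s := fun s ↦ by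
    rw [hps, smul_smul, mul_inv_cancel₀ hκ0.ne', one_smul]
  have hpn : ∀ s ∈ J, ‖p s‖ = 1 := fun s hs ↦ by
    rw [hps, norm_smul, hn s hs, norm_inv, Real.norm_eq_abs, abs_of_pos hκ0,
      inv_mul_cancel₀ hκ0.ne']
  have hvp : ∀ s ∈ J, (inner ℝ (velocity I γ s) (p s) : ℝ) = 0 := fun s hs ↦ by
    rw [hps, real_inner_smul_right, hγ.inner_velocity_covCurve hJ hs, mul_zero]
  refine ⟨κ, hκ0, p, fun s hs ↦ ⟨hpn s hs, hvp s hs, hcp s, ?_⟩⟩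
  have hv := (hγ.contMDiffAlongAt_velocity hJ hs).of_le (m := 1) one_le_two
  have hp : ContMDiffAlongAt I 𝓘(ℝ, ℝ) 1 γ p s :=
    ContMDiffAlongAt.smul contMDiffAt_const (hγ.contMDiffAlongAt_covCurve hJ hs)
  have h1 := mvfderiv_inner_curve hv hp (r := 0) (by
    filter_upwards [hJ.mem_nhds hs] with t ht using hvp t ht)
  have h2 := mvfderiv_inner_curve hp hp (r := 1) (by
    filter_upwards [hJ.mem_nhds hs] with t ht
    rw [real_inner_self_eq_norm_sq, hpn t ht, one_pow])
  rw [hcp, real_inner_smul_left, real_inner_self_eq_norm_sq, hpn s hs] at h1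
  rw [real_inner_comm (p s)] at h2
  have h3 := eq_inner_smul_add_inner_smul (F := TangentSpace I (γ s)) hE (hγ.norm_velocity s hs)
    (hpn s hs) (hvp s hs) (covCurve I γ p s)
  have h4 : (inner ℝ (velocity I γ s) (covCurve I γ p s) : ℝ) = -κ := by linarith
  have h5 : (inner ℝ (p s) (covCurve I γ p s) : ℝ) = 0 := by linarith
  rw [h4, h5, zero_smul, add_zero, neg_smul] at h3
  exact h3

end CurvesOfConstantCurvature

noncomputable section HopfCylinderEigenfields

variable {M : Type*} [TopologicalSpace M] [ChartedSpace (EuclideanSpace ℝ (Fin 3)) M]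
  [IsManifold (𝓡 3) ∞ M]
  [RiemannianBundle (fun x : M ↦ TangentSpace (𝓡 3) x)]
  [IsContMDiffRiemannianBundle (𝓡 3) ∞ (EuclideanSpace ℝ (Fin 3))
      (fun x : M ↦ TangentSpace (𝓡 3) x)]
  {B : Type*} [TopologicalSpace B] [ChartedSpace (EuclideanSpace ℝ (Fin 2)) B]
  [IsManifold (𝓡 2) ∞ B]
  [RiemannianBundle (fun x : B ↦ TangentSpace (𝓡 2) x)]
  [IsContMDiffRiemannianBundle (𝓡 2) ∞ (EuclideanSpace ℝ (Fin 2))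
      (fun x : B ↦ TangentSpace (𝓡 2) x)]
  {S : Type*} [TopologicalSpace S] [ChartedSpace (EuclideanSpace ℝ (Fin 2)) S]
  [IsManifold (𝓡 2) ∞ S]
  [RiemannianBundle (fun x : S ↦ TangentSpace (𝓡 2) x)]
  [IsContMDiffRiemannianBundle (𝓡 2) ∞ (EuclideanSpace ℝ (Fin 2))
      (fun x : S ↦ TangentSpace (𝓡 2) x)]
  {ξ : Π x : M, TangentSpace (𝓡 3) x} {η : Π x : M, TangentSpace (𝓡 3) x →L[ℝ] ℝ}
  {φ : Π x : M, TangentSpace (𝓡 3) x →L[ℝ] TangentSpace (𝓡 3) x} {pr : M → B}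
  {J : Set ℝ} {γ : ℝ → B} {ι : S → M} {σ : S → ℝ} {x : S}

/-- If the mean curvature vector field of a Hopf cylinder is an eigenfield of the Jacobi operator,
then the base curve has constant curvature. -/
theorem IsHopfCylinder.exists_norm_covCurve_eq (hι : IsHopfCylinder pr γ J ι)
    (hpr : IsBoothbyWangFibration ξ pr) (hs : IsSasakian (𝓡 3) ξ η φ) {c l : ℝ}
    (hc : HasConstHolSectionalCurvature (𝓡 3) φ c) (hJ : IsOpen J) (hJ' : J.OrdConnected)
    (hγ : IsUnitSpeedOn (𝓡 2) γ J)
    (hl : ∀ x : S, jacobiOperator (𝓡 3) (𝓡 2) ι (meanCurvatureVector (𝓡 3) (𝓡 2) ι) x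
      = l • meanCurvatureVector (𝓡 3) (𝓡 2) ι x) :
    ∃ K : ℝ, ∀ s ∈ J, ‖covCurve (𝓡 2) γ (velocity (𝓡 2) γ) s‖ ^ 2 = K := by
  set k : ℝ → ℝ := fun s ↦ ‖covCurve (𝓡 2) γ (velocity (𝓡 2) γ) s‖ ^ 2 with hk
  have hks : ∀ s ∈ J, ContMDiffAt 𝓘(ℝ, ℝ) 𝓘(ℝ, ℝ) 1 k s := fun s hs ↦
    hγ.contMDiffAt_norm_covCurve_sq hJ hs
  have hd : ∀ s ∈ J, DifferentiableAt ℝ k s := fun s hs ↦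
    ((hks s hs).mdifferentiableAt one_ne_zero).differentiableAt
  have h0 : ∀ s ∈ J, deriv k s = 0 := by
    intro s hsJ
    obtain ⟨p, hp⟩ := hpr.surjective (γ s)
    obtain ⟨x, σ, -, rfl, hσ⟩ := hι.exists_point s hsJ p hp
    obtain ⟨T, Ξ, hT, hTσ⟩ := hι.exists_isAdaptedFrameAt hpr hs hJ hγ hσ
    have h1 := (hT.of_jacobiOperator_eq hs hι.smooth hι.isometric finrank_euclideanSpace_fin
      finrank_euclideanSpace_fin hc hl).1
    have h2 := hι.eventually_fieldCurvature_sq hpr hs hJ hγ hσ hT hTσ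
    have h3 := mvfderiv_sq ((hT.contMDiffAt_fieldCurvature hs hι.smooth).mdifferentiableAt
      two_ne_zero) (T x)
    rw [h1, mul_zero, mul_zero, mvfderiv_congr (g' := k ∘ σ) h2] at h3
    have h4 := mvfderiv_comp_apply x ((hks _ hsJ).mdifferentiableAt one_ne_zero)
      (hσ.1.mdifferentiableAt (by simp)) (T x)
    have h5 : mfderiv (𝓡 2) 𝓘(ℝ, ℝ) σ x (T x) = (1 : ℝ) := hTσ.self_of_nhds
    rw [h3, h5] at h4
    have h6 : mvfderiv 𝓘(ℝ, ℝ) k (σ x) = fderiv ℝ k (σ x) := by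
      ext
      simp [mvfderiv]
      rfl
    rw [← fderiv_apply_one_eq_deriv, ← h6]
    exact h4.symm
  rcases J.eq_empty_or_nonempty with hJe | ⟨s₀, hs₀⟩
  · exact ⟨0, fun s hs ↦ absurd hs (by simp [hJe])⟩
  · exact ⟨k s₀, fun s hsJ ↦ hJ.is_const_of_deriv_eq_zero hJ'.isPreconnected
      (fun t ht ↦ (hd t ht).differentiableWithinAt) h0 hsJ hs₀⟩

end HopfCylinderEigenfields

theorem mainTheorem3
    {M : Type*} [EMetricSpace M] [ChartedSpace (EuclideanSpace ℝ (Fin 3)) M]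
    [IsManifold (𝓡 3) ∞ M] [RiemannianBundle (fun x : M ↦ TangentSpace (𝓡 3) x)]
    [IsContMDiffRiemannianBundle (𝓡 3) ∞ (EuclideanSpace ℝ (Fin 3))
      (fun x : M ↦ TangentSpace (𝓡 3) x)]
    [IsRiemannianManifold (𝓡 3) M]
    (ξ : Π x : M, TangentSpace (𝓡 3) x) (η : Π x : M, TangentSpace (𝓡 3) x →L[ℝ] ℝ)
    (φ : Π x : M, TangentSpace (𝓡 3) x →L[ℝ] TangentSpace (𝓡 3) x) (c : ℝ)
    (hM : IsSasakianSpaceForm (𝓡 3) ξ η φ c)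
    {B : Type*} [TopologicalSpace B] [T2Space B] [ChartedSpace (EuclideanSpace ℝ (Fin 2)) B]
    [IsManifold (𝓡 2) ∞ B] [RiemannianBundle (fun x : B ↦ TangentSpace (𝓡 2) x)]
    [IsContMDiffRiemannianBundle (𝓡 2) ∞ (EuclideanSpace ℝ (Fin 2))
      (fun x : B ↦ TangentSpace (𝓡 2) x)]
    (pr : M → B) (hpr : IsBoothbyWangFibration ξ pr)
    (J : Set ℝ) (hJ : IsOpen J) (hJ' : J.OrdConnected)
    (γ : ℝ → B) (hγ : IsUnitSpeedOn (𝓡 2) γ J)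
    {S : Type*} [TopologicalSpace S] [T2Space S] [ChartedSpace (EuclideanSpace ℝ (Fin 2)) S]
    [IsManifold (𝓡 2) ∞ S] [RiemannianBundle (fun x : S ↦ TangentSpace (𝓡 2) x)]
    [IsContMDiffRiemannianBundle (𝓡 2) ∞ (EuclideanSpace ℝ (Fin 2))
      (fun x : S ↦ TangentSpace (𝓡 2) x)]
    (ι : S → M) (hι : IsHopfCylinder pr γ J ι) :
    ((∃ l : ℝ, ∀ x : S, jacobiOperator (𝓡 3) (𝓡 2) ι (meanCurvatureVector (𝓡 3) (𝓡 2) ι) x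
        = l • meanCurvatureVector (𝓡 3) (𝓡 2) ι x) ↔
      IsGeodesicOn (𝓡 2) γ J ∨ IsRiemannianCircleOn (𝓡 2) γ J) ∧
    (∀ l : ℝ, (∀ x : S, jacobiOperator (𝓡 3) (𝓡 2) ι (meanCurvatureVector (𝓡 3) (𝓡 2) ι) x
        = l • meanCurvatureVector (𝓡 3) (𝓡 2) ι x) →
      ¬ IsGeodesicOn (𝓡 2) γ J →
      ∀ x : S, l = 4 * ‖meanCurvatureVector (𝓡 3) (𝓡 2) ι x‖ ^ 2 + 1 - c) := by
  have hs := hM.sasakian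
  have hc := hM.curvature
  have hE : Module.finrank ℝ (EuclideanSpace ℝ (Fin 3)) = 3 := finrank_euclideanSpace_fin
  have hE' : Module.finrank ℝ (EuclideanSpace ℝ (Fin 2)) = 2 := finrank_euclideanSpace_fin
  refine ⟨?_, fun l hl hg x ↦ ?_⟩
  · rw [hγ.isGeodesicOn_or_isRiemannianCircleOn_iff hJ hE']
    refine ⟨fun ⟨l, hl⟩ ↦ hι.exists_norm_covCurve_eq hpr hs hc hJ hJ' hγ hl, fun ⟨K, hK⟩ ↦
      ⟨K + 1 - c, fun x ↦ ?_⟩⟩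
    obtain ⟨σ, hσ⟩ := hι.exists_parameter x
    obtain ⟨T, Ξ, hT, hTσ⟩ := hι.exists_isAdaptedFrameAt hpr hs hJ hγ hσ
    refine hT.jacobiOperator_eq_of_sq_eq hs hι.smooth hι.isometric hE hE' hc ?_
    filter_upwards [hι.eventually_fieldCurvature_sq hpr hs hJ hγ hσ hT hTσ, hσ.2] with y hy hy'
    rw [hy, hK _ hy'.1]
  · obtain ⟨K, hK⟩ := hι.exists_norm_covCurve_eq hpr hs hc hJ hJ' hγ hl
    obtain ⟨σ, hσ⟩ := hι.exists_parameter x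
    obtain ⟨T, Ξ, hT, hTσ⟩ := hι.exists_isAdaptedFrameAt hpr hs hJ hγ hσ
    have hx := (hι.eventually_fieldCurvature_sq hpr hs hJ hγ hσ hT hTσ).self_of_nhds
    rw [hT.norm_meanCurvatureVector_sq hs hι.smooth hι.isometric hE hE']
    refine (hT.of_jacobiOperator_eq hs hι.smooth hι.isometric hE hE' hc hl).2 fun h0 ↦ hg ?_
    intro s hsJ
    rw [h0, hK _ hσ.2.self_of_nhds.1, zero_pow two_ne_zero] at hx
    have h1 := hK s hsJ
    rw [← hx] at h1
    exact norm_eq_zero.1 (pow_eq_zero_iff two_ne_zero |>.1 h1)
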